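/- **Terminology.** A relational signature is a set of relations, each with a positive arity; it has arity $\le a$ if all its relations do. Conjunctive queries (CQs) are Boolean and may use constants. A tuple-generating dependency (TGD) is a constant-free sentence $\forall \vec x\,(\phi(\vec x)\to\exists \vec y\,\psi(\vec x,\vec y))$ with $\phi$ (the body) and $\psi$ (the head) conjunctions of relational atoms. Its *exported* variables are the body variables that occur in the head; its *width* is their number; its *head arity* is the number of variables used in the head. It is *full* if it has no existentially quantified variable, *guarded* (a GTGD) if some body atom (a *guard*) contains all body variables, *linear* if its body and its head each consist of a single atom (variables may be repeated), and an *inclusion dependency* (ID) if moreover neither of the two atoms has a repeated variable. A full GTGD has *side signature* $\mathcal S'$ if, for some choice of the guard atom, all other body atoms use relations of $\mathcal S'$. The *position graph* of a set of TGDs has the pairs (relation, position) as nodes, and an edge from $R[i]$ to $T[j]$ whenever some exported variable of some TGD of the set occurs at position $i$ of an $R$-atom of its body and at position $j$ of a $T$-atom of its head. A set of TGDs has *semi-width* $\le w$ if it is a union $\Sigma_1\cup\Sigma_2$ where all TGDs of $\Sigma_1$ have width $\le w$ and the position graph of $\Sigma_2$ has no directed cycle. For a set $\Sigma$ of TGDs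 and CQs $Q,Q'$, write $Q\subseteq_\Sigma Q'$ if every (finite or infinite) instance that satisfies $\Sigma$ and $Q$ also satisfies $Q'$. Finally, $|\Sigma|$ and $|Q|$ are the sizes of representations of $\Sigma$ and $Q$ as data; running times are those of a deterministic sequential machine model that is polynomially equivalent to Turing machines, and in the inputs it is marked which of the relations occurring in $\Sigma$ belong to $\mathcal S'$. **Theorem (generalized linearization).** For every $a'\in\mathbb N$ there are polynomials $P_1,P_2$ and two algorithms such that the following holds. Let $\mathcal S$ be a signature of arity $\le a$, let $\mathcal S'\subseteq\mathcal S$ be a subsignature with $n'$ relations, all of arity $\le a'$, and let $\Sigma$ be a finite set of constraints on $\mathcal S$, each of which is either a non-full ID of width $\le w$ or a full GTGD with side signature $\mathcal S'$ and head arity $\le h$. Then: 1. the first algorithm, given $\Sigma$, computes in time $P_1\bigl(|\Sigma|,\,2^{P_2(w,h,n')}\bigr)$ a finite set $\Sigma'$ of linear TGDs of semi-width $\le w$ on a signature of arity $\le a$ that extends $\mathcal S$ by new relations ($\Sigma'$ and this signature do not depend on any query); 2. the second algorithm, given $\Sigma$ and any CQ $Q$ on $\mathcal S$, computes in time $P_1\bigl(|\Sigma|,\,|Q|^{P_2(w,h,n')}\bigr)$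 a CQ $Q^{\mathrm{Lin}}$ on the extended signature; 3. for every CQ $Q$ on $\mathcal S$ and every CQ $Q'$ on $\mathcal S$: $\;Q\subseteq_\Sigma Q'$ if and only if $Q^{\mathrm{Lin}}\subseteq_{\Sigma'}Q'$. -/

import Mathlib

namespace Linearization

/-! ## Relational signatures, instances, conjunctive queries, dependencies -/

/-- Names of relations, of variables and of constants are bit strings. -/
abbrev Name : Type := List Bool

/-- A relational signature over relation symbols drawn from `R`: a set of relations, each with an
arity, which is a positive integer. -/
structure Signature (R : Type) where
  rels : Set R
  arity : R → ℕ
  arity_pos : ∀ r ∈ rels, 0 < arity r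

/-- An expression `r(t₁, …, tₙ)`; it is a fact if the `tᵢ` are values. -/
structure Atom (R T : Type) where
  rel : R
  args : List T

/-- Apply a map to the arguments of an atom. -/
def Atom.mapArgs {R T U : Type} (f : T → U) (A : Atom R T) : Atom R U := ⟨A.rel, A.args.map f⟩

/-- Rename the relation of an atom. -/
def Atom.mapRel {R R' T : Type} (f : R → R') (A : Atom R T) : Atom R' T := ⟨f A.rel, A.args⟩

/-- The atom is over the signature `S`: its relation is in `S` and is used with its arity. -/
def Atom.Over {R T : Type} (A : Atom R T) (S : Signature R) : Prop :=
  A.rel ∈ S.rels ∧ A.args.length = S.arity A.rel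

/-- The arguments of the atoms of a query are variables or constants. -/
inductive Term where
  | var (x : Name)
  | const (c : Name)

/-- The value of a term under an assignment `ν` of the variables, where `ι` places the constants
among the values. -/
def Term.eval {D : Type} (ι : Name ↪ D) (ν : Name → D) : Term → D
  | .var x => ν x
  | .const c => ι c

/-- A Boolean conjunctive query: all the variables of the listed atoms are existentially
quantified. -/
abbrev CQ (R : Type) : Type := List (Atom R Term)

/-- A tuple-generating dependency, given by the atoms of its body and of its head (without
constants). The variables of the body are universally quantified, the other variables of the head
are existentially quantified. -/
structure TGD (R : Type) where
  body : List (Atom R Name)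
  head : List (Atom R Name)

/-- An instance with values in `D`, as a (finite or infinite) set of facts. -/
abbrev Instance (R D : Type) : Type := Set (Atom R D)

/-- The query has a homomorphism to the instance which is the identity on constants. -/
def CQ.Holds {R D : Type} (ι : Name ↪ D) (Q : CQ R) (I : Instance R D) : Prop :=
  ∃ ν : Name → D, ∀ A ∈ Q, A.mapArgs (Term.eval ι ν) ∈ I

/-- The finite set of variables of a list of atoms. -/
def vars {R : Type} (L : List (Atom R Name)) : Finset Name := (L.flatMap Atom.args).toFinset

/-- The instance satisfies the dependency. -/
def TGD.Sat {R D : Type} (δ : TGD R) (I : Instance R D) : Prop :=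
  ∀ ν : Name → D, (∀ A ∈ δ.body, A.mapArgs ν ∈ I) →
    ∃ μ : Name → D, (∀ x ∈ vars δ.body, μ x = ν x) ∧ ∀ B ∈ δ.head, B.mapArgs μ ∈ I

/-- Containment `Q ⊆ Q'` under the constraints `C`, for the signature `S`: every instance of `S`
that satisfies `Q` and `C` also satisfies `Q'`. The values of an instance form an arbitrary set
in which distinct constants are distinct values. -/
def Contained {R : Type} (S : Signature R) (C : List (TGD R)) (Q Q' : CQ R) : Prop :=
  ∀ (D : Type) (ι : Name ↪ D) (I : Instance R D), (∀ F ∈ I, F.Over S) →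
    (∀ δ ∈ C, δ.Sat I) → Q.Holds ι I → Q'.Holds ι I

/-- The query is over the signature `S`. -/
def CQ.Over {R : Type} (Q : CQ R) (S : Signature R) : Prop := ∀ A ∈ Q, A.Over S

/-- Rename the relations of a query. -/
def CQ.mapRel {R R' : Type} (f : R → R') (Q : CQ R) : CQ R' := List.map (Atom.mapRel f) Q

namespace TGD

variable {R : Type}

/-- The dependency is over the signature `S`. -/
def Over (δ : TGD R) (S : Signature R) : Prop :=
  (∀ A ∈ δ.body, A.Over S) ∧ ∀ B ∈ δ.head, B.Over S

/-- The exported variables: those of the body which occur in the head. -/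
def exported (δ : TGD R) : Finset Name := vars δ.body ∩ vars δ.head

/-- The width: the number of exported variables. -/
def width (δ : TGD R) : ℕ := δ.exported.card

/-- The head arity: the number of variables used in the head. -/
def headArity (δ : TGD R) : ℕ := (vars δ.head).card

/-- A full dependency has no existentially quantified variable. -/
def IsFull (δ : TGD R) : Prop := vars δ.head ⊆ vars δ.body

/-- The atom `A` is a guard: an atom of the body that contains all variables of the body. -/
def IsGuard (δ : TGD R) (A : Atom R Name) : Prop := A ∈ δ.body ∧ vars δ.body ⊆ A.args.toFinset

/-- Guarded dependencies. -/
def IsGuarded (δ : TGD R) : Prop := ∃ A, δ.IsGuard A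

/-- The dependency has side signature `side`: for some choice of the guard atom, all the other
atoms of the body use relations of `side`. -/
def HasSideSignature (δ : TGD R) (side : Set R) : Prop :=
  ∃ A, δ.IsGuard A ∧ ∀ B ∈ δ.body, B ≠ A → B.rel ∈ side

/-- Linear dependencies: one body atom and one head atom, with repetitions of variables allowed. -/
def IsLinear (δ : TGD R) : Prop := ∃ A B, δ.body = [A] ∧ δ.head = [B]

/-- Inclusion dependencies: one body atom and one head atom, none of them with a repeated
variable. -/
def IsID (δ : TGD R) : Prop :=
  ∃ A B, δ.body = [A] ∧ δ.head = [B] ∧ A.args.Nodup ∧ B.args.Nodup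

end TGD

/-- The edges of the basic position graph of a set of dependencies. A position is a relation with
an index; there is an edge from `p` to `q` if an exported variable of some dependency occurs at
position `p` in its body and at position `q` in its head. -/
def PositionEdge {R : Type} (C : Set (TGD R)) (p q : R × ℕ) : Prop :=
  ∃ δ ∈ C, ∃ x ∈ δ.exported,
    (∃ A ∈ δ.body, A.rel = p.1 ∧ A.args[p.2]? = some x) ∧
    ∃ B ∈ δ.head, B.rel = q.1 ∧ B.args[q.2]? = some x

/-- The basic position graph has no directed cycle. -/
def AcyclicPositions {R : Type} (C : Set (TGD R)) : Prop :=
  ∀ p, ¬ Relation.TransGen (PositionEdge C) p p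

/-- Semi-width at most `w`: the set is a union of a set of dependencies of width at most `w` and of
a set of dependencies with an acyclic position graph. -/
def SemiWidthLE {R : Type} (C : Set (TGD R)) (w : ℕ) : Prop :=
  ∃ C₁ C₂ : Set (TGD R), C = C₁ ∪ C₂ ∧ (∀ δ ∈ C₁, δ.width ≤ w) ∧ AcyclicPositions C₂

/-! ## The model of computation

Programs of a while language over binary trees (the data of pure Lisp). Each elementary operation
costs as much as the size of the data that it handles, so that the time of a run bounds the size of
all the data that occur in it; such programs and Turing machines simulate each other with
polynomial overhead. -/

/-- Binary trees, the data of programs. -/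
inductive Data where
  | nil
  | node (l r : Data)

/-- The number of nodes and leaves. -/
def Data.size : Data → ℕ
  | .nil => 1
  | .node l r => l.size + r.size + 1

/-- The left subtree (of `nil`: `nil`). -/
def Data.left : Data → Data
  | .nil => .nil
  | .node l _ => l

/-- The right subtree (of `nil`: `nil`). -/
def Data.right : Data → Data
  | .nil => .nil
  | .node _ r => r

/-- Programs; each one transforms a tree. -/
inductive Prog where
  /-- return the input -/
  | id
  /-- return `nil` -/
  | nil
  /-- return the left subtree of the input -/
  | left
  /-- return the right subtree of the input -/
  | right
  /-- run both programs on the input and join the results -/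
  | pair (p q : Prog)
  /-- run the first program, then the second one on its result -/
  | seq (p q : Prog)
  /-- if the test `c` does not return `nil` on the input, run `p` on the input, else run `q` -/
  | ite (c p q : Prog)
  /-- as long as the test `c` does not return `nil` on the current tree, replace that tree by the
  result of `p` on it -/
  | loop (c p : Prog)

/-- `Run p x y t`: the program `p` halts on `x` with result `y`, in time `t`. -/
inductive Run : Prog → Data → Data → ℕ → Prop
  | id (x : Data) : Run .id x x x.size
  | nil (x : Data) : Run .nil x .nil x.size
  | left (x : Data) : Run .left x x.left x.size
  | right (x : Data) : Run .right x x.right x.size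
  | pair {p q : Prog} {x y z : Data} {s t : ℕ} (hp : Run p x y s) (hq : Run q x z t) :
      Run (.pair p q) x (.node y z) (s + t + 1)
  | seq {p q : Prog} {x y z : Data} {s t : ℕ} (hp : Run p x y s) (hq : Run q y z t) :
      Run (.seq p q) x z (s + t + 1)
  | ite_true {c p q : Prog} {x u v y : Data} {s t : ℕ} (hc : Run c x (.node u v) s)
      (hp : Run p x y t) : Run (.ite c p q) x y (s + t + 1)
  | ite_false {c p q : Prog} {x y : Data} {s t : ℕ} (hc : Run c x .nil s)
      (hq : Run q x y t) : Run (.ite c p q) x y (s + t + 1)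
  | loop_stop {c p : Prog} {x : Data} {s : ℕ} (hc : Run c x .nil s) :
      Run (.loop c p) x x (s + x.size + 1)
  | loop_step {c p : Prog} {x u v y z : Data} {s t r : ℕ} (hc : Run c x (.node u v) s)
      (hp : Run p x y t) (hl : Run (.loop c p) y z r) : Run (.loop c p) x z (s + t + r + 1)

/-- The program `p` computes `y` from `x` in time at most `T`. -/
def ComputesWithin (p : Prog) (x y : Data) (T : ℕ) : Prop := ∃ t ≤ T, Run p x y t

/-! ## Representation of constraints and queries as data -/

def encBool : Bool → Data
  | false => .nil
  | true => .node .nil .nil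

def encList {α : Type} (e : α → Data) : List α → Data
  | [] => .nil
  | a :: l => .node (e a) (encList e l)

def encName : Name → Data := encList encBool

def encTerm : Term → Data
  | .var x => .node (encBool false) (encName x)
  | .const c => .node (encBool true) (encName c)

/-- The name of a relation together with a bit that tells whether it is in the side signature. -/
def encMarked (side : Finset Name) (r : Name) : Data := .node (encBool (decide (r ∈ side))) (encName r)

/-- The names of the relations of an extended signature: `Sum.inl` are the original relations,
`Sum.inr` are new ones. -/
def encExt : Name ⊕ Name → Data
  | .inl r => .node (encBool false) (encName r)
  | .inr r => .node (encBool true) (encName r)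

def encAtom {R T : Type} (eR : R → Data) (eT : T → Data) (A : Atom R T) : Data :=
  .node (eR A.rel) (encList eT A.args)

def encTGD {R : Type} (eR : R → Data) (δ : TGD R) : Data :=
  .node (encList (encAtom eR encName) δ.body) (encList (encAtom eR encName) δ.head)

def encTGDs {R : Type} (eR : R → Data) (C : List (TGD R)) : Data := encList (encTGD eR) C

def encCQ {R : Type} (eR : R → Data) (Q : CQ R) : Data := encList (encAtom eR encTerm) Q

/-- The size of a set of constraints: the size of its representation. -/
def constraintsSize (C : List (TGD Name)) : ℕ := (encTGDs encName C).size

/-- The size of a query: the size of its representation. -/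
def querySize (Q : CQ Name) : ℕ := (encCQ encName Q).size

/-- The signature `T` extends `S` by new relations. -/
def Extends (T : Signature (Name ⊕ Name)) (S : Signature Name) : Prop :=
  (∀ r, Sum.inl r ∈ T.rels ↔ r ∈ S.rels) ∧ ∀ r ∈ S.rels, T.arity (Sum.inl r) = S.arity r

/-- The allowed constraints: non-full inclusion dependencies of width at most `w`, and full guarded
dependencies with side signature `side` and head arity at most `h`, all over the signature `S`. -/
def Admissible (S : Signature Name) (side : Finset Name) (w h : ℕ) (C : List (TGD Name)) : Prop :=
  ∀ δ ∈ C, δ.Over S ∧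
    ((δ.IsID ∧ ¬ δ.IsFull ∧ δ.width ≤ w) ∨
      (δ.IsFull ∧ δ.IsGuarded ∧ δ.HasSideSignature (side : Set Name) ∧ δ.headArity ≤ h))

end Linearization

/-!
# Linearization of inclusion dependencies and full guarded dependencies

Given a full guarded dependency, the only body atoms besides its guard are side atoms. So in the
chase, where every fact generated by an inclusion dependency opens a bag below the bag of the fact
that generates it, what can be derived in a bag depends only on the generated fact and on the side
facts about the values which it shares with its parent. This information is finite: a *type*
(`types`) is an inclusion dependency, with some exported variables identified, together with a set
of side atoms on the exported variables. There are at most `w ^ w * 2 ^ (n' * (w + 1) ^ a')` types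
for each inclusion dependency.

*The linear constraints.* Information also flows upwards, as a bag may derive new side facts about
the values of its parent. This is anticipated by full dependencies which derive these side facts in
the parent (`derived`); `rules` is the least list that contains the full constraints and is closed
under this derivation. Each type `τ` has two new relations, named by a serialization of `τ`. A
trigger fact of `τ` says that some fact matches the guard of `τ` and that the side atoms of `τ`
hold; a generated fact of `τ` is the fact that results from it. The linear constraints
(`linearized`) lead from triggers to generated facts and from a generated fact to each fact of
the closure of `τ`, including the triggers in it (`annotate`). The first kind has width at most `w`,
and for the second kind all edges of the position graph go from relations of generated facts to
other relations. The query is replaced by its annotated closure.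

*Correctness* (`contained_iff`). If an instance satisfies the constraints and the query, then the
new relations can be given their intended meaning (`expansion`). For the converse there is a tree
model `Obj.model` of the query and the constraints, with a bag for every sequence of choices of a
type and of a match of its guard. The model satisfies the full constraints, because a side fact that
holds in any bag holds in every bag that contains its values (`Obj.side_fact_local`); and it has a
homomorphism to every instance of the linear constraints that satisfies the annotated query
(`Obj.homAt`).

*Running time.* `PTime M x y` says that one program computes the tree `y i` from the tree `x i` in
time polynomial in `M i`, uniformly over a family of indices `i`. Closure properties of `PTime`, for
list operations, loops and saturation, reduce the running time to bounds for the sizes of the lists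
that occur. The only bound that needs an idea is the one for the closure of a list `X` of facts: its
size is polynomial up to a factor `(h + a' + 1) ^ h`, though the arities are not bounded. If a full
constraint derives a fact from a fact of `X`, then that fact, and all that full constraints derive
from it in turn, has its arguments among the values of the head variables, of which there are at
most `h`; what full constraints derive from a side fact has its arguments among those of the side
fact, at most `a'` (`closureBound`). Finally `exponent` bounds the exponents of the three exponential
quantities.
-/

namespace Linearization

open Classical

/-! ### Polynomial time relative to a measure -/

/-- The family `f` is bounded by a fixed power of the measure `M`. -/
def PolyLE {ι : Type} (M f : ι → ℕ) : Prop := ∃ k : ℕ, ∀ i, f i ≤ (M i + 2) ^ k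

/-- One program computes `y i` from `x i`, for all indices `i`, in time polynomial in the measure
`M i`.

The index type is arbitrary: the index may carry objects on which the data depend but which the
program does not see. A program with several arguments is described by a fixed family `x` from which
each of the arguments can be computed; so the lemmas below have the form
`PTime M x y → PTime M x z`. -/
def PTime {ι : Type} (M : ι → ℕ) (x y : ι → Data) : Prop :=
  ∃ (p : Prog) (k : ℕ), ∀ i, ComputesWithin p (x i) (y i) ((M i + 2) ^ k)

namespace PolyLE

variable {ι κ : Type} {M f g : ι → ℕ}

theorem mono (hf : PolyLE M f) (h : ∀ i, g i ≤ f i) : PolyLE M g :=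
  hf.imp fun _ hk i => (h i).trans (hk i)

theorem const (c : ℕ) : PolyLE M fun _ => c :=
  ⟨c, fun i => (Nat.lt_two_pow_self (n := c)).le.trans (Nat.pow_le_pow_left (by omega) c)⟩

theorem self : PolyLE M M := ⟨1, fun i => by simp⟩

theorem mul (hf : PolyLE M f) (hg : PolyLE M g) : PolyLE M fun i => f i * g i := by
  obtain ⟨k, hk⟩ := hf
  obtain ⟨l, hl⟩ := hg
  exact ⟨k + l, fun i => by rw [pow_add]; exact Nat.mul_le_mul (hk i) (hl i)⟩

theorem add (hf : PolyLE M f) (hg : PolyLE M g) : PolyLE M fun i => f i + g i := by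
  obtain ⟨k, hk⟩ := hf
  obtain ⟨l, hl⟩ := hg
  refine ⟨k + l + 1, fun i => ?_⟩
  have h1 : (M i + 2) ^ k ≤ (M i + 2) ^ (k + l) := Nat.pow_le_pow_right (by omega) (by omega)
  have h2 : (M i + 2) ^ l ≤ (M i + 2) ^ (k + l) := Nat.pow_le_pow_right (by omega) (by omega)
  have h3 : (M i + 2) ^ (k + l) * 2 ≤ (M i + 2) ^ (k + l + 1) := by
    rw [pow_succ]; exact Nat.mul_le_mul_left _ (by omega)
  have := hk i
  have := hl i
  dsimp only
  omega

theorem pow (hf : PolyLE M f) (n : ℕ) : PolyLE M fun i => f i ^ n := by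
  obtain ⟨k, hk⟩ := hf
  exact ⟨k * n, fun i => by rw [pow_mul]; exact Nat.pow_le_pow_left (hk i) n⟩

theorem on (hf : PolyLE M f) (r : κ → ι) : PolyLE (fun k => M (r k)) fun k => f (r k) :=
  hf.imp fun _ hk i => hk (r i)

end PolyLE

theorem Data.size_pos (x : Data) : 0 < x.size := by cases x <;> simp [Data.size]

theorem Data.size_left_le (x : Data) : x.left.size ≤ x.size := by
  cases x <;> simp [Data.size, Data.left]; omega

theorem Data.size_right_le (x : Data) : x.right.size ≤ x.size := by
  cases x <;> simp [Data.size, Data.right]; omega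

/-- The time of a run bounds the sizes of the input and of the output. -/
theorem Run.size_le {p : Prog} {x y : Data} {t : ℕ} (h : Run p x y t) :
    x.size ≤ t ∧ y.size ≤ t := by
  induction h with
  | id x => simp
  | nil x => exact ⟨le_rfl, x.size_pos⟩
  | left x => exact ⟨le_rfl, x.size_left_le⟩
  | right x => exact ⟨le_rfl, x.size_right_le⟩
  | pair => simp only [Data.size]; omega
  | seq => omega
  | ite_true => omega
  | ite_false => omega
  | loop_stop => omega
  | loop_step => omega

namespace PTime

variable {ι κ : Type} {M : ι → ℕ} {x y z : ι → Data}

theorem size_le (h : PTime M x y) : PolyLE M fun i => (y i).size := by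
  obtain ⟨p, k, h⟩ := h
  refine ⟨k, fun i => ?_⟩
  obtain ⟨t, ht, hr⟩ := h i
  exact hr.size_le.2.trans ht

theorem size_input_le (h : PTime M x y) : PolyLE M fun i => (x i).size := by
  obtain ⟨p, k, h⟩ := h
  refine ⟨k, fun i => ?_⟩
  obtain ⟨t, ht, hr⟩ := h i
  exact hr.size_le.1.trans ht

theorem of_polyLE (p : Prog) {T : ι → ℕ} (hT : PolyLE M T)
    (h : ∀ i, ComputesWithin p (x i) (y i) (T i)) : PTime M x y := by
  obtain ⟨k, hk⟩ := hT
  refine ⟨p, k, fun i => ?_⟩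
  obtain ⟨t, ht, hr⟩ := h i
  exact ⟨t, ht.trans (hk i), hr⟩

theorem id (hx : PolyLE M fun i => (x i).size) : PTime M x x :=
  of_polyLE .id hx fun _ => ⟨_, le_rfl, .id _⟩

theorem congr (h : PTime M x y) (hyz : ∀ i, y i = z i) : PTime M x z := by
  obtain rfl : y = z := funext hyz
  exact h

theorem trans (h : PTime M x y) (h' : PTime M y z) : PTime M x z := by
  obtain ⟨p, k, h⟩ := h
  obtain ⟨q, l, h'⟩ := h'
  refine of_polyLE (.seq p q) (T := fun i => (M i + 2) ^ k + (M i + 2) ^ l + 1)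
    (.add (.add ⟨k, fun _ => le_rfl⟩ ⟨l, fun _ => le_rfl⟩) (.const 1)) fun i => ?_
  obtain ⟨s, hs, hr⟩ := h i
  obtain ⟨t, ht, hr'⟩ := h' i
  exact ⟨_, by omega, .seq hr hr'⟩

theorem pair (h : PTime M x y) (h' : PTime M x z) : PTime M x fun i => .node (y i) (z i) := by
  obtain ⟨p, k, h⟩ := h
  obtain ⟨q, l, h'⟩ := h'
  refine of_polyLE (.pair p q) (T := fun i => (M i + 2) ^ k + (M i + 2) ^ l + 1)
    (.add (.add ⟨k, fun _ => le_rfl⟩ ⟨l, fun _ => le_rfl⟩) (.const 1)) fun i => ?_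
  obtain ⟨s, hs, hr⟩ := h i
  obtain ⟨t, ht, hr'⟩ := h' i
  exact ⟨_, by omega, .pair hr hr'⟩

theorem left (h : PTime M x y) : PTime M x fun i => (y i).left :=
  h.trans (of_polyLE .left h.size_le fun _ => ⟨_, le_rfl, .left _⟩)

theorem right (h : PTime M x y) : PTime M x fun i => (y i).right :=
  h.trans (of_polyLE .right h.size_le fun _ => ⟨_, le_rfl, .right _⟩)

/-- Every fixed tree can be computed. -/
theorem const (hx : PolyLE M fun i => (x i).size) (d : Data) : PTime M x fun _ => d := by
  induction d with
  | nil => exact of_polyLE .nil hx fun _ => ⟨_, le_rfl, .nil _⟩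
  | node l r hl hr => exact hl.pair hr

/-- Restriction to a subfamily of the indices. -/
theorem reindex (h : PTime M x y) (r : κ → ι) :
    PTime (fun k => M (r k)) (fun k => x (r k)) fun k => y (r k) :=
  let ⟨p, k, h⟩ := h
  ⟨p, k, fun i => h (r i)⟩

/-- Weakening: what can be computed from `x` can be computed from everything that computes `x`. -/
theorem on {r : κ → ι} {w : κ → Data} (hw : PTime (fun k => M (r k)) w fun k => x (r k))
    (h : PTime M x y) : PTime (fun k => M (r k)) w fun k => y (r k) :=
  hw.trans (h.reindex r)

/-- A case distinction by a computable test, where the running time in each case is analysed only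
on the indices to which the case applies. -/
theorem cond_cases {b : ι → Bool} (hb : PTime M x fun i => encBool (b i))
    (h1 : PTime (fun i : {i // b i = true} => M i.1) (fun i => x i.1) fun i => y i.1)
    (h2 : PTime (fun i : {i // b i = false} => M i.1) (fun i => x i.1) fun i => y i.1) :
    PTime M x y := by
  obtain ⟨c, k, hc⟩ := hb
  obtain ⟨p, l, hp⟩ := h1
  obtain ⟨q, m, hq⟩ := h2
  refine of_polyLE (.ite c p q) (T := fun i => (M i + 2) ^ k + (M i + 2) ^ l + (M i + 2) ^ m + 1)
    (.add (.add (.add ⟨k, fun _ => le_rfl⟩ ⟨l, fun _ => le_rfl⟩) ⟨m, fun _ => le_rfl⟩)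
      (.const 1)) fun i => ?_
  obtain ⟨s, hs, hr⟩ := hc i
  cases hbi : b i with
  | true =>
    obtain ⟨t, ht, hr'⟩ := hp ⟨i, hbi⟩
    simp only [hbi] at hr
    exact ⟨_, by dsimp only at ht; omega, .ite_true hr hr'⟩
  | false =>
    obtain ⟨t, ht, hr'⟩ := hq ⟨i, hbi⟩
    simp only [hbi] at hr
    exact ⟨_, by dsimp only at ht; omega, .ite_false hr hr'⟩

theorem cond {b : ι → Bool} (hb : PTime M x fun i => encBool (b i)) (h1 : PTime M x y)
    (h2 : PTime M x z) : PTime M x fun i => if b i = true then y i else z i :=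
  cond_cases hb ((h1.reindex _).congr fun i => by simp [i.2])
    ((h2.reindex _).congr fun i => by simp [i.2])

end PTime

/-- At most `n` rounds of a loop with test `c` and body `f`. -/
def runWhile {β : Type} (c : β → Bool) (f : β → β) : ℕ → β → β
  | 0, s => s
  | n + 1, s => if c s = true then runWhile c f n (f s) else s

theorem runWhile_of_false {β : Type} {c : β → Bool} {f : β → β} {s : β} (h : c s = false) (n : ℕ) :
    runWhile c f n s = s := by
  cases n <;> simp [runWhile, h]

/-- A loop that stops within polynomially many rounds runs in polynomial time, if its test and its
body do so on all states that satisfy an invariant. -/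
theorem PTime.while {ι β : Type} {M : ι → ℕ} (e : ι → β → Data) (c : ι → β → Bool)
    (f : ι → β → β) (Inv : ι → β → Prop) (s : ι → β) {N : ι → ℕ} (hN : PolyLE M N)
    (h0 : ∀ i, Inv i (s i)) (hInv : ∀ i b, Inv i b → c i b = true → Inv i (f i b))
    (hfinal : ∀ i, c i (runWhile (c i) (f i) (N i) (s i)) = false)
    (hc : PTime (fun p : {p : ι × β // Inv p.1 p.2} => M p.1.1) (fun p => e p.1.1 p.1.2)
      fun p => encBool (c p.1.1 p.1.2))
    (hf : PTime (fun p : {p : ι × β // Inv p.1 p.2 ∧ c p.1 p.2 = true} => M p.1.1)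
      (fun p => e p.1.1 p.1.2) fun p => e p.1.1 (f p.1.1 p.1.2)) :
    PTime M (fun i => e i (s i)) fun i => e i (runWhile (c i) (f i) (N i) (s i)) := by
  obtain ⟨pc, kc, hc⟩ := hc
  obtain ⟨pf, kf, hf⟩ := hf
  have key : ∀ i (n : ℕ) (b : β), Inv i b → c i (runWhile (c i) (f i) n b) = false →
      ComputesWithin (.loop pc pf) (e i b) (e i (runWhile (c i) (f i) n b))
        (n * ((M i + 2) ^ kc + (M i + 2) ^ kf + 1) + (2 * (M i + 2) ^ kc + 1)) := by
    intro i n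
    induction n with
    | zero =>
      intro b hb hs
      obtain ⟨t, ht, hr⟩ := hc ⟨(i, b), hb⟩
      simp only [runWhile] at hs ⊢
      dsimp only at ht hr
      rw [hs] at hr
      have := hr.size_le.1
      exact ⟨_, by omega, Run.loop_stop hr⟩
    | succ n ih =>
      intro b hb hs
      obtain ⟨t, ht, hr⟩ := hc ⟨(i, b), hb⟩
      dsimp only at ht hr
      cases hcb : c i b with
      | false =>
        rw [runWhile_of_false hcb]
        rw [hcb] at hr
        have := hr.size_le.1
        exact ⟨_, by omega, Run.loop_stop hr⟩
      | true =>
        obtain ⟨t', ht', hr'⟩ := hf ⟨(i, b), hb, hcb⟩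
        dsimp only at ht' hr'
        simp only [runWhile, hcb, if_true] at hs ⊢
        obtain ⟨u, hu, hl⟩ := ih _ (hInv i b hb hcb) hs
        rw [hcb] at hr
        refine ⟨_, ?_, .loop_step hr hr' hl⟩
        rw [Nat.succ_mul]
        omega
  refine of_polyLE (.loop pc pf) ?_ fun i => key i (N i) (s i) (h0 i) (hfinal i)
  exact .add (.mul hN (.add (.add ⟨kc, fun _ => le_rfl⟩ ⟨kf, fun _ => le_rfl⟩) (.const 1)))
    (.add (.mul (.const 2) ⟨kc, fun _ => le_rfl⟩) (.const 1))

/-! ### Lists -/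

section Lists

variable {α β : Type}

theorem size_encList (e : α → Data) (l : List α) :
    (encList e l).size = 1 + (l.map fun a => (e a).size + 1).sum := by
  induction l with
  | nil => simp [encList, Data.size]
  | cons a l ih => simp [encList, Data.size, ih]; omega

theorem encList_injective {e : α → Data} (he : Function.Injective e) :
    Function.Injective (encList e) := by
  intro l
  induction l with
  | nil => intro l' h; cases l' with
    | nil => rfl
    | cons => simp [encList] at h
  | cons a l ih => intro l' h; cases l' with
    | nil => simp [encList] at h
    | cons a' l' =>
      simp only [encList, Data.node.injEq] at h
      rw [he h.1, ih h.2]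

theorem encBool_injective : Function.Injective encBool := by
  intro a b; cases a <;> cases b <;> simp [encBool]

theorem encName_injective : Function.Injective encName := encList_injective encBool_injective

theorem length_le_size_encList (e : α → Data) (l : List α) : l.length ≤ (encList e l).size := by
  induction l with
  | nil => simp
  | cons a l ih => simp [encList, Data.size]; omega

theorem size_le_size_encList (e : α → Data) {l : List α} {a : α} (h : a ∈ l) :
    (e a).size ≤ (encList e l).size := by
  induction l with
  | nil => simp at h
  | cons b l ih =>
    simp only [encList, Data.size]
    rcases List.mem_cons.1 h with rfl | h
    · omega
    · have := ih h; omega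

theorem size_encList_le (e : α → Data) (l : List α) {n : ℕ} (h : ∀ a ∈ l, (e a).size ≤ n) :
    (encList e l).size ≤ 1 + l.length * (n + 1) := by
  induction l with
  | nil => simp [encList, Data.size]
  | cons b l ih =>
    simp only [encList, Data.size, List.length_cons]
    have := h b (by simp)
    have := ih fun a ha => h a (by simp [ha])
    rw [Nat.succ_mul]; omega

theorem size_encList_append (e : α → Data) (l l' : List α) :
    (encList e (l ++ l')).size + 1 = (encList e l).size + (encList e l').size := by
  simp only [size_encList, List.map_append, List.sum_append]; omega

theorem size_encList_le_of_suffix (e : α → Data) {l l' : List α} (h : l <:+ l') :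
    (encList e l).size ≤ (encList e l').size := by
  obtain ⟨m, rfl⟩ := h
  have := size_encList_append e m l
  have := (encList e m).size_pos
  omega

theorem size_encList_le_of_prefix (e : α → Data) {l l' : List α} (h : l <+: l') :
    (encList e l).size ≤ (encList e l').size := by
  obtain ⟨m, rfl⟩ := h
  have := size_encList_append e l m
  have := (encList e m).size_pos
  omega

end Lists

namespace PTime

variable {ι α β γ : Type} {M : ι → ℕ} {x : ι → Data} {e : ι → α → Data} {e' : ι → β → Data}

theorem constTrue (hx : PolyLE M fun i => (x i).size) : PTime M x fun _ => encBool true :=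
  const hx _

theorem constFalse (hx : PolyLE M fun i => (x i).size) : PTime M x fun _ => encBool false :=
  const hx _

theorem listNil (hx : PolyLE M fun i => (x i).size) : PTime M x fun i => encList (e i) [] :=
  const hx .nil

theorem cons {a : ι → α} {l : ι → List α} (ha : PTime M x fun i => e i (a i))
    (hl : PTime M x fun i => encList (e i) (l i)) :
    PTime M x fun i => encList (e i) (a i :: l i) := ha.pair hl

theorem singleton {a : ι → α} (ha : PTime M x fun i => e i (a i)) :
    PTime M x fun i => encList (e i) [a i] := ha.pair (const ha.size_input_le .nil)

theorem tail {l : ι → List α} (hl : PTime M x fun i => encList (e i) (l i)) :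
    PTime M x fun i => encList (e i) (l i).tail :=
  hl.right.congr fun i => by cases l i <;> rfl

theorem not {b : ι → Bool} (hb : PTime M x fun i => encBool (b i)) :
    PTime M x fun i => encBool (!b i) :=
  (hb.cond (constFalse hb.size_input_le) (constTrue hb.size_input_le)).congr fun i => by
    cases b i <;> rfl

theorem and {b c : ι → Bool} (hb : PTime M x fun i => encBool (b i))
    (hc : PTime M x fun i => encBool (c i)) : PTime M x fun i => encBool (b i && c i) :=
  (hb.cond hc (constFalse hb.size_input_le)).congr fun i => by cases b i <;> simp

theorem isNode {y : ι → Data} (h : PTime M x y) :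
    PTime M x fun i => encBool (decide (y i ≠ .nil)) := by
  obtain ⟨p, k, hp⟩ := h
  refine of_polyLE (.ite p (.pair .nil .nil) .nil)
    (T := fun i => (M i + 2) ^ k + ((M i + 2) ^ k + (M i + 2) ^ k + 1) + 1)
    (.add (.add ⟨k, fun _ => le_rfl⟩ (.add (.add ⟨k, fun _ => le_rfl⟩ ⟨k, fun _ => le_rfl⟩)
      (.const 1))) (.const 1)) fun i => ?_
  obtain ⟨t, ht, hr⟩ := hp i
  have := hr.size_le.1
  cases hy : y i with
  | nil =>
    rw [hy] at hr
    exact ⟨t + (x i).size + 1, by omega, by simpa [encBool] using Run.ite_false hr (.nil _)⟩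
  | node u v =>
    rw [hy] at hr
    exact ⟨t + ((x i).size + (x i).size + 1) + 1, by omega,
      by simpa [encBool] using Run.ite_true hr (.pair (.nil _) (.nil _))⟩

theorem isEmpty {l : ι → List α} (hl : PTime M x fun i => encList (e i) (l i)) :
    PTime M x fun i => encBool (l i).isEmpty :=
  hl.isNode.not.congr fun i => by cases l i <;> simp [encList]

/-- Left folds are computable in polynomial time, if their values stay polynomially bounded.

The body `f` of the fold is analysed on an enlarged index type, whose members consist of an index, a
prefix of the list and the next element; `z` is any family from which the input, the element and
the value reached so far can be computed. -/
theorem foldl {l : ι → List α} {s : ι → β} (f : ι → β → α → β)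
    (hl : PTime M x fun i => encList (e i) (l i)) (hs : PTime M x fun i => e' i (s i))
    (hsize : PolyLE (fun p : {p : ι × List α // p.2 <+: l p.1} => M p.1.1)
      fun p => (e' p.1.1 (p.1.2.foldl (f p.1.1) (s p.1.1))).size)
    (hf : ∀ z : {p : ι × List α × α // p.2.1 ++ [p.2.2] <+: l p.1} → Data,
      PTime (fun p => M p.1.1) z (fun p => x p.1.1) →
      PTime (fun p => M p.1.1) z (fun p => e p.1.1 p.1.2.2) →
      PTime (fun p => M p.1.1) z (fun p => e' p.1.1 (p.1.2.1.foldl (f p.1.1) (s p.1.1))) →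
      PTime (fun p => M p.1.1) z
        (fun p => e' p.1.1 (f p.1.1 (p.1.2.1.foldl (f p.1.1) (s p.1.1)) p.1.2.2))) :
    PTime M x fun i => e' i ((l i).foldl (f i) (s i)) := by
  let E : ι → List α × β → Data := fun i q => .node (x i) (.node (encList (e i) q.1) (e' i q.2))
  let c : ι → List α × β → Bool := fun _ q => !q.1.isEmpty
  let g : ι → List α × β → List α × β := fun i q =>
    match q with
    | ([], b) => ([], b)
    | (a :: r, b) => (r, f i b a)
  let Inv : ι → List α × β → Prop := fun i q => ∃ l₁, l i = l₁ ++ q.1 ∧ q.2 = l₁.foldl (f i) (s i)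
  have hx := hl.size_input_le
  choose pre hpre hpre' using fun i q (h : Inv i q) => h
  have hE : PolyLE (fun p : {p : ι × (List α × β) // Inv p.1 p.2} => M p.1.1)
      fun p => (E p.1.1 p.1.2).size := by
    have h1 := hx.on (fun p : {p : ι × (List α × β) // Inv p.1 p.2} => p.1.1)
    have h2 := hl.size_le.on (fun p : {p : ι × (List α × β) // Inv p.1 p.2} => p.1.1)
    have h3 := hsize.on (fun p : {p : ι × (List α × β) // Inv p.1 p.2} =>
      (⟨(p.1.1, pre _ _ p.2), ⟨_, (hpre _ _ p.2).symm⟩⟩ :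
        {p : ι × List α // p.2 <+: l p.1}))
    refine ((h1.add ((h2.add h3).add (.const 1))).add (.const 1)).mono fun p => ?_
    have h4 := size_encList_le_of_suffix (e p.1.1) ⟨_, (hpre _ _ p.2).symm⟩
    simp only [E, Data.size]
    rw [← hpre' _ _ p.2]
    omega
  have hrun : ∀ i (r : List α) (b : β),
      runWhile (c i) (g i) r.length (r, b) = ([], r.foldl (f i) b) := by
    intro i r
    induction r with
    | nil => intro b; rfl
    | cons a r ih => intro b; simpa [runWhile, c, g] using ih _
  have hw := PTime.while (M := M) E c g Inv (fun i => (l i, s i)) (N := fun i => (l i).length)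
    (hl.size_le.mono fun i => length_le_size_encList _ _) (fun i => ⟨[], by simp⟩)
    (by
      rintro i ⟨r, b⟩ ⟨l₁, h1, h2⟩ hcb
      cases r with
      | nil => simp [c] at hcb
      | cons a r => exact ⟨l₁ ++ [a], by simpa using h1, by
          dsimp only at h2; simp [g, h2]⟩)
    (fun i => by rw [hrun]; rfl)
    (by
      have h := ((PTime.id hE).right.left).isNode
      refine h.congr fun p => ?_
      cases h : p.1.2.1 <;> simp [E, c, Data.left, Data.right, encList, h])
    (by
      let r : {p : ι × (List α × β) // Inv p.1 p.2 ∧ c p.1 p.2 = true} →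
          {p : ι × List α × α // p.2.1 ++ [p.2.2] <+: l p.1} := fun p =>
        ⟨(p.1.1, pre _ _ p.2.1, p.1.2.1.head fun h => by simpa [c, h] using p.2.2), by
          have h1 := hpre _ _ p.2.1
          have h2 : p.1.2.1 ≠ [] := fun h => by simpa [c, h] using p.2.2
          obtain ⟨a, t, ht⟩ := List.exists_cons_of_ne_nil h2
          refine ⟨t, Eq.trans ?_ h1.symm⟩
          simp [ht]⟩
      have hE' := hE.on (fun p : {p : ι × (List α × β) // Inv p.1 p.2 ∧ c p.1 p.2 = true} =>
        (⟨p.1, p.2.1⟩ : {p : ι × (List α × β) // Inv p.1 p.2}))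
      have hid := PTime.id hE'
      -- the index type of `hf` has all pairs of a prefix and a next element, whose data are
      -- computed from the state
      let z : {p : ι × List α × α // p.2.1 ++ [p.2.2] <+: l p.1} → Data := fun p =>
        .node (x p.1.1) (.node (e p.1.1 p.1.2.2) (e' p.1.1 (p.1.2.1.foldl (f p.1.1) (s p.1.1))))
      have hz : PolyLE (fun p : {p : ι × List α × α // p.2.1 ++ [p.2.2] <+: l p.1} => M p.1.1)
          fun p => (z p).size := by
        have h1 := hx.on (fun p : {p : ι × List α × α // p.2.1 ++ [p.2.2] <+: l p.1} => p.1.1)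
        have h2 := hl.size_le.on
          (fun p : {p : ι × List α × α // p.2.1 ++ [p.2.2] <+: l p.1} => p.1.1)
        have h3 := hsize.on (fun p : {p : ι × List α × α // p.2.1 ++ [p.2.2] <+: l p.1} =>
          (⟨(p.1.1, p.1.2.1), (List.prefix_append _ _).trans p.2⟩ :
            {p : ι × List α // p.2 <+: l p.1}))
        refine ((h1.add ((h2.add h3).add (.const 1))).add (.const 1)).mono fun p => ?_
        have h4 := size_le_size_encList (e p.1.1) (l := l p.1.1) (a := p.1.2.2)
          (p.2.subset (by simp))
        simp only [z, Data.size]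
        omega
      have hzid := PTime.id hz
      have hbody := (hf z hzid.left hzid.right.left hzid.right.right).reindex r
      have hzr : PTime (fun p : {p : ι × (List α × β) // Inv p.1 p.2 ∧ c p.1 p.2 = true} =>
          M p.1.1) (fun p => E p.1.1 p.1.2) fun p => z (r p) := by
        refine (hid.left.pair (hid.right.left.left.pair hid.right.right)).congr fun p => ?_
        have h2 : p.1.2.1 ≠ [] := fun h => by simpa [c, h] using p.2.2
        obtain ⟨a, t, ht⟩ := List.exists_cons_of_ne_nil h2
        have h3 := hpre' _ _ p.2.1
        simp only [E, Data.left, Data.right, z, r, ht, List.head_cons, encList]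
        exact congrArg (fun b => Data.node _ (.node _ (e' p.1.1 b))) h3
      refine (hid.left.pair (hid.right.left.right.pair (hzr.trans hbody))).congr fun p => ?_
      obtain ⟨⟨i, ⟨q, b⟩⟩, hi, hcb⟩ := p
      have hb := hpre' _ _ hi
      cases q with
      | nil => simp [c] at hcb
      | cons a t =>
        simp only [E, Data.left, Data.right, r, List.head_cons, encList, g]
        exact congrArg (fun b => Data.node _ (.node _ (e' i (f i b a)))) hb.symm)
  have hstart : PTime M x fun i => E i (l i, s i) := (PTime.id hx).pair (hl.pair hs)
  refine (hstart.trans hw).right.right.congr fun i => ?_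
  rw [hrun]
  rfl

theorem reverse {l : ι → List α} (hl : PTime M x fun i => encList (e i) (l i)) :
    PTime M x fun i => encList (e i) (l i).reverse := by
  have key : ∀ r t : List α, r.foldl (fun b a => a :: b) t = r.reverse ++ t := by
    intro r
    induction r with
    | nil => simp
    | cons a r ih => intro t; simp [ih]
  have h := hl.foldl (e' := fun i => encList (e i)) (s := fun _ => []) (fun _ b a => a :: b)
    (listNil hl.size_input_le)
    (by
      refine (hl.size_le.on (fun p : {p : ι × List α // p.2 <+: l p.1} => p.1.1)).mono fun p => ?_
      rw [key, List.append_nil]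
      refine le_trans (le_of_eq ?_) (size_encList_le_of_prefix _ p.2)
      simp [size_encList, List.sum_reverse])
    (fun z hx ha hb => ha.cons hb)
  exact h.congr fun i => by rw [key, List.append_nil]

theorem append {l l' : ι → List α} (hl : PTime M x fun i => encList (e i) (l i))
    (hl' : PTime M x fun i => encList (e i) (l' i)) :
    PTime M x fun i => encList (e i) (l i ++ l' i) := by
  have key : ∀ r t : List α, r.foldl (fun b a => a :: b) t = r.reverse ++ t := by
    intro r
    induction r with
    | nil => simp
    | cons a r ih => intro t; simp [ih]
  have h := hl.reverse.foldl (e' := fun i => encList (e i)) (s := l') (fun _ b a => a :: b)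
    hl'
    (by
      refine ((hl.size_le.add hl'.size_le).on
        (fun p : {p : ι × List α // p.2 <+: (l p.1).reverse} => p.1.1)).mono fun p => ?_
      have h1 := size_encList_append (e p.1.1) p.1.2.reverse (l' p.1.1)
      have h2 := size_encList_le_of_suffix (e p.1.1) (l := p.1.2.reverse) (l' := l p.1.1)
        (List.reverse_prefix.1 (by simpa using p.2))
      rw [key]
      omega)
    (fun z hx ha hb => ha.cons hb)
  exact h.congr fun i => by rw [key, List.reverse_reverse]

end PTime

/-- A proposition as data: its truth value. -/
noncomputable def encProp (P : Prop) : Data := encBool (@decide P (Classical.propDecidable P))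

/-- The sublist of the elements with the property `P`. -/
noncomputable def sel {α : Type} (P : α → Prop) (l : List α) : List α :=
  l.filter fun a => @decide (P a) (Classical.propDecidable (P a))

theorem mem_sel {α : Type} {P : α → Prop} {l : List α} {a : α} :
    a ∈ sel P l ↔ a ∈ l ∧ P a := by simp [sel]

theorem sel_sublist {α : Type} (P : α → Prop) (l : List α) : (sel P l).Sublist l :=
  List.filter_sublist

namespace PTime

variable {ι α β γ : Type} {M : ι → ℕ} {x : ι → Data} {e : ι → α → Data} {e' : ι → β → Data}

/-- The body `g` is analysed on an enlarged index type, whose members consist of an index and an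
element of the list; `z` is any family from which the input and the element can be computed. The
following lemmas on lists have their bodies in the same form. -/
theorem flatMap {l : ι → List α} (g : ι → α → List β)
    (hl : PTime M x fun i => encList (e i) (l i))
    (hg : ∀ z : {p : ι × α // p.2 ∈ l p.1} → Data,
      PTime (fun p => M p.1.1) z (fun p => x p.1.1) →
      PTime (fun p => M p.1.1) z (fun p => e p.1.1 p.1.2) →
      PTime (fun p => M p.1.1) z (fun p => encList (e' p.1.1) (g p.1.1 p.1.2))) :
    PTime M x fun i => encList (e' i) ((l i).flatMap (g i)) := by
  have key : ∀ i (r : List α) (b : List β),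
      r.foldl (fun b a => b ++ g i a) b = b ++ r.flatMap (g i) := by
    intro i r
    induction r with
    | nil => simp
    | cons a r ih => intro b; simp [ih]
  have hx := hl.size_input_le
  let z : {p : ι × α // p.2 ∈ l p.1} → Data := fun p => .node (x p.1.1) (e p.1.1 p.1.2)
  have hz : PTime (fun p : {p : ι × α // p.2 ∈ l p.1} => M p.1.1) z z := by
    refine .id (((hx.add hl.size_le).add (.const 1)).on
      (fun p : {p : ι × α // p.2 ∈ l p.1} => p.1.1) |>.mono fun p => ?_)
    have := size_le_size_encList (e p.1.1) p.2
    simp only [z, Data.size]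
    omega
  obtain ⟨k, hk⟩ := (hg z hz.left hz.right).size_le
  have h := hl.foldl (e' := fun i => encList (e' i)) (s := fun _ => [])
    (fun i b a => b ++ g i a) (listNil hx)
    (by
      refine ((PolyLE.const 1).add (hl.size_le.mul
        (show PolyLE M fun i => (M i + 2) ^ k from ⟨k, fun i => le_rfl⟩))).on
        (fun p : {p : ι × List α // p.2 <+: l p.1} => p.1.1) |>.mono fun p => ?_
      rw [key, List.nil_append]
      have hgen : ∀ r : List α, (∀ a ∈ r, a ∈ l p.1.1) →
          (encList (e' p.1.1) (r.flatMap (g p.1.1))).size ≤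
            1 + r.length * (M p.1.1 + 2) ^ k := by
        intro r
        induction r with
        | nil => simp [encList, Data.size]
        | cons a r ih =>
          intro hr
          have h1 := ih fun a ha => hr a (by simp [ha])
          have h2 := hk ⟨(p.1.1, a), hr a (by simp)⟩
          have h3 := size_encList_append (e' p.1.1) (g p.1.1 a) (r.flatMap (g p.1.1))
          dsimp only at h2
          rw [List.flatMap_cons, List.length_cons, Nat.succ_mul]
          omega
      have h1 := hgen p.1.2 p.2.subset
      have h2 := p.2.length_le.trans (length_le_size_encList (e p.1.1) _)
      have h3 := Nat.mul_le_mul_right ((M p.1.1 + 2) ^ k) h2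
      omega)
    (fun w hx' ha hb => by
      refine hb.append ?_
      let r : {p : ι × List α × α // p.2.1 ++ [p.2.2] <+: l p.1} → {p : ι × α // p.2 ∈ l p.1} :=
        fun p => ⟨(p.1.1, p.1.2.2), p.2.subset (by simp)⟩
      exact PTime.on (r := r) (hx'.pair ha) (hg z hz.left hz.right))
  exact h.congr fun i => by rw [key, List.nil_append]

theorem map {l : ι → List α} (g : ι → α → β)
    (hl : PTime M x fun i => encList (e i) (l i))
    (hg : ∀ z : {p : ι × α // p.2 ∈ l p.1} → Data,
      PTime (fun p => M p.1.1) z (fun p => x p.1.1) →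
      PTime (fun p => M p.1.1) z (fun p => e p.1.1 p.1.2) →
      PTime (fun p => M p.1.1) z (fun p => e' p.1.1 (g p.1.1 p.1.2))) :
    PTime M x fun i => encList (e' i) ((l i).map (g i)) :=
  (hl.flatMap (e' := e') (fun i a => [g i a])
    fun z hx ha => (hg z hx ha).singleton
      (e := fun p : {p : ι × α // p.2 ∈ l p.1} => e' p.1.1)).congr fun i => by
        simp [List.map_eq_flatMap]

theorem sel {l : ι → List α} (P : ι → α → Prop)
    (hl : PTime M x fun i => encList (e i) (l i))
    (hP : ∀ z : {p : ι × α // p.2 ∈ l p.1} → Data,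
      PTime (fun p => M p.1.1) z (fun p => x p.1.1) →
      PTime (fun p => M p.1.1) z (fun p => e p.1.1 p.1.2) →
      PTime (fun p => M p.1.1) z (fun p => encProp (P p.1.1 p.1.2))) :
    PTime M x fun i => encList (e i) (sel (P i) (l i)) := by
  have h := hl.flatMap (e' := e) (fun i a => if decide (P i a) = true then [a] else [])
    fun z hx ha => by
      have h := (hP z hx ha).cond
        (ha.singleton (e := fun p : {p : ι × α // p.2 ∈ l p.1} => e p.1.1))
        (listNil (e := fun p : {p : ι × α // p.2 ∈ l p.1} => e p.1.1) ha.size_input_le)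
      exact h.congr fun p => by split <;> rfl
  refine h.congr fun i => congrArg _ ?_
  unfold Linearization.sel
  induction l i with
  | nil => rfl
  | cons a r ih => by_cases h : P i a <;> simp_all

theorem propNot {P : ι → Prop} (h : PTime M x fun i => encProp (P i)) :
    PTime M x fun i => encProp (¬ P i) :=
  (PTime.not h).congr fun i => by simp [encProp]

theorem propAnd {P Q : ι → Prop} (h : PTime M x fun i => encProp (P i))
    (h' : PTime M x fun i => encProp (Q i)) : PTime M x fun i => encProp (P i ∧ Q i) :=
  (PTime.and h h').congr fun i => by simp [encProp]

theorem propCongr {P Q : ι → Prop} (h : PTime M x fun i => encProp (P i))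
    (h' : ∀ i, P i ↔ Q i) : PTime M x fun i => encProp (Q i) :=
  h.congr fun i => by rw [h' i]

theorem exists_mem {l : ι → List α} (P : ι → α → Prop)
    (hl : PTime M x fun i => encList (e i) (l i))
    (hP : ∀ z : {p : ι × α // p.2 ∈ l p.1} → Data,
      PTime (fun p => M p.1.1) z (fun p => x p.1.1) →
      PTime (fun p => M p.1.1) z (fun p => e p.1.1 p.1.2) →
      PTime (fun p => M p.1.1) z (fun p => encProp (P p.1.1 p.1.2))) :
    PTime M x fun i => encProp (∃ a ∈ l i, P i a) :=
  (hl.sel P hP).isEmpty.not.congr fun i => congrArg _ <| by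
    rw [Bool.eq_iff_iff]
    simp [Linearization.sel]

theorem forall_mem {l : ι → List α} (P : ι → α → Prop)
    (hl : PTime M x fun i => encList (e i) (l i))
    (hP : ∀ z : {p : ι × α // p.2 ∈ l p.1} → Data,
      PTime (fun p => M p.1.1) z (fun p => x p.1.1) →
      PTime (fun p => M p.1.1) z (fun p => e p.1.1 p.1.2) →
      PTime (fun p => M p.1.1) z (fun p => encProp (P p.1.1 p.1.2))) :
    PTime M x fun i => encProp (∀ a ∈ l i, P i a) :=
  (hl.exists_mem (fun i a => ¬ P i a) fun z hx ha => (hP z hx ha).propNot).propNot.propCongr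
    fun i => by simp

/-- One step of the comparison of two trees, on a stack of pairs that remain to be compared. -/
def eqStep : Bool × List (Data × Data) → Bool × List (Data × Data)
  | (b, []) => (b, [])
  | (_, (.nil, .nil) :: s) => (true, s)
  | (_, (.node a b, .node c d) :: s) => (true, (a, c) :: (b, d) :: s)
  | (_, (.nil, .node _ _) :: s) => (false, s)
  | (_, (.node _ _, .nil) :: s) => (false, s)

end PTime

/-- Pairs are represented by nodes. -/
def encPair {α β : Type} (e : α → Data) (e' : β → Data) (q : α × β) : Data :=
  .node (e q.1) (e' q.2)

namespace PTime

variable {ι α β γ : Type} {M : ι → ℕ} {x : ι → Data} {e : ι → α → Data} {e' : ι → β → Data}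

theorem runWhile_eqStep (n : ℕ) (s : List (Data × Data))
    (h : (s.map fun q => q.1.size).sum ≤ n) :
    (runWhile (fun q => q.1 && !q.2.isEmpty) eqStep n (true, s)).1 =
        decide (∀ q ∈ s, q.1 = q.2) ∧
      (fun q : Bool × List (Data × Data) => q.1 && !q.2.isEmpty)
        (runWhile (fun q => q.1 && !q.2.isEmpty) eqStep n (true, s)) = false := by
  induction n generalizing s with
  | zero =>
    cases s with
    | nil => simp [runWhile]
    | cons q s => have := q.1.size_pos; simp at h; omega
  | succ n ih =>
    cases s with
    | nil => simp [runWhile]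
    | cons q s =>
      obtain ⟨a, b⟩ := q
      cases a with
      | nil =>
        cases b with
        | nil =>
          have := ih s (by simp [Data.size] at h; omega)
          simpa [runWhile, eqStep] using this
        | node c d =>
          simp only [runWhile, eqStep]
          rw [if_pos (by simp), runWhile_of_false (by simp)]
          simp
      | node a₁ a₂ =>
        cases b with
        | nil =>
          simp only [runWhile, eqStep]
          rw [if_pos (by simp), runWhile_of_false (by simp)]
          simp
        | node c d =>
          have := ih ((a₁, c) :: (a₂, d) :: s) (by simp [Data.size] at h ⊢; omega)
          simpa [runWhile, eqStep, and_assoc] using this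

/-- Trees are compared with a stack of pairs of subtrees; every round removes a node or a leaf from
the left component of some pair, so that the size of the left tree bounds the number of rounds. -/
theorem eq_data {y z : ι → Data} (hy : PTime M x y) (hz : PTime M x z) :
    PTime M x fun i => encProp (y i = z i) := by
  let eP : Data × Data → Data := encPair (fun d => d) (fun d => d)
  let E : ι → Bool × List (Data × Data) → Data := fun _ q => encPair encBool (encList eP) q
  let Inv : ι → Bool × List (Data × Data) → Prop := fun i q =>
    (encList eP q.2).size ≤ (encList eP [(y i, z i)]).size
  have hstart : PTime M x fun i => E i (true, [(y i, z i)]) :=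
    (constTrue hy.size_input_le).pair ((hy.pair hz).pair (const hy.size_input_le .nil))
  have hsz : ∀ b : Bool, (encBool b).size ≤ 3 := by
    intro b; cases b <;> simp [encBool, Data.size]
  have hE : PolyLE (fun p : {p : ι × Bool × List (Data × Data) // Inv p.1 p.2} => M p.1.1)
      fun p => (E p.1.1 p.1.2).size := by
    refine (((hstart.size_le.add (.const 5))).on
      (fun p : {p : ι × Bool × List (Data × Data) // Inv p.1 p.2} => p.1.1)).mono fun p => ?_
    have h1 := p.2
    have h2 := hsz p.1.2.1
    simp only [Inv] at h1
    simp only [E, encPair, Data.size]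
    omega
  have hw := PTime.while (M := M) E (fun _ q => q.1 && !q.2.isEmpty) (fun _ => eqStep) Inv
    (fun i => (true, [(y i, z i)])) (N := fun i => (y i).size) hy.size_le
    (fun i => le_rfl)
    (by
      rintro i ⟨b, s⟩ hs -
      refine le_trans ?_ hs
      cases s with
      | nil => simp [eqStep]
      | cons q s =>
        obtain ⟨a, b⟩ := q
        cases a <;> cases b <;> simp [eqStep, encList, eP, encPair, Data.size] <;> omega)
    (fun i => (runWhile_eqStep _ _ (by simp)).2)
    (by
      have hid := PTime.id hE
      exact (hid.left.and (hid.right.isEmpty (e := fun _ => eP)).not))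
    (by
      have hE' := hE.on (fun p : {p : ι × Bool × List (Data × Data) //
        Inv p.1 p.2 ∧ (p.2.1 && !p.2.2.isEmpty) = true} =>
        (⟨p.1, p.2.1⟩ : {p : ι × Bool × List (Data × Data) // Inv p.1 p.2}))
      have hid := PTime.id hE'
      have hs := hid.right
      have h1 := hs.left.left
      have h2 := hs.left.right
      have ht := constTrue hE'
      have hf := constFalse hE'
      refine ((h1.isNode.cond
        (h2.isNode.cond (ht.pair ((h1.left.pair h2.left).pair ((h1.right.pair h2.right).pair
          hs.right))) (hf.pair hs.right))
        (h2.isNode.cond (hf.pair hs.right) (ht.pair hs.right)))).congr ?_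
      rintro ⟨⟨i, ⟨b, s⟩⟩, hs1, hs2⟩
      cases s with
      | nil => simp at hs2
      | cons q s =>
        obtain ⟨a, c⟩ := q
        cases a <;> cases c <;>
          simp [E, eP, encPair, encList, Data.left, Data.right, eqStep])
  refine (hstart.trans hw).left.congr fun i => ?_
  have := (runWhile_eqStep (y i).size [(y i, z i)] (by simp)).1
  simp only [E, encPair, Data.left, this, encProp]
  simp

theorem eq {a b : ι → α} (he : ∀ i, Function.Injective (e i))
    (ha : PTime M x fun i => e i (a i)) (hb : PTime M x fun i => e i (b i)) :
    PTime M x fun i => encProp (a i = b i) :=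
  (ha.eq_data hb).propCongr fun i => (he i).eq_iff

theorem mem {a : ι → α} {l : ι → List α} (he : ∀ i, Function.Injective (e i))
    (ha : PTime M x fun i => e i (a i)) (hl : PTime M x fun i => encList (e i) (l i)) :
    PTime M x fun i => encProp (a i ∈ l i) :=
  (hl.exists_mem (fun i b => a i = b) fun _ hx hb =>
    (hx.on ha).eq (e := fun p : {p : ι × α // p.2 ∈ l p.1} => e p.1.1)
      (fun p => he p.1.1) hb).propCongr fun i => by simp

theorem headD {l : ι → List α} {d : α} {t : Data} (hd : ∀ i, e i d = t)
    (hl : PTime M x fun i => encList (e i) (l i)) : PTime M x fun i => e i ((l i).headD d) :=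
  (hl.isEmpty.cond (const hl.size_input_le t) hl.left).congr fun i => by
    cases l i <;> simp [hd, encList, Data.left]

theorem zip {l : ι → List α} {l' : ι → List β} (hl : PTime M x fun i => encList (e i) (l i))
    (hl' : PTime M x fun i => encList (e' i) (l' i)) :
    PTime M x fun i => encList (encPair (e i) (e' i)) ((l i).zip (l' i)) := by
  let f : List β × List (α × β) → α → List β × List (α × β) := fun q a =>
    (q.1.tail, (q.1.take 1).map (fun b => (a, b)) ++ q.2)
  have key : ∀ (r : List α) (t : List β) (acc : List (α × β)),
      r.foldl f (t, acc) = (t.drop r.length, (r.zip t).reverse ++ acc) := by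
    intro r
    induction r with
    | nil => simp
    | cons a r ih =>
      intro t acc
      rw [List.foldl_cons]
      cases t with
      | nil => rw [show f ([], acc) a = ([], acc) from rfl, ih]; simp
      | cons b t => rw [show f (b :: t, acc) a = (t, (a, b) :: acc) from rfl, ih]; simp
  have hlen : ∀ i (r : List α) (t : List β), (encList (encPair (e i) (e' i)) (r.zip t)).size ≤
      (encList (e i) r).size + (encList (e' i) t).size := by
    intro i r
    induction r with
    | nil => simp [encList, Data.size]
    | cons a r ih =>
      intro t
      cases t with
      | nil => simp [encList, Data.size]
      | cons b t => have := ih t; simp [encList, Data.size, encPair]; omega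
  have h := hl.foldl (e' := fun i => encPair (encList (e' i)) (encList (encPair (e i) (e' i))))
    (s := fun i => (l' i, [])) (fun _ => f)
    (hl'.pair (const hl.size_input_le .nil))
    (by
      refine (((hl.size_le.add hl'.size_le).add (hl'.size_le.add (.const 1))).on
        (fun p : {p : ι × List α // p.2 <+: l p.1} => p.1.1)).mono fun p => ?_
      rw [key, List.append_nil]
      have h1 := hlen p.1.1 p.1.2 (l' p.1.1)
      have h2 := size_encList_le_of_prefix (e p.1.1) p.2
      have h3 := size_encList_le_of_suffix (e' p.1.1) (List.drop_suffix p.1.2.length (l' p.1.1))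
      have h4 : (encList (encPair (e p.1.1) (e' p.1.1)) (p.1.2.zip (l' p.1.1)).reverse).size =
          (encList (encPair (e p.1.1) (e' p.1.1)) (p.1.2.zip (l' p.1.1))).size := by
        simp [size_encList, List.sum_reverse]
      simp only [encPair, Data.size] at h1 h4 ⊢
      omega)
    (fun z hx ha hb => by
      have hrest := hb.left
      refine PTime.pair (hrest.tail (e := fun p : {p : ι × List α × α //
        p.2.1 ++ [p.2.2] <+: l p.1} => e' p.1.1)) ?_
      refine (hrest.isNode.cond ((ha.pair hrest.left).pair hb.right) hb.right).congr fun p => ?_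
      generalize List.foldl f (l' p.1.1, []) p.1.2.1 = q
      obtain ⟨q, acc⟩ := q
      cases q <;> simp [encList, encPair, f, Data.left, Data.right])
  have h' := h.right.congr (z := fun i =>
    encList (encPair (e i) (e' i)) ((l i).zip (l' i)).reverse) fun i => by
      rw [key, List.append_nil]; rfl
  exact h'.reverse.congr fun i => by rw [List.reverse_reverse]

end PTime

/-- The lists of length `n` of elements of `E`. -/
def tuples {β : Type} (E : List β) : ℕ → List (List β)
  | 0 => [[]]
  | n + 1 => E.flatMap fun v => (tuples E n).map fun t => v :: t

theorem mem_tuples {β : Type} {E : List β} {n : ℕ} {t : List β} :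
    t ∈ tuples E n ↔ t.length = n ∧ ∀ v ∈ t, v ∈ E := by
  induction n generalizing t with
  | zero =>
    simp only [tuples, List.mem_singleton]
    constructor
    · rintro rfl
      simp
    · exact fun h => List.eq_nil_of_length_eq_zero h.1
  | succ n ih =>
    simp only [tuples, List.mem_flatMap, List.mem_map, ih]
    constructor
    · rintro ⟨v, hv, t, ⟨h1, h2⟩, rfl⟩
      simp only [List.length_cons, h1, List.mem_cons, true_and]
      rintro u (rfl | hu)
      · exact hv
      · exact h2 u hu
    · rintro ⟨h1, h2⟩
      cases t with
      | nil => simp at h1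
      | cons v t =>
        exact ⟨v, h2 v (by simp), t, ⟨by simpa using h1, fun u hu => h2 u (by simp [hu])⟩, rfl⟩

theorem length_tuples {β : Type} (E : List β) (n : ℕ) : (tuples E n).length = E.length ^ n := by
  induction n with
  | zero => simp [tuples]
  | succ n ih => simp [tuples, List.length_flatMap, ih, pow_succ, mul_comm]

namespace PTime

variable {ι α β γ : Type} {M : ι → ℕ} {x : ι → Data} {e : ι → α → Data} {e' : ι → β → Data}

/-- The tuples over a list can be enumerated in time polynomial in their number. -/
theorem tuples {l : ι → List α} {E : ι → List β} (hl : PTime M x fun i => encList (e i) (l i))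
    (hE : PTime M x fun i => encList (e' i) (E i))
    (hcard : PolyLE M fun i => (E i).length ^ (l i).length) :
    PTime M x fun i => encList (encList (e' i)) (tuples (E i) (l i).length) := by
  let f : ι → List (List β) → α → List (List β) := fun i acc _ =>
    (E i).flatMap fun v => acc.map fun t => v :: t
  have key' : ∀ i (r : List α) n, r.foldl (f i) (Linearization.tuples (E i) n) =
      Linearization.tuples (E i) (n + r.length) := by
    intro i r
    induction r with
    | nil => simp
    | cons a r ih =>
      intro n
      rw [List.foldl_cons, show f i (Linearization.tuples (E i) n) a =
        Linearization.tuples (E i) (n + 1) from rfl, ih]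
      simp [Nat.add_assoc, Nat.add_comm 1]
  have key : ∀ i (r : List α), r.foldl (f i) [[]] = Linearization.tuples (E i) r.length := by
    intro i r
    simpa [Linearization.tuples] using key' i r 0
  have hx := hl.size_input_le
  have h := hl.foldl (e' := fun i => encList (encList (e' i))) (s := fun _ => [[]]) f
    (const hx (.node .nil .nil))
    (by
      refine (((PolyLE.const 1).add ((hcard.add (.const 1)).mul
        (((PolyLE.const 1).add (hl.size_le.mul (hE.size_le.add (.const 1)))).add
          (.const 1)))).on
          (fun p : {p : ι × List α // p.2 <+: l p.1} => p.1.1)).mono fun p => ?_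
      rw [key]
      have h1 : (Linearization.tuples (E p.1.1) p.1.2.length).length ≤
          (E p.1.1).length ^ (l p.1.1).length + 1 := by
        rw [length_tuples]
        rcases Nat.eq_zero_or_pos (E p.1.1).length with h0 | h0
        · rw [h0]
          rcases Nat.eq_zero_or_pos p.1.2.length with h1 | h1
          · rw [h1, pow_zero]; exact Nat.le_add_left _ _
          · rw [Nat.zero_pow h1]; exact Nat.zero_le _
        · exact (Nat.pow_le_pow_right h0 p.2.length_le).trans (by omega)
      refine (size_encList_le _ _ (n := 1 + (encList (e p.1.1) (l p.1.1)).size *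
        ((encList (e' p.1.1) (E p.1.1)).size + 1)) fun t ht => ?_).trans ?_
      · obtain ⟨ht1, ht2⟩ := mem_tuples.1 ht
        refine (size_encList_le _ _ fun v hv => size_le_size_encList _ (ht2 v hv)).trans ?_
        have h2 := (ht1.le.trans p.2.length_le).trans (length_le_size_encList (e p.1.1) _)
        have := Nat.mul_le_mul_right ((encList (e' p.1.1) (E p.1.1)).size + 1) h2
        omega
      · have := Nat.mul_le_mul_right (1 + (encList (e p.1.1) (l p.1.1)).size *
          ((encList (e' p.1.1) (E p.1.1)).size + 1) + 1) h1
        omega)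
    (fun z hx ha hb => by
      refine (hx.on hE).flatMap (e := fun p : {p : ι × List α × α //
        p.2.1 ++ [p.2.2] <+: l p.1} => e' p.1.1) _ fun w hw hv => ?_
      let J := {q : {p : ι × List α × α // p.2.1 ++ [p.2.2] <+: l p.1} × β // q.2 ∈ E q.1.1.1}
      exact (hw.on hb).map (e := fun p : J => encList (e' p.1.1.1.1))
        (e' := fun p : J => encList (e' p.1.1.1.1))
        (fun p t => p.1.2 :: t) fun u hu ht => (hu.on hv).pair ht)
  exact h.congr fun i => by rw [key]

end PTime

/-! ### Saturation -/

section Saturation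

variable {α : Type}

/-- The first element that `st` generates from the list and that is not yet in it is added. -/
noncomputable def grow (st : List α → List α) (Y : List α) : List α :=
  (sel (fun a => a ∉ Y) (st Y)).take 1 ++ Y

/-- Some element that `st` generates from the list is not in it. -/
noncomputable def growing (st : List α → List α) (Y : List α) : Bool :=
  @decide (∃ a ∈ st Y, a ∉ Y) (Classical.propDecidable _)

theorem growing_iff {st : List α → List α} {Y : List α} :
    growing st Y = true ↔ ∃ a ∈ st Y, a ∉ Y := by simp only [growing, decide_eq_true_eq]

/-- The list `X` enlarged, element by element, until it contains all that `st` generates from it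
(the list `X` itself, if that never happens). -/
noncomputable def saturate (st : List α → List α) (X : List α) : List α :=
  if h : ∃ n, growing st (runWhile (growing st) (grow st) n X) = false then
    runWhile (growing st) (grow st) h.choose X else X

/-- All that `st` generates from elements of `U` is in `U`. -/
def ClosedUnder (st : List α → List α) (U : Set α) : Prop :=
  ∀ Y : List α, (∀ a ∈ Y, a ∈ U) → ∀ a ∈ st Y, a ∈ U

theorem runWhile_eq_of_false {β : Type} {c : β → Bool} {f : β → β} {m n : ℕ} {s : β}
    (hm : c (runWhile c f m s) = false) (hn : c (runWhile c f n s) = false) :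
    runWhile c f m s = runWhile c f n s := by
  induction m generalizing n s with
  | zero => exact (runWhile_of_false hm n).symm
  | succ m ih =>
    cases hs : c s with
    | false => rw [runWhile_of_false hs, runWhile_of_false hs]
    | true =>
      cases n with
      | zero => simp only [runWhile] at hn; rw [hn] at hs; cases hs
      | succ n =>
        simp only [runWhile, hs, if_true] at hm hn ⊢
        exact ih hm hn

theorem saturate_eq {st : List α → List α} {X : List α} {n : ℕ}
    (h : growing st (runWhile (growing st) (grow st) n X) = false) :
    saturate st X = runWhile (growing st) (grow st) n X := by
  have h' : ∃ n, growing st (runWhile (growing st) (grow st) n X) = false := ⟨n, h⟩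
  rw [saturate, dif_pos h']
  exact runWhile_eq_of_false h'.choose_spec h

/-- The states of the saturation of `X` inside `U`. -/
def SatState (U : Finset α) (X Y : List α) : Prop :=
  (∃ W, Y = W ++ X ∧ W.Nodup) ∧ ∀ a ∈ Y, a ∈ U

theorem SatState.exists_grow {st : List α → List α} {U : Finset α} {X Y : List α}
    (hU : ClosedUnder st (U : Set α)) (h : SatState U X Y) (hg : growing st Y = true) :
    ∃ a ∈ st Y, a ∉ Y ∧ grow st Y = a :: Y ∧ SatState U X (a :: Y) := by
  obtain ⟨⟨W, rfl, hW⟩, hY⟩ := h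
  have h1 : sel (fun a => a ∉ W ++ X) (st (W ++ X)) ≠ [] := by
    obtain ⟨a, ha, haY⟩ := growing_iff.1 hg
    exact List.ne_nil_of_mem (mem_sel.2 ⟨ha, haY⟩)
  obtain ⟨a, t, ht⟩ := List.exists_cons_of_ne_nil h1
  obtain ⟨ha, haY⟩ := mem_sel.1 (ht ▸ List.mem_cons_self : a ∈ sel (fun a => a ∉ W ++ X) _)
  refine ⟨a, ha, haY, by rw [grow, ht]; rfl, ⟨a :: W, rfl, ?_⟩, ?_⟩
  · exact List.nodup_cons.2 ⟨fun h => haY (List.mem_append_left _ h), hW⟩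
  · intro b hb
    rcases List.mem_cons.1 hb with rfl | hb
    · exact hU _ (by simpa using hY) _ ha
    · exact hY b hb

theorem growing_runWhile {st : List α → List α} {U : Finset α} {X : List α}
    (hU : ClosedUnder st (U : Set α)) (n : ℕ) (W : List α) (h : SatState U X (W ++ X))
    (hW : W.Nodup) (hn : U.card ≤ W.length + n) :
    growing st (runWhile (growing st) (grow st) n (W ++ X)) = false := by
  induction n generalizing W with
  | zero =>
    rw [runWhile]
    by_contra hg
    obtain ⟨a, ha, haY, -, hs⟩ := h.exists_grow hU (by simpa using hg)
    have hc : (insert a W.toFinset).card ≤ U.card := Finset.card_le_card fun b hb => by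
      rcases Finset.mem_insert.1 hb with rfl | hb
      · exact hs.2 _ (by simp)
      · exact hs.2 _ (by simp [List.mem_toFinset.1 hb])
    rw [Finset.card_insert_of_notMem (by simpa using fun h => haY (List.mem_append_left _ h)),
      List.toFinset_card_of_nodup hW] at hc
    omega
  | succ n ih =>
    cases hg : growing st (W ++ X) with
    | false => rw [runWhile_of_false hg, hg]
    | true =>
      obtain ⟨a, ha, haY, hgr, hs⟩ := h.exists_grow hU hg
      rw [runWhile, if_pos hg, hgr]
      exact ih (a :: W) hs (List.nodup_cons.2 ⟨fun h => haY (List.mem_append_left _ h), hW⟩)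
        (by simp only [List.length_cons]; omega)

/-- Inside a finite closed set, saturation yields the least closed list. -/
theorem saturate_spec {st : List α → List α} {X : List α} {U : Finset α}
    (hU : ClosedUnder st (U : Set α)) (hX : ∀ a ∈ X, a ∈ U) :
    (∀ a ∈ X, a ∈ saturate st X) ∧ (∀ a ∈ st (saturate st X), a ∈ saturate st X) ∧
      ∀ P : Set α, ClosedUnder st P → (∀ a ∈ X, a ∈ P) → ∀ a ∈ saturate st X, a ∈ P := by
  have hfinal := growing_runWhile hU U.card [] ⟨⟨[], by simp⟩, by simpa using hX⟩ (by simp)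
    (by simp)
  rw [List.nil_append] at hfinal
  have hgen : ∀ n, ∀ P : Set α, ClosedUnder st P → ∀ Y : List α, (∀ a ∈ Y, a ∈ P) →
      ∀ a ∈ runWhile (growing st) (grow st) n Y, a ∈ P := by
    intro n P hP
    induction n with
    | zero => exact fun Y hY => hY
    | succ n ih =>
      intro Y hY
      rw [runWhile]
      split
      · refine ih _ fun a ha => ?_
        rcases List.mem_append.1 ha with ha | ha
        · exact hP Y hY a (mem_sel.1 (List.mem_of_mem_take ha)).1
        · exact hY a ha
      · exact hY
  have hsub : ∀ n, ∀ Y : List α, ∀ a ∈ Y, a ∈ runWhile (growing st) (grow st) n Y := by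
    intro n
    induction n with
    | zero => exact fun Y a ha => ha
    | succ n ih =>
      intro Y a ha
      rw [runWhile]
      split
      · exact ih _ a (List.mem_append_right _ ha)
      · exact ha
  rw [saturate_eq hfinal]
  refine ⟨hsub _ _, fun a ha => ?_, fun P hP h => hgen _ P hP _ h⟩
  have h : ¬ ∃ a ∈ st (runWhile (growing st) (grow st) U.card X),
      a ∉ runWhile (growing st) (grow st) U.card X := by
    rw [← growing_iff, hfinal]; simp
  push Not at h
  exact h a ha

theorem satState_saturate {st : List α → List α} {X : List α} {U : Finset α}
    (hU : ClosedUnder st (U : Set α)) (hX : ∀ a ∈ X, a ∈ U) : SatState U X (saturate st X) := by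
  have hgen : ∀ n, ∀ Y, SatState U X Y → SatState U X (runWhile (growing st) (grow st) n Y) := by
    intro n
    induction n with
    | zero => exact fun Y hY => hY
    | succ n ih =>
      intro Y hY
      rw [runWhile]
      split
      · obtain ⟨a, -, -, h1, h2⟩ := hY.exists_grow hU ‹_›
        exact ih _ (h1 ▸ h2)
      · exact hY
  have h0 : SatState U X X := ⟨⟨[], by simp⟩, hX⟩
  have h1 := saturate_eq (growing_runWhile hU U.card [] h0 (by simp) (by simp))
  rw [List.nil_append] at h1
  rw [h1]
  exact hgen _ _ h0

end Saturation

namespace PTime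

variable {ι α β γ : Type} {M : ι → ℕ} {x : ι → Data} {e : ι → α → Data} {e' : ι → β → Data}

theorem take_one {l : ι → List α} (hl : PTime M x fun i => encList (e i) (l i)) :
    PTime M x fun i => encList (e i) ((l i).take 1) :=
  (hl.isEmpty.cond hl (hl.left.pair (const hl.size_input_le .nil))).congr fun i => by
    cases l i <;> simp [encList, Data.left]

/-- Saturation takes polynomial time if it happens inside sets of polynomially many elements of
polynomial size. -/
theorem saturate {st : ι → List α → List α} {X : ι → List α} (he : ∀ i, Function.Injective (e i))
    (hX : PTime M x fun i => encList (e i) (X i)) (U : ι → Finset α)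
    (hU : ∀ i, ClosedUnder (st i) (U i : Set α)) (hXU : ∀ i, ∀ a ∈ X i, a ∈ U i)
    (hcard : PolyLE M fun i => (U i).card)
    (hsize : PolyLE (fun p : {p : ι × α // p.2 ∈ U p.1} => M p.1.1) fun p => (e p.1.1 p.1.2).size)
    (hst : ∀ z : {p : ι × List α // SatState (U p.1) (X p.1) p.2} → Data,
      PTime (fun p => M p.1.1) z (fun p => x p.1.1) →
      PTime (fun p => M p.1.1) z (fun p => encList (e p.1.1) p.1.2) →
      PTime (fun p => M p.1.1) z (fun p => encList (e p.1.1) (st p.1.1 p.1.2))) :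
    PTime M x fun i => encList (e i) (saturate (st i) (X i)) := by
  let E : ι → List α → Data := fun i Y => .node (x i) (encList (e i) Y)
  let Inv : ι → List α → Prop := fun i Y => SatState (U i) (X i) Y
  let J := {p : ι × List α // Inv p.1 p.2}
  have hx := hX.size_input_le
  have hfinal : ∀ i, growing (st i) (runWhile (growing (st i)) (grow (st i)) (U i).card (X i)) =
      false := fun i => by
    simpa using growing_runWhile (hU i) (U i).card [] ⟨⟨[], by simp⟩, by simpa using hXU i⟩
      (by simp) (by simp)
  have hE : PolyLE (fun p : J => M p.1.1) fun p => (E p.1.1 p.1.2).size := by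
    obtain ⟨k, hk⟩ := hsize
    refine ((hx.add (((PolyLE.const 1).add ((hcard.add hX.size_le).mul
      ((show PolyLE M fun i => (M i + 2) ^ k from ⟨k, fun i => le_rfl⟩).add (.const 1)))).add
      (.const 1))).on (fun p : J => p.1.1)).mono fun p => ?_
    obtain ⟨⟨i, Y⟩, ⟨W, hY, hW⟩, hYU⟩ := p
    have h1 := size_encList_le (e i) Y (n := (M i + 2) ^ k)
      fun a ha => hk ⟨(i, a), hYU a ha⟩
    dsimp only at hY hYU h1
    have h2 : W.length ≤ (U i).card := by
      rw [← List.toFinset_card_of_nodup hW]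
      exact Finset.card_le_card fun a ha => hYU a (by simp [hY, List.mem_toFinset.1 ha])
    have h3 := length_le_size_encList (e i) (X i)
    have h4 : Y.length ≤ (U i).card + (encList (e i) (X i)).size := by
      rw [hY, List.length_append]; omega
    have h5 := Nat.mul_le_mul_right ((M i + 2) ^ k + 1) h4
    simp only [E, Data.size]
    omega
  have hid := PTime.id hE
  have hcur : PTime (fun p : J => M p.1.1) (fun p => E p.1.1 p.1.2)
      (fun p => encList (e p.1.1) p.1.2) := hid.right
  have hnext : PTime (fun p : J => M p.1.1) (fun p => E p.1.1 p.1.2)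
      (fun p => encList (e p.1.1) (st p.1.1 p.1.2)) := hst _ hid.left hcur
  have hfresh : PTime (fun p : J => M p.1.1) (fun p => E p.1.1 p.1.2)
      (fun p => encList (e p.1.1) (Linearization.sel (fun a => a ∉ p.1.2) (st p.1.1 p.1.2))) :=
    PTime.sel (e := fun p : J => e p.1.1) (fun p a => a ∉ p.1.2) hnext fun z hz ha =>
      (ha.mem (e := fun q : {q : J × α // q.2 ∈ st q.1.1.1 q.1.1.2} => e q.1.1.1.1)
        (fun q => he q.1.1.1.1) (hz.on hcur)).propNot
  have hw := PTime.while (M := M) E (fun i => growing (st i)) (fun i => grow (st i)) Inv X hcard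
    (fun i => ⟨⟨[], by simp⟩, hXU i⟩)
    (fun i Y hY hg => by
      obtain ⟨a, -, -, h1, h2⟩ := hY.exists_grow (hU i) hg
      rwa [h1])
    hfinal
    (hfresh.isEmpty.not.congr fun p => congrArg _ <| by
      rw [Bool.eq_iff_iff]
      simp [Linearization.sel, growing])
    (by
      let r : {p : ι × List α // Inv p.1 p.2 ∧ growing (st p.1) p.2 = true} → J :=
        fun p => ⟨p.1, p.2.1⟩
      exact (hid.left.pair (hfresh.take_one.append hcur)).reindex r)
  have hstart : PTime M x fun i => E i (X i) := (PTime.id hx).pair hX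
  exact (hstart.trans hw).right.congr fun i => by rw [saturate_eq (hfinal i)]; rfl

end PTime

/-! ### Serialization of trees -/

/-- The reversed preorder of the tree (`true` for nodes, `false` for leaves), in front of a given
bit string. -/
def serialize : Data → Name → Name
  | .nil, acc => false :: acc
  | .node l r, acc => serialize r (serialize l (true :: acc))

/-- A parser for reversed preorders, with a stack of finished trees. -/
def parse : Name → List Data → List Data
  | [], s => s
  | false :: n, s => parse n (.nil :: s)
  | true :: n, l :: r :: s => parse n (.node l r :: s)
  | true :: _, s => s

theorem parse_serialize (d : Data) (acc : Name) (s : List Data) :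
    parse (serialize d acc) s = parse acc (d :: s) := by
  induction d generalizing acc s with
  | nil => rfl
  | node l r hl hr => rw [serialize, hr, hl, parse]

theorem serialize_injective : Function.Injective fun d => serialize d [] := by
  intro d d' h
  have h1 := parse_serialize d [] []
  have h2 := parse_serialize d' [] []
  dsimp only at h
  rw [h, h2] at h1
  simpa [parse] using h1.symm

namespace PTime

variable {ι α β γ : Type} {M : ι → ℕ} {x : ι → Data} {e : ι → α → Data} {e' : ι → β → Data}

/-- One step of the serialization of a stack of trees. -/
def serStep : List Data × Name → List Data × Name
  | ([], n) => ([], n)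
  | (.nil :: s, n) => (s, false :: n)
  | (.node l r :: s, n) => (l :: r :: s, true :: n)

theorem runWhile_serStep (k : ℕ) (s : List Data) (n : Name) (h : (s.map Data.size).sum ≤ k) :
    runWhile (fun q : List Data × Name => !q.1.isEmpty) serStep k (s, n) =
      ([], s.foldl (fun n d => serialize d n) n) := by
  induction k generalizing s n with
  | zero =>
    cases s with
    | nil => rfl
    | cons d s => have := d.size_pos; simp at h; omega
  | succ k ih =>
    cases s with
    | nil => rfl
    | cons d s =>
      rw [runWhile, if_pos (by simp)]
      cases d with
      | nil => rw [serStep, ih _ _ (by simp [Data.size] at h; omega)]; rfl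
      | node l r => rw [serStep, ih _ _ (by simp [Data.size] at h ⊢; omega)]; rfl

theorem serialize {y : ι → Data} (hy : PTime M x y) :
    PTime M x fun i => encName (serialize (y i) []) := by
  let E : ι → List Data × Name → Data := fun _ => encPair (encList fun d => d) encName
  let Inv : ι → List Data × Name → Prop := fun i q =>
    (q.1.map Data.size).sum + q.2.length = (y i).size
  let J := {p : ι × List Data × Name // Inv p.1 p.2}
  have hE : PolyLE (fun p : J => M p.1.1) fun p => (E p.1.1 p.1.2).size := by
    refine ((((PolyLE.const 6).mul hy.size_le).add (.const 3)).on
      (fun p : J => p.1.1)).mono fun p => ?_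
    obtain ⟨⟨i, s, n⟩, h⟩ := p
    have h1 : (encList (fun d => d) s).size ≤ 1 + 2 * (s.map Data.size).sum := by
      clear h
      induction s with
      | nil => simp [encList, Data.size]
      | cons d s ih => have := d.size_pos; simp [encList, Data.size]; omega
    have h2 := size_encList_le encBool n (n := 3) fun b _ => by
      cases b <;> simp [encBool, Data.size]
    simp only [Inv] at h
    simp only [E, encPair, encName, Data.size]
    omega
  have hrun := fun i => runWhile_serStep (y i).size [y i] [] (by simp)
  have hw := PTime.while (M := M) E (fun _ q => !q.1.isEmpty) (fun _ => serStep) Inv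
    (fun i => ([y i], [])) (N := fun i => (y i).size) hy.size_le (fun i => by simp [Inv])
    (by
      rintro i ⟨s, n⟩ hs hc
      simp only [Inv] at hs ⊢
      cases s with
      | nil => simp at hc
      | cons d s => cases d <;> simp [serStep, Data.size] at hs ⊢ <;> omega)
    (fun i => by rw [hrun]; rfl)
    ((PTime.id hE).left.isEmpty (e := fun _ d => d)).not
    (by
      have hE' := hE.on (fun p : {p : ι × List Data × Name //
        Inv p.1 p.2 ∧ (!p.2.1.isEmpty) = true} => (⟨p.1, p.2.1⟩ : J))
      have hid := PTime.id hE'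
      have htop := hid.left.left
      refine (htop.isNode.cond
        ((htop.left.pair (htop.right.pair hid.left.right)).pair ((constTrue hE').pair hid.right))
        (hid.left.right.pair ((constFalse hE').pair hid.right))).congr ?_
      rintro ⟨⟨i, s, n⟩, hs1, hs2⟩
      cases s with
      | nil => simp at hs2
      | cons d s =>
        cases d <;> simp [E, encPair, encList, encName, Data.left, Data.right, serStep])
  have hstart : PTime M x fun i => E i ([y i], []) :=
    (hy.pair (const hy.size_input_le .nil)).pair (const hy.size_input_le .nil)
  exact (hstart.trans hw).right.congr fun i => by rw [hrun]; rfl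

end PTime

/-! ### Guarded dependencies with a single head atom and their closures -/

/-- A guard, further body atoms and one head atom. Such a triple is read as a full dependency, or,
in the list `types` below, as a dependency whose head has existential variables. -/
structure GDep where
  guard : Atom Name Name
  side : List (Atom Name Name)
  head : Atom Name Name

/-- The further body atoms use only variables of the guard. -/
def GDep.SideGuarded (d : GDep) : Prop := ∀ G ∈ d.side, ∀ z ∈ G.args, z ∈ d.guard.args

/-- All variables are in the guard. -/
def GDep.Guarded (d : GDep) : Prop := d.SideGuarded ∧ ∀ z ∈ d.head.args, z ∈ d.guard.args

/-- The variables common to guard and head. -/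
noncomputable def GDep.iface (d : GDep) : List Name := sel (fun z => z ∈ d.head.args) d.guard.args

theorem GDep.mem_iface {d : GDep} {z : Name} :
    z ∈ d.iface ↔ z ∈ d.guard.args ∧ z ∈ d.head.args := mem_sel

section Closure

variable {V W : Type}

theorem Atom.mapArgs_congr {R T U : Type} {f g : T → U} {A : Atom R T}
    (h : ∀ z ∈ A.args, f z = g z) : A.mapArgs f = A.mapArgs g := by
  simp only [Atom.mapArgs, Atom.mk.injEq, true_and]
  exact List.map_congr_left h

theorem Atom.mapArgs_mapArgs {R T U X : Type} (f : T → U) (g : U → X) (A : Atom R T) :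
    (A.mapArgs f).mapArgs g = A.mapArgs fun z => g (f z) := by
  simp [Atom.mapArgs, Function.comp_def]

theorem Atom.mapArgs_eq_self {R T : Type} {f : T → T} {A : Atom R T}
    (h : ∀ z ∈ A.args, f z = z) : A.mapArgs f = A := by
  rw [Atom.mapArgs_congr (g := fun z => z) h]
  simp [Atom.mapArgs]

theorem Atom.mem_mapArgs {R T U : Type} {f : T → U} {A : Atom R T} {u : U} :
    u ∈ (A.mapArgs f).args ↔ ∃ z ∈ A.args, f z = u := by simp [Atom.mapArgs]

theorem Atom.Over.mapArgs {R T U : Type} {S : Signature R} {A : Atom R T} (h : A.Over S)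
    (f : T → U) : (A.mapArgs f).Over S := ⟨h.1, by simpa [Atom.mapArgs] using h.2⟩

/-- The consequences of a set of facts under a set of full guarded dependencies. -/
inductive Cl (L : List GDep) (X : Set (Atom Name V)) : Atom Name V → Prop
  | base {F : Atom Name V} (h : F ∈ X) : Cl L X F
  | step {d : GDep} (hd : d ∈ L) (σ : Name → V) (hg : Cl L X (d.guard.mapArgs σ))
      (hs : ∀ G ∈ d.side, Cl L X (G.mapArgs σ)) : Cl L X (d.head.mapArgs σ)

/-- The instance `I` satisfies the full dependency `d`. -/
def GDep.Sat (d : GDep) (I : Set (Atom Name V)) : Prop :=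
  ∀ σ : Name → V, d.guard.mapArgs σ ∈ I → (∀ G ∈ d.side, G.mapArgs σ ∈ I) → d.head.mapArgs σ ∈ I

theorem Cl.map_mem {L : List GDep} {X : Set (Atom Name V)} {I : Set (Atom Name W)} {g : V → W}
    (hL : ∀ d ∈ L, d.Sat I) (hX : ∀ F ∈ X, F.mapArgs g ∈ I) {F : Atom Name V} (h : Cl L X F) :
    F.mapArgs g ∈ I := by
  induction h with
  | base h => exact hX _ h
  | step hd σ _ _ ih ih' =>
    rw [Atom.mapArgs_mapArgs] at ih ⊢
    exact hL _ hd _ ih fun G hG => by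
      have := ih' G hG
      rwa [Atom.mapArgs_mapArgs] at this

theorem Cl.sat (L : List GDep) (X : Set (Atom Name V)) : ∀ d ∈ L, d.Sat {F | Cl L X F} :=
  fun _ hd σ hg hs => Cl.step hd σ hg hs

theorem Cl.args_mem {L : List GDep} {X : Set (Atom Name V)} {E : Set V}
    (hL : ∀ d ∈ L, d.Guarded) (hX : ∀ F ∈ X, ∀ v ∈ F.args, v ∈ E) {F : Atom Name V}
    (h : Cl L X F) : ∀ v ∈ F.args, v ∈ E := by
  induction h with
  | base h => exact hX _ h
  | step hd σ _ _ ih _ =>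
    intro v hv
    obtain ⟨z, hz, rfl⟩ := Atom.mem_mapArgs.1 hv
    exact ih _ (Atom.mem_mapArgs.2 ⟨z, (hL _ hd).2 z hz, rfl⟩)

theorem Cl.over {L : List GDep} {X : Set (Atom Name V)} {S : Signature Name}
    (hL : ∀ d ∈ L, d.head.Over S) (hX : ∀ F ∈ X, F.Over S) {F : Atom Name V}
    (h : Cl L X F) : F.Over S := by
  cases h with
  | base h => exact hX _ h
  | step hd σ _ _ => exact (hL _ hd).mapArgs σ

/-- Closures commute with injective renamings of the values. -/
theorem Cl.exists_of_image [Nonempty V] {L : List GDep} {X : Set (Atom Name V)} {E : Set V}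
    (hL : ∀ d ∈ L, d.Guarded) (hX : ∀ F ∈ X, ∀ v ∈ F.args, v ∈ E) {g : V → W}
    (hg : Set.InjOn g E) {F : Atom Name W} (h : Cl L (Atom.mapArgs g '' X) F) :
    Cl L X (F.mapArgs (Function.invFunOn g E)) ∧
      (F.mapArgs (Function.invFunOn g E)).mapArgs g = F := by
  constructor
  · refine Cl.map_mem (I := {F | Cl L X F}) (Cl.sat L X) ?_ h
    rintro _ ⟨F, hF, rfl⟩
    rw [Atom.mapArgs_mapArgs, Atom.mapArgs_eq_self]
    · exact Cl.base hF
    · exact fun v hv => hg.leftInvOn_invFunOn (hX F hF v hv)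
  · rw [Atom.mapArgs_mapArgs]
    refine Atom.mapArgs_eq_self fun v hv => ?_
    have : v ∈ g '' E := Cl.args_mem hL (E := g '' E) (by
      rintro _ ⟨F, hF, rfl⟩ v hv
      obtain ⟨z, hz, rfl⟩ := Atom.mem_mapArgs.1 hv
      exact ⟨z, hX F hF z hz, rfl⟩) h v hv
    exact Function.invFunOn_eq this

/-! ### Computing closures -/

/-- The value of `z` in a list of bindings (the default value, if `z` is not bound). -/
noncomputable def look [Inhabited V] (σ : List (Name × V)) (z : Name) : V :=
  ((sel (fun q => q.1 = z) σ).map Prod.snd).headD default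

theorem look_eq [Inhabited V] {σ : List (Name × V)} {f : Name → V} {z : Name}
    (h : ∀ q ∈ σ, q.1 = z → q.2 = f z) (hz : ∃ q ∈ σ, q.1 = z) : look σ z = f z := by
  obtain ⟨q, hq, hqz⟩ := hz
  have h1 : sel (fun q => q.1 = z) σ ≠ [] := List.ne_nil_of_mem (mem_sel.2 ⟨hq, hqz⟩)
  obtain ⟨p, t, ht⟩ := List.exists_cons_of_ne_nil h1
  obtain ⟨hp, hpz⟩ := mem_sel.1 (ht ▸ List.mem_cons_self : p ∈ sel (fun q => q.1 = z) σ)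
  simp [look, ht, h p hp hpz]

theorem look_mem [Inhabited V] {σ : List (Name × V)} {z : Name} (hz : ∃ q ∈ σ, q.1 = z) :
    (z, look σ z) ∈ σ := by
  obtain ⟨q, hq, hqz⟩ := hz
  have h1 : sel (fun q => q.1 = z) σ ≠ [] := List.ne_nil_of_mem (mem_sel.2 ⟨hq, hqz⟩)
  obtain ⟨p, t, ht⟩ := List.exists_cons_of_ne_nil h1
  obtain ⟨hp, rfl⟩ := mem_sel.1 (ht ▸ List.mem_cons_self : p ∈ sel (fun q => q.1 = z) σ)
  simpa [look, ht] using hp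

theorem mem_zip_map {α β : Type} {l : List α} {f : α → β} {q : α × β} (h : q ∈ l.zip (l.map f)) :
    q.2 = f q.1 := by
  induction l with
  | nil => simp at h
  | cons a l ih =>
    simp only [List.map_cons, List.zip_cons_cons, List.mem_cons] at h
    rcases h with rfl | h
    · rfl
    · exact ih h

theorem exists_mem_zip_map {α β : Type} {l : List α} (f : α → β) {a : α} (h : a ∈ l) :
    (a, f a) ∈ l.zip (l.map f) := by
  induction l with
  | nil => simp at h
  | cons b l ih =>
    rcases List.mem_cons.1 h with rfl | h
    · simp
    · simp [ih h]

theorem look_zip_map [Inhabited V] {l : List Name} {f : Name → V} {z : Name} (hz : z ∈ l) :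
    look (l.zip (l.map f)) z = f z :=
  look_eq (fun _ hq hqz => hqz ▸ mem_zip_map hq) ⟨_, exists_mem_zip_map f hz, rfl⟩

/-- The assignment of the variables of the atom `A` that maps `A` to the fact `F`, if there is
one. Otherwise it is still some assignment, so that its users have to test whether it maps `A`
to `F`. -/
noncomputable def matching [Inhabited V] (A : Atom Name Name) (F : Atom Name V) : Name → V :=
  look (A.args.zip F.args)

theorem matching_mapArgs [Inhabited V] (A : Atom Name Name) (σ : Name → V) :
    ∀ z ∈ A.args, matching A (A.mapArgs σ) z = σ z :=
  fun _ hz => look_zip_map hz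

/-- The body of `d` is matched in `X`, with `F` as the image of the guard. -/
def GDep.Applies [Inhabited V] (d : GDep) (X : List (Atom Name V)) (F : Atom Name V) : Prop :=
  d.guard.mapArgs (matching d.guard F) = F ∧
    ∀ G ∈ d.side, G.mapArgs (matching d.guard F) ∈ X

theorem GDep.applies_iff [Inhabited V] {d : GDep} (hd : d.SideGuarded) {X : List (Atom Name V)}
    {F : Atom Name V} :
    d.Applies X F ↔ ∃ σ : Name → V, d.guard.mapArgs σ = F ∧ ∀ G ∈ d.side, G.mapArgs σ ∈ X := by
  refine ⟨fun h => ⟨_, h⟩, ?_⟩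
  rintro ⟨σ, rfl, h⟩
  have h1 := matching_mapArgs d.guard σ
  refine ⟨Atom.mapArgs_congr h1, fun G hG => ?_⟩
  rw [Atom.mapArgs_congr fun z hz => h1 z (hd G hG z hz)]
  exact h G hG

/-- The immediate consequences of the facts `X` under the full dependencies `L`. -/
noncomputable def consequences [Inhabited V] (L : List GDep) (X : List (Atom Name V)) :
    List (Atom Name V) :=
  X.flatMap fun F => (sel (fun d => d.Applies X F) L).map fun d =>
    d.head.mapArgs (matching d.guard F)

/-- The list of the consequences of the facts `X` under the full dependencies `L`. -/
noncomputable def cl [Inhabited V] (L : List GDep) (X : List (Atom Name V)) :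
    List (Atom Name V) := saturate (consequences L) X

theorem mem_consequences [Inhabited V] {L : List GDep} {X : List (Atom Name V)}
    {F : Atom Name V} : F ∈ consequences L X ↔
      ∃ G ∈ X, ∃ d ∈ L, d.Applies X G ∧ d.head.mapArgs (matching d.guard G) = F := by
  simp [consequences, mem_sel, and_assoc]

/-- Full guarded dependencies create no values, so that the closure of finitely many facts is
finite. -/
theorem exists_closedUnder_consequences [Inhabited V] {L : List GDep} (hL : ∀ d ∈ L, d.Guarded)
    (X : List (Atom Name V)) :
    ∃ U : Finset (Atom Name V), ClosedUnder (consequences L) (U : Set (Atom Name V)) ∧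
      ∀ F ∈ X, F ∈ U := by
  let E := X.flatMap Atom.args
  let H : List (Atom Name V) := X ++ L.flatMap fun d =>
    (tuples E d.head.args.length).map fun t => ⟨d.head.rel, t⟩
  have hE : ∀ F ∈ H, ∀ v ∈ F.args, v ∈ E := by
    intro F hF v hv
    rcases List.mem_append.1 hF with hF | hF
    · exact List.mem_flatMap.2 ⟨F, hF, hv⟩
    · simp only [List.mem_flatMap, List.mem_map] at hF
      obtain ⟨d, -, t, ht, rfl⟩ := hF
      exact (mem_tuples.1 ht).2 v hv
  refine ⟨H.toFinset, ?_, fun F hF => by simp [H, hF]⟩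
  intro Y hY F hF
  obtain ⟨G, hG, d, hd, hap, rfl⟩ := mem_consequences.1 hF
  refine List.mem_toFinset.2 (List.mem_append_right _ (List.mem_flatMap.2 ⟨d, hd,
    List.mem_map.2 ⟨_, mem_tuples.2 ⟨?_, ?_⟩, rfl⟩⟩))
  · simp
  · intro v hv
    obtain ⟨z, hz, rfl⟩ := List.mem_map.1 hv
    refine hE G (List.mem_toFinset.1 (hY G hG)) _ ?_
    rw [← hap.1]
    exact Atom.mem_mapArgs.2 ⟨z, (hL d hd).2 z hz, hap.1.symm ▸ rfl⟩

theorem mem_cl [Inhabited V] {L : List GDep} (hL : ∀ d ∈ L, d.Guarded) {X : List (Atom Name V)}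
    {F : Atom Name V} : F ∈ cl L X ↔ Cl L {F | F ∈ X} F := by
  obtain ⟨U, hU, hXU⟩ := exists_closedUnder_consequences hL X
  obtain ⟨h1, h2, h3⟩ := saturate_spec hU hXU
  constructor
  · refine h3 {F | Cl L {F | F ∈ X} F} ?_ (fun F hF => Cl.base hF) F
    intro Y hY F hF
    obtain ⟨G, hG, d, hd, hap, rfl⟩ := mem_consequences.1 hF
    exact Cl.step hd _ (hap.1.symm ▸ hY G hG) fun G hG => hY _ (hap.2 G hG)
  · intro h
    induction h with
    | base h => exact h1 _ h
    | step hd σ _ _ ih ih' =>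
      refine h2 _ (mem_consequences.2 ⟨_, ih, _, hd,
        (GDep.applies_iff (hL _ hd).1).2 ⟨σ, rfl, ih'⟩, ?_⟩)
      exact Atom.mapArgs_congr fun z hz => matching_mapArgs _ σ z ((hL _ hd).2 z hz)

end Closure

/-! ### Types and derived full dependencies -/

/-- All atoms of the constraints. -/
def atomsOf (C : List (TGD Name)) : List (Atom Name Name) := C.flatMap fun δ => δ.body ++ δ.head

/-- The full constraints, split into single head atoms, with all choices of a guard. -/
noncomputable def fullRules (C : List (TGD Name)) : List GDep :=
  (sel TGD.IsFull C).flatMap fun δ =>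
    (sel (fun A => vars δ.body ⊆ A.args.toFinset) δ.body).flatMap fun A =>
      δ.head.map fun B => ⟨A, δ.body, B⟩

/-- Body and head of the constraints that are not full. -/
noncomputable def inclusions (C : List (TGD Name)) : List (Atom Name Name × Atom Name Name) :=
  (sel (fun δ => ¬ δ.IsFull) C).flatMap fun δ => δ.body.flatMap fun A => δ.head.map fun B => (A, B)

/-- The atoms over `E` whose relations are side relations that occur in `C`. -/
noncomputable def sideFacts {V : Type} (C : List (TGD Name)) (side : Finset Name) (E : List V) :
    List (Atom Name V) :=
  (sel (fun G => G.rel ∈ side) (atomsOf C)).flatMap fun G =>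
    (tuples E G.args.length).map fun t => ⟨G.rel, t⟩

/-- The atoms of `sideFacts`, over the variables `E`, without repetitions. -/
noncomputable def sideAtoms (C : List (TGD Name)) (side : Finset Name) (E : List Name) :
    List (Atom Name Name) :=
  saturate (fun _ => sideFacts C side E) []

/-- All sublists. -/
noncomputable def subs {α : Type} (l : List α) : List (List α) :=
  (tuples [true, false] l.length).map fun b => (sel (fun q => q.2 = true) (l.zip b)).map Prod.fst

/-- The variables common to two atoms. -/
noncomputable def common (A B : Atom Name Name) : List Name := sel (fun z => z ∈ B.args) A.args

/-- The renaming of the variables of `A` and `B` which maps the common ones to the members of `t`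
and fixes the other ones. -/
noncomputable def renameVars (A B : Atom Name Name) (t : List Name) : Name → Name :=
  let l := sel (fun z => z ∉ common A B) (A.args ++ B.args)
  look ((common A B).zip t ++ l.zip l)

/-- The types: a type consists of an inclusion dependency, with some of the exported variables
identified, and a list of side atoms on the exported variables. It describes a fact generated by
that dependency from a fact that satisfies these side atoms. -/
noncomputable def types (C : List (TGD Name)) (side : Finset Name) : List GDep :=
  (inclusions C).flatMap fun q =>
    (tuples (common q.1 q.2) (common q.1 q.2).length).flatMap fun t =>
      (subs (sideAtoms C side (common (q.1.mapArgs (renameVars q.1 q.2 t))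
        (q.2.mapArgs (renameVars q.1 q.2 t))))).map fun s =>
          ⟨q.1.mapArgs (renameVars q.1 q.2 t), s, q.2.mapArgs (renameVars q.1 q.2 t)⟩

/-- The full dependencies which state that a side atom on the exported variables follows from a
type, as the full dependencies `L` derive it from the generated fact. -/
noncomputable def derived (C : List (TGD Name)) (side : Finset Name) (L : List GDep) :
    List GDep :=
  (types C side).flatMap fun τ =>
    (sel (fun F => F ∈ cl L (τ.head :: τ.side)) (sideAtoms C side τ.iface)).map fun F =>
      ⟨τ.guard, τ.side, F⟩

/-- The full constraints together with all derived full dependencies. -/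
noncomputable def rules (C : List (TGD Name)) (side : Finset Name) : List GDep :=
  saturate (derived C side) (fullRules C)

/-- The full dependencies among which `rules` is the least set closed under derivation. -/
noncomputable def candidates (C : List (TGD Name)) (side : Finset Name) : List GDep :=
  fullRules C ++ (types C side).flatMap fun τ =>
    (sideAtoms C side τ.iface).map fun F => ⟨τ.guard, τ.side, F⟩

theorem mem_sideFacts {V : Type} {C : List (TGD Name)} {side : Finset Name} {E : List V}
    {F : Atom Name V} : F ∈ sideFacts C side E ↔
      (∃ G ∈ atomsOf C, G.rel ∈ side ∧ F.rel = G.rel ∧ F.args.length = G.args.length) ∧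
        ∀ v ∈ F.args, v ∈ E := by
  simp only [sideFacts, List.mem_flatMap, List.mem_map, mem_sel, mem_tuples]
  constructor
  · rintro ⟨G, ⟨hG, hs⟩, t, ⟨ht, hE⟩, rfl⟩
    exact ⟨⟨G, hG, hs, rfl, ht⟩, hE⟩
  · rintro ⟨⟨G, hG, hs, hr, hl⟩, hE⟩
    exact ⟨G, ⟨hG, hs⟩, F.args, ⟨hl, hE⟩, by rw [← hr]⟩

theorem mem_sideAtoms {C : List (TGD Name)} {side : Finset Name} {E : List Name}
    {F : Atom Name Name} : F ∈ sideAtoms C side E ↔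
      (∃ G ∈ atomsOf C, G.rel ∈ side ∧ F.rel = G.rel ∧ F.args.length = G.args.length) ∧
        ∀ z ∈ F.args, z ∈ E := by
  have hspec := saturate_spec (st := fun _ => sideFacts C side E) (X := [])
    (U := (sideFacts C side E).toFinset) (fun Y _ a ha => by simpa using ha) (by simp)
  rw [← mem_sideFacts]
  exact ⟨hspec.2.2 {a | a ∈ sideFacts C side E} (fun Y _ a ha => ha) (by simp) F,
    fun h => hspec.2.1 F h⟩

theorem mem_of_mem_subs {α : Type} {l s : List α} (h : s ∈ subs l) {a : α} (ha : a ∈ s) :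
    a ∈ l := by
  obtain ⟨b, -, rfl⟩ := List.mem_map.1 h
  obtain ⟨q, hq, rfl⟩ := List.mem_map.1 ha
  exact (List.of_mem_zip (mem_sel.1 hq).1).1

theorem sel_mem_subs {α : Type} (P : α → Prop) (l : List α) : sel P l ∈ subs l := by
  refine List.mem_map.2 ⟨l.map fun a => decide (P a), mem_tuples.2 ⟨by simp, fun b _ => by
    cases b <;> simp⟩, ?_⟩
  induction l with
  | nil => rfl
  | cons a l ih =>
    by_cases h : P a
    · simpa [sel, h] using ih
    · simpa [sel, h] using ih

theorem mem_fullRules {C : List (TGD Name)} {d : GDep} : d ∈ fullRules C ↔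
    ∃ δ ∈ C, δ.IsFull ∧ δ.IsGuard d.guard ∧ d.side = δ.body ∧ d.head ∈ δ.head := by
  simp only [fullRules, List.mem_flatMap, mem_sel, List.mem_map, TGD.IsGuard]
  constructor
  · rintro ⟨δ, ⟨h1, h2⟩, A, ⟨h3, h4⟩, B, h5, rfl⟩
    exact ⟨δ, h1, h2, ⟨h3, h4⟩, rfl, h5⟩
  · rintro ⟨δ, h1, h2, ⟨h3, h4⟩, h5, h6⟩
    exact ⟨δ, ⟨h1, h2⟩, d.guard, ⟨h3, h4⟩, d.head, h6, by rw [← h5]⟩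

theorem mem_vars {R : Type} {L : List (Atom R Name)} {z : Name} :
    z ∈ vars L ↔ ∃ A ∈ L, z ∈ A.args := by simp [vars]

theorem guarded_of_mem_fullRules {C : List (TGD Name)} {d : GDep} (h : d ∈ fullRules C) :
    d.Guarded := by
  obtain ⟨δ, -, hf, hg, hs, hh⟩ := mem_fullRules.1 h
  have h1 : ∀ z ∈ vars δ.body, z ∈ d.guard.args := fun z hz => by simpa using hg.2 hz
  refine ⟨fun G hG z hz => h1 z (mem_vars.2 ⟨G, hs ▸ hG, hz⟩), fun z hz => h1 z (hf ?_)⟩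
  exact mem_vars.2 ⟨_, hh, hz⟩

theorem mem_common {A B : Atom Name Name} {z : Name} :
    z ∈ common A B ↔ z ∈ A.args ∧ z ∈ B.args := mem_sel

theorem GDep.iface_eq (d : GDep) : d.iface = common d.guard d.head := rfl

/-- A map which sends the common variables of two atoms to common variables and fixes their other
variables. -/
def IsRenaming (A B : Atom Name Name) (ρ : Name → Name) : Prop :=
  (∀ z ∈ common A B, ρ z ∈ common A B) ∧
    ∀ z, z ∈ A.args ∨ z ∈ B.args → z ∉ common A B → ρ z = z

theorem isRenaming_renameVars {A B : Atom Name Name} {t : List Name}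
    (ht : t ∈ tuples (common A B) (common A B).length) : IsRenaming A B (renameVars A B t) := by
  obtain ⟨h1, h2⟩ := mem_tuples.1 ht
  have hself : ∀ q ∈ (sel (fun z => z ∉ common A B) (A.args ++ B.args)).zip
      (sel (fun z => z ∉ common A B) (A.args ++ B.args)), q.1 ∉ common A B :=
    fun q hq => (mem_sel.1 (List.of_mem_zip hq).1).2
  constructor
  · intro z hz
    have h3 : ∃ q ∈ (common A B).zip t, q.1 = z := by
      have : z ∈ ((common A B).zip t).map Prod.fst := by rwa [List.map_fst_zip h1.ge]
      simpa using this
    obtain ⟨q, hq, hqz⟩ := h3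
    have h4 := look_mem (σ := (common A B).zip t ++
      (sel (fun z => z ∉ common A B) (A.args ++ B.args)).zip
        (sel (fun z => z ∉ common A B) (A.args ++ B.args)))
      ⟨q, List.mem_append_left _ hq, hqz⟩
    rcases List.mem_append.1 h4 with h4 | h4
    · exact h2 _ (List.of_mem_zip h4).2
    · exact absurd hz (hself _ h4)
  · intro z hz hzc
    refine look_eq (f := fun z => z) (fun q hq hqz => ?_) ?_
    · rcases List.mem_append.1 hq with hq | hq
      · exact absurd (hqz ▸ (List.of_mem_zip hq).1) hzc
      · rw [← hqz]
        exact mem_zip_map (f := fun z : Name => z) (by simpa using hq)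
    · refine ⟨(z, z), List.mem_append_right _ ?_, rfl⟩
      simpa using exists_mem_zip_map (fun z => z)
        (mem_sel.2 ⟨List.mem_append.2 hz, hzc⟩ : z ∈ sel (fun z => z ∉ common A B) _)

/-- All renamings arise from tuples, so that `types` misses none of them. -/
theorem exists_renameVars {A B : Atom Name Name} {ρ : Name → Name} (h : IsRenaming A B ρ) :
    ∃ t ∈ tuples (common A B) (common A B).length,
      ∀ z, z ∈ A.args ∨ z ∈ B.args → renameVars A B t z = ρ z := by
  refine ⟨(common A B).map ρ, mem_tuples.2 ⟨by simp, fun v hv => ?_⟩, fun z hz => ?_⟩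
  · obtain ⟨z, hz, rfl⟩ := List.mem_map.1 hv
    exact h.1 z hz
  · refine look_eq (f := ρ) (fun q hq hqz => ?_) ?_
    · rcases List.mem_append.1 hq with hq | hq
      · rw [mem_zip_map hq, hqz]
      · have h1 := mem_zip_map (f := fun z : Name => z) (by simpa using hq)
        rw [h1, hqz, h.2 z hz (hqz ▸ (mem_sel.1 (List.of_mem_zip hq).1).2)]
    · by_cases hzc : z ∈ common A B
      · exact ⟨_, List.mem_append_left _ (exists_mem_zip_map ρ hzc), rfl⟩
      · refine ⟨(z, z), List.mem_append_right _ ?_, rfl⟩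
        simpa using exists_mem_zip_map (fun z => z)
          (mem_sel.2 ⟨List.mem_append.2 hz, hzc⟩ : z ∈ sel (fun z => z ∉ common A B) _)

theorem mem_types {C : List (TGD Name)} {side : Finset Name} {τ : GDep} : τ ∈ types C side ↔
    ∃ A B t, (A, B) ∈ inclusions C ∧ t ∈ tuples (common A B) (common A B).length ∧
      τ.guard = A.mapArgs (renameVars A B t) ∧ τ.head = B.mapArgs (renameVars A B t) ∧
      τ.side ∈ subs (sideAtoms C side τ.iface) := by
  simp only [types, List.mem_flatMap, List.mem_map, GDep.iface_eq]
  constructor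
  · rintro ⟨⟨A, B⟩, h, t, ht, s, hs, rfl⟩
    exact ⟨A, B, t, h, ht, rfl, rfl, hs⟩
  · rintro ⟨A, B, t, h, ht, h1, h2, hs⟩
    rw [h1, h2] at hs
    exact ⟨(A, B), h, t, ht, τ.side, hs, by rw [← h1, ← h2]⟩

section Types

variable {C : List (TGD Name)} {side : Finset Name} {S : Signature Name} {w h : ℕ} {D : Type}

theorem inclusions_spec (hC : Admissible S side w h C) {A B : Atom Name Name}
    (hAB : (A, B) ∈ inclusions C) :
    ∃ δ ∈ C, δ.body = [A] ∧ δ.head = [B] ∧ A.args.Nodup ∧ δ.width ≤ w ∧ A.Over S ∧ B.Over S := by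
  simp only [inclusions, List.mem_flatMap, mem_sel, List.mem_map, Prod.mk.injEq] at hAB
  obtain ⟨δ, ⟨hδ, hf⟩, A', hA, B', hB, rfl, rfl⟩ := hAB
  obtain ⟨hS, ⟨hid, -, hw⟩ | ⟨hf', -⟩⟩ := hC δ hδ
  · obtain ⟨A, B, h1, h2, h3, -⟩ := hid
    have hA' := hA
    have hB' := hB
    rw [h1, List.mem_singleton] at hA
    rw [h2, List.mem_singleton] at hB
    subst hA hB
    exact ⟨δ, hδ, h1, h2, h3, hw, hS.1 _ hA', hS.2 _ hB'⟩
  · exact absurd hf' hf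

theorem atomsOf_over (hC : Admissible S side w h C) {A : Atom Name Name} (hA : A ∈ atomsOf C) :
    A.Over S := by
  obtain ⟨δ, hδ, hA⟩ := List.mem_flatMap.1 hA
  rcases List.mem_append.1 hA with hA | hA
  · exact (hC δ hδ).1.1 A hA
  · exact (hC δ hδ).1.2 A hA

theorem sideAtoms_over (hC : Admissible S side w h C) {E : List Name} {F : Atom Name Name}
    (hF : F ∈ sideAtoms C side E) : F.Over S := by
  obtain ⟨⟨G, hG, -, hr, hl⟩, -⟩ := mem_sideAtoms.1 hF
  have := atomsOf_over hC hG
  exact ⟨hr ▸ this.1, by rw [hl, hr]; exact this.2⟩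

theorem types_over (hC : Admissible S side w h C) {τ : GDep} (hτ : τ ∈ types C side) :
    τ.guard.Over S ∧ τ.head.Over S ∧ ∀ G ∈ τ.side, G.Over S := by
  obtain ⟨A, B, t, hAB, -, h1, h2, hs⟩ := mem_types.1 hτ
  obtain ⟨-, -, -, -, -, -, hA, hB⟩ := inclusions_spec hC hAB
  exact ⟨h1 ▸ hA.mapArgs _, h2 ▸ hB.mapArgs _,
    fun G hG => sideAtoms_over hC (mem_of_mem_subs hs hG)⟩

theorem types_side_subset {τ : GDep} (hτ : τ ∈ types C side) {G : Atom Name Name}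
    (hG : G ∈ τ.side) : G ∈ sideAtoms C side τ.iface := by
  obtain ⟨-, -, -, -, -, -, -, hs⟩ := mem_types.1 hτ
  exact mem_of_mem_subs hs hG

theorem types_sideGuarded {τ : GDep} (hτ : τ ∈ types C side) : τ.SideGuarded := fun _ hG z hz =>
  (GDep.mem_iface.1 ((mem_sideAtoms.1 (types_side_subset hτ hG)).2 z hz)).1

/-- All atoms of a generated fact together with its side atoms use only variables of the head. -/
theorem types_args_head {τ : GDep} (hτ : τ ∈ types C side) :
    ∀ F ∈ τ.head :: τ.side, ∀ z ∈ F.args, z ∈ τ.head.args := by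
  intro F hF z hz
  rcases List.mem_cons.1 hF with rfl | hF
  · exact hz
  · exact (GDep.mem_iface.1 ((mem_sideAtoms.1 (types_side_subset hτ hF)).2 z hz)).2

/-- A renaming of the exported variables does not create new exported variables. -/
theorem IsRenaming.common_subset {A B : Atom Name Name} {ρ : Name → Name} (hρ : IsRenaming A B ρ)
    {z : Name} (hz : z ∈ common (A.mapArgs ρ) (B.mapArgs ρ)) : ∃ y ∈ common A B, ρ y = z := by
  obtain ⟨hzA, hzB⟩ := mem_common.1 hz
  obtain ⟨a, ha, haz⟩ := Atom.mem_mapArgs.1 hzA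
  obtain ⟨b, hb, hbz⟩ := Atom.mem_mapArgs.1 hzB
  by_cases hac : a ∈ common A B
  · exact ⟨a, hac, haz⟩
  by_cases hbc : b ∈ common A B
  · exact ⟨b, hbc, hbz⟩
  have h1 := hρ.2 a (.inl ha) hac
  have h2 := hρ.2 b (.inr hb) hbc
  have hab : a = b := by rw [← h1, ← h2, haz, hbz]
  exact absurd (mem_common.2 ⟨ha, hab ▸ hb⟩) hac

theorem types_iface_subset {τ : GDep} (hτ : τ ∈ types C side) :
    ∃ A B, (A, B) ∈ inclusions C ∧ ∀ z ∈ τ.iface, z ∈ common A B := by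
  obtain ⟨A, B, t, hAB, ht, h1, h2, hs⟩ := mem_types.1 hτ
  refine ⟨A, B, hAB, fun z hz => ?_⟩
  have hρ := isRenaming_renameVars ht
  rw [GDep.iface_eq, h1, h2] at hz
  obtain ⟨y, hy, rfl⟩ := hρ.common_subset hz
  exact hρ.1 y hy

theorem common_toFinset {A B : Atom Name Name} {δ : TGD Name} (h1 : δ.body = [A])
    (h2 : δ.head = [B]) : (common A B).toFinset = δ.exported := by
  ext z
  simp [mem_common, TGD.exported, mem_vars, h1, h2]

theorem types_width (hC : Admissible S side w h C) {τ : GDep} (hτ : τ ∈ types C side) :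
    τ.iface.toFinset.card ≤ w := by
  obtain ⟨A, B, hAB, hsub⟩ := types_iface_subset hτ
  obtain ⟨δ, -, h1, h2, -, hw, -⟩ := inclusions_spec hC hAB
  refine (Finset.card_le_card fun z hz => ?_).trans hw
  rw [← common_toFinset h1 h2]
  simpa using hsub z (by simpa using hz)

/-- The dependency from guard to head of a type follows from the constraints. -/
theorem types_sat (hC : Admissible S side w h C) {I : Instance Name D} (hI : ∀ δ ∈ C, δ.Sat I)
    {τ : GDep} (hτ : τ ∈ types C side) {σ : Name → D} (hσ : τ.guard.mapArgs σ ∈ I) :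
    ∃ μ : Name → D, (∀ z ∈ τ.guard.args, μ z = σ z) ∧ τ.head.mapArgs μ ∈ I := by
  obtain ⟨A, B, t, hAB, ht, h1, h2, -⟩ := mem_types.1 hτ
  obtain ⟨δ, hδ, hb, hh, -, -, -, -⟩ := inclusions_spec hC hAB
  have hρ := isRenaming_renameVars ht
  set ρ := renameVars A B t
  rw [h1, Atom.mapArgs_mapArgs] at hσ
  obtain ⟨μ, hμ, hμh⟩ := hI δ hδ (fun z => σ (ρ z)) (by simpa [hb] using hσ)
  have hμB : B.mapArgs μ ∈ I := hμh B (by simp [hh])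
  have hμA : ∀ z ∈ A.args, μ z = σ (ρ z) := fun z hz =>
    hμ z (mem_vars.2 ⟨A, by simp [hb], hz⟩)
  refine ⟨fun z => if z ∈ A.args then σ z else μ z, fun z hz => ?_, ?_⟩
  · rw [h1] at hz
    obtain ⟨y, hy, rfl⟩ := Atom.mem_mapArgs.1 hz
    by_cases hyc : y ∈ common A B
    · exact if_pos (mem_common.1 (hρ.1 y hyc)).1
    · rw [hρ.2 y (.inl hy) hyc]
      exact if_pos hy
  · rw [h2, Atom.mapArgs_mapArgs]
    convert hμB using 1
    refine Atom.mapArgs_congr fun z hz => ?_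
    by_cases hzc : z ∈ common A B
    · rw [if_pos (mem_common.1 (hρ.1 z hzc)).1, hμA z (mem_common.1 hzc).1]
    · have hzA : z ∉ A.args := fun h => hzc (mem_common.2 ⟨h, hz⟩)
      rw [hρ.2 z (.inr hz) hzc, if_neg hzA]

/-- Every match of the body of an inclusion dependency is described by a type which identifies
exactly the exported variables with equal values and which lists all side atoms that hold. -/
theorem exists_type {A B : Atom Name Name} (hAB : (A, B) ∈ inclusions C) (σ : Name → D)
    (P : Atom Name Name → Prop) :
    ∃ τ ∈ types C side, τ.guard.mapArgs σ = A.mapArgs σ ∧ Set.InjOn σ {z | z ∈ τ.iface} ∧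
      τ.side = sel P (sideAtoms C side τ.iface) ∧
      ∀ μ : Name → D, (∀ z ∈ τ.guard.args, μ z = σ z) →
        ∃ μ' : Name → D, (∀ z ∈ A.args, μ' z = σ z) ∧ τ.head.mapArgs μ = B.mapArgs μ' := by
  let r : Name → Name := fun z => Function.invFunOn σ {y | y ∈ common A B} (σ z)
  let ρ : Name → Name := fun z => if z ∈ common A B then r z else z
  have hr : ∀ z ∈ common A B, r z ∈ common A B ∧ σ (r z) = σ z := fun z hz =>
    ⟨Function.invFunOn_mem (s := {y | y ∈ common A B}) ⟨z, hz, rfl⟩,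
      Function.invFunOn_eq (s := {y | y ∈ common A B}) ⟨z, hz, rfl⟩⟩
  have hρ : IsRenaming A B ρ :=
    ⟨fun z hz => by simp only [ρ, if_pos hz]; exact (hr z hz).1,
      fun z _ hz => by simp only [ρ, if_neg hz]⟩
  have hσρ : ∀ z, σ (ρ z) = σ z := fun z => by
    by_cases hz : z ∈ common A B
    · simp only [ρ, if_pos hz]; exact (hr z hz).2
    · simp only [ρ, if_neg hz]
  obtain ⟨t, ht, htρ⟩ := exists_renameVars hρ
  have hA : A.mapArgs (renameVars A B t) = A.mapArgs ρ :=
    Atom.mapArgs_congr fun z hz => htρ z (.inl hz)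
  have hB : B.mapArgs (renameVars A B t) = B.mapArgs ρ :=
    Atom.mapArgs_congr fun z hz => htρ z (.inr hz)
  refine ⟨⟨A.mapArgs ρ, sel P (sideAtoms C side (common (A.mapArgs ρ) (B.mapArgs ρ))),
    B.mapArgs ρ⟩, mem_types.2 ⟨A, B, t, hAB, ht, hA.symm, hB.symm, sel_mem_subs _ _⟩,
    ?_, ?_, rfl, ?_⟩
  · rw [Atom.mapArgs_mapArgs]
    exact Atom.mapArgs_congr fun z _ => hσρ z
  · intro u hu v hv huv
    obtain ⟨y, hy, rfl⟩ := hρ.common_subset hu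
    obtain ⟨z, hz, rfl⟩ := hρ.common_subset hv
    rw [hσρ, hσρ] at huv
    simp only [ρ, if_pos hy, if_pos hz, r, huv]
  · intro μ hμ
    refine ⟨fun z => μ (ρ z), fun z hz => ?_, Atom.mapArgs_mapArgs _ _ _⟩
    exact (hμ _ (Atom.mem_mapArgs.2 ⟨z, hz, rfl⟩)).trans (hσρ z)

end Types

section Rules

variable {C : List (TGD Name)} {side : Finset Name} {S : Signature Name} {w h : ℕ} {D : Type}

theorem mem_derived {L : List GDep} {d : GDep} : d ∈ derived C side L ↔
    ∃ τ ∈ types C side, ∃ F ∈ sideAtoms C side τ.iface, F ∈ cl L (τ.head :: τ.side) ∧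
      (⟨τ.guard, τ.side, F⟩ : GDep) = d := by
  simp [derived, mem_sel, and_assoc]

theorem derived_subset_candidates (L : List GDep) :
    ∀ d ∈ derived C side L, d ∈ candidates C side := by
  intro d hd
  obtain ⟨τ, hτ, F, hF, -, rfl⟩ := mem_derived.1 hd
  exact List.mem_append_right _ (List.mem_flatMap.2 ⟨τ, hτ, List.mem_map.2 ⟨F, hF, rfl⟩⟩)

theorem rules_spec (C : List (TGD Name)) (side : Finset Name) :
    (∀ d ∈ fullRules C, d ∈ rules C side) ∧
      (∀ d ∈ derived C side (rules C side), d ∈ rules C side) ∧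
      ∀ P : Set GDep, ClosedUnder (derived C side) P → (∀ d ∈ fullRules C, d ∈ P) →
        ∀ d ∈ rules C side, d ∈ P :=
  saturate_spec (U := (candidates C side).toFinset)
    (fun Y _ d hd => by simpa using derived_subset_candidates Y d hd)
    (fun d hd => by simp [candidates, hd])

theorem guarded_of_mem_candidates {d : GDep} (hd : d ∈ candidates C side) : d.Guarded := by
  rcases List.mem_append.1 hd with hd | hd
  · exact guarded_of_mem_fullRules hd
  · simp only [List.mem_flatMap, List.mem_map] at hd
    obtain ⟨τ, hτ, F, hF, rfl⟩ := hd
    exact ⟨fun G hG z hz => types_sideGuarded hτ G hG z hz,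
      fun z hz => (GDep.mem_iface.1 ((mem_sideAtoms.1 hF).2 z hz)).1⟩

theorem rules_subset_candidates : ∀ d ∈ rules C side, d ∈ candidates C side :=
  (rules_spec C side).2.2 {d | d ∈ candidates C side}
    (fun Y _ d hd => derived_subset_candidates Y d hd) fun _ hd => List.mem_append_left _ hd

theorem rules_guarded : ∀ d ∈ rules C side, d.Guarded := fun d hd =>
  guarded_of_mem_candidates (rules_subset_candidates d hd)

theorem mem_atomsOf_of_mem_fullRules {d : GDep} (hd : d ∈ fullRules C) : d.head ∈ atomsOf C := by
  obtain ⟨δ, hδ, -, -, -, hh⟩ := mem_fullRules.1 hd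
  exact List.mem_flatMap.2 ⟨δ, hδ, List.mem_append_right _ hh⟩

theorem rules_over (hC : Admissible S side w h C) : ∀ d ∈ rules C side, d.head.Over S := by
  intro d hd
  rcases List.mem_append.1 (rules_subset_candidates d hd) with hd | hd
  · exact atomsOf_over hC (mem_atomsOf_of_mem_fullRules hd)
  · simp only [List.mem_flatMap, List.mem_map] at hd
    obtain ⟨τ, hτ, F, hF, rfl⟩ := hd
    exact sideAtoms_over hC hF

/-- The full dependencies in `rules` follow from the constraints. -/
theorem rules_sat (hC : Admissible S side w h C) {I : Instance Name D} (hI : ∀ δ ∈ C, δ.Sat I) :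
    ∀ d ∈ rules C side, d.Sat I := by
  suffices H : ∀ d ∈ rules C side, d.Guarded ∧ d.Sat I from fun d hd => (H d hd).2
  refine (rules_spec C side).2.2 {d | d.Guarded ∧ d.Sat I} ?_ ?_
  · intro L hL d hd
    obtain ⟨τ, hτ, F, hF, hcl, rfl⟩ := mem_derived.1 hd
    refine ⟨guarded_of_mem_candidates (derived_subset_candidates L _ hd), fun σ hg hs => ?_⟩
    obtain ⟨μ, hμ, hμh⟩ := types_sat hC hI hτ hg
    have hFμ : F.mapArgs μ = F.mapArgs σ := Atom.mapArgs_congr fun z hz =>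
      hμ z (GDep.mem_iface.1 ((mem_sideAtoms.1 hF).2 z hz)).1
    rw [← hFμ]
    refine Cl.map_mem (fun d hd => (hL d hd).2) ?_ ((mem_cl fun d hd => (hL d hd).1).1 hcl)
    intro G hG
    rcases List.mem_cons.1 hG with rfl | hG
    · exact hμh
    · rw [Atom.mapArgs_congr fun z hz => hμ z (types_sideGuarded hτ G hG z hz)]
      exact hs G hG
  · intro d hd
    refine ⟨guarded_of_mem_fullRules hd, fun σ _ hs => ?_⟩
    obtain ⟨δ, hδ, hf, -, hside, hh⟩ := mem_fullRules.1 hd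
    obtain ⟨μ, hμ, hμh⟩ := hI δ hδ σ (hside ▸ hs)
    rw [← Atom.mapArgs_congr fun z hz => hμ z (hf (mem_vars.2 ⟨_, hh, hz⟩))]
    exact hμh _ hh

theorem rules_derived {τ : GDep} (hτ : τ ∈ types C side) {F : Atom Name Name}
    (hF : F ∈ sideAtoms C side τ.iface)
    (hcl : Cl (rules C side) {G | G ∈ τ.head :: τ.side} F) :
    (⟨τ.guard, τ.side, F⟩ : GDep) ∈ rules C side :=
  (rules_spec C side).2.1 _ (mem_derived.2 ⟨τ, hτ, F, hF, (mem_cl rules_guarded).2 hcl, rfl⟩)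

end Rules

/-! ### The linear constraints -/

/-- The representation of a dependency with one guard and one head atom. -/
def encGDep (e : Name → Data) (d : GDep) : Data :=
  .node (encAtom e encName d.guard) (.node (encList (encAtom e encName) d.side)
    (encAtom e encName d.head))

theorem encAtom_injective {R T : Type} {eR : R → Data} {eT : T → Data}
    (hR : Function.Injective eR) (hT : Function.Injective eT) :
    Function.Injective (encAtom eR eT) := by
  rintro ⟨r, l⟩ ⟨r', l'⟩ h
  simp only [encAtom, Data.node.injEq] at h
  rw [hR h.1, encList_injective hT h.2]

theorem encGDep_injective {e : Name → Data} (he : Function.Injective e) :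
    Function.Injective (encGDep e) := by
  rintro ⟨g, s, b⟩ ⟨g', s', b'⟩ h
  have hA := encAtom_injective he encName_injective
  simp only [encGDep, Data.node.injEq] at h
  rw [hA h.1, encList_injective hA h.2.1, hA h.2.2]

theorem encMarked_injective (side : Finset Name) : Function.Injective (encMarked side) := by
  intro r r' h
  simp only [encMarked, Data.node.injEq] at h
  exact encName_injective h.2

/-- The names of the two new relations of a type: one for the facts that trigger its dependency
(`false`) and one for the generated facts (`true`). -/
def typeName (side : Finset Name) (b : Bool) (τ : GDep) : Name :=
  b :: serialize (encGDep (encMarked side) τ) []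

theorem typeName_inj {side : Finset Name} {b b' : Bool} {τ τ' : GDep} :
    typeName side b τ = typeName side b' τ' ↔ b = b' ∧ τ = τ' := by
  constructor
  · intro h
    simp only [typeName, List.cons.injEq] at h
    exact ⟨h.1, encGDep_injective (encMarked_injective side) (serialize_injective h.2)⟩
  · rintro ⟨rfl, rfl⟩
    rfl

section

variable {V : Type} [Inhabited V]

/-- The atoms which state that a fact triggers a type. -/
noncomputable def triggers (C : List (TGD Name)) (side : Finset Name) (X : List (Atom Name V)) :
    List (Atom (Name ⊕ Name) V) :=
  X.flatMap fun F => (sel (fun τ => τ.Applies X F) (types C side)).map fun τ =>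
    ⟨.inr (typeName side false τ), F.args⟩

/-- The closure of the facts `X`, with all its triggers. -/
noncomputable def annotate (C : List (TGD Name)) (side : Finset Name) (X : List (Atom Name V)) :
    List (Atom (Name ⊕ Name) V) :=
  (cl (rules C side) X).map (Atom.mapRel .inl) ++ triggers C side (cl (rules C side) X)

end

/-- The linear constraints: a trigger of a type generates a fact of that type, from which the
annotated closure of that fact follows. -/
noncomputable def linearized (C : List (TGD Name)) (side : Finset Name) :
    List (TGD (Name ⊕ Name)) :=
  (types C side).flatMap fun τ =>
    ⟨[⟨.inr (typeName side false τ), τ.guard.args⟩],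
        [⟨.inr (typeName side true τ), τ.head.args⟩]⟩ ::
      (annotate C side (τ.head :: τ.side)).map fun G =>
        ⟨[⟨.inr (typeName side true τ), τ.head.args⟩], [G]⟩

/-- The atom of a type to which the new relation `typeName side b τ` corresponds. -/
def GDep.atom (τ : GDep) (b : Bool) : Atom Name Name := if b = true then τ.head else τ.guard

/-- The extended signature: every type `τ` adds two relations, with the arities of the relations of
its guard and of its head. The arity of names which are not names of types is irrelevant. -/
noncomputable def extended (S : Signature Name) (C : List (TGD Name)) (side : Finset Name)
    (hS : ∀ τ ∈ types C side, ∀ b, (τ.atom b).Over S) : Signature (Name ⊕ Name) where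
  rels := {r | (∃ s ∈ S.rels, r = .inl s) ∨ ∃ τ ∈ types C side, ∃ b, r = .inr (typeName side b τ)}
  arity
    | .inl s => S.arity s
    | .inr n => if h : ∃ q : GDep × Bool, n = typeName side q.2 q.1 then
        S.arity (h.choose.1.atom h.choose.2).rel else 0
  arity_pos := by
    rintro r (⟨s, hs, rfl⟩ | ⟨τ, hτ, b, rfl⟩)
    · exact S.arity_pos s hs
    · have h : ∃ q : GDep × Bool, typeName side b τ = typeName side q.2 q.1 := ⟨(τ, b), rfl⟩
      obtain ⟨h1, h2⟩ := typeName_inj.1 h.choose_spec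
      simp only [dif_pos h, ← h1, ← h2]
      exact S.arity_pos _ (hS τ hτ b).1

section Extended

variable {C : List (TGD Name)} {side : Finset Name} {S : Signature Name} {w h : ℕ} {D V : Type}
  {hS : ∀ τ ∈ types C side, ∀ b, (τ.atom b).Over S}

theorem atom_over (hC : Admissible S side w h C) : ∀ τ ∈ types C side, ∀ b, (τ.atom b).Over S := by
  intro τ hτ b
  obtain ⟨h1, h2, -⟩ := types_over hC hτ
  cases b
  · exact h1
  · exact h2

theorem extended_arity (τ : GDep) (b : Bool) :
    (extended S C side hS).arity (.inr (typeName side b τ)) = S.arity (τ.atom b).rel := by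
  have h : ∃ q : GDep × Bool, typeName side b τ = typeName side q.2 q.1 := ⟨(τ, b), rfl⟩
  obtain ⟨h1, h2⟩ := typeName_inj.1 h.choose_spec
  simp only [extended, dif_pos h, ← h1, ← h2]

theorem extended_extends : Extends (extended S C side hS) S :=
  ⟨fun r => by simp [extended], fun r _ => rfl⟩

theorem extended_arity_le {a : ℕ} (ha : ∀ r ∈ S.rels, S.arity r ≤ a) :
    ∀ r ∈ (extended S C side hS).rels, (extended S C side hS).arity r ≤ a := by
  rintro r (⟨s, hs, rfl⟩ | ⟨τ, hτ, b, rfl⟩)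
  · exact ha s hs
  · rw [extended_arity]
    exact ha _ (hS τ hτ b).1

theorem over_inl {F : Atom Name V} (hF : F.Over S) :
    (F.mapRel Sum.inl : Atom (Name ⊕ Name) V).Over (extended S C side hS) :=
  ⟨.inl ⟨_, hF.1, rfl⟩, hF.2⟩

theorem over_inr {τ : GDep} (hτ : τ ∈ types C side) {b : Bool} {l : List V}
    (hl : l.length = (τ.atom b).args.length) :
    (⟨.inr (typeName side b τ), l⟩ : Atom (Name ⊕ Name) V).Over (extended S C side hS) :=
  ⟨.inr ⟨τ, hτ, b, rfl⟩, by rw [extended_arity, hl]; exact (hS τ hτ b).2⟩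

variable [Inhabited V]

theorem mem_triggers {X : List (Atom Name V)} {G : Atom (Name ⊕ Name) V} :
    G ∈ triggers C side X ↔ ∃ τ ∈ types C side, ∃ σ : Name → V, τ.guard.mapArgs σ ∈ X ∧
      (∀ H ∈ τ.side, H.mapArgs σ ∈ X) ∧
      G = ⟨.inr (typeName side false τ), (τ.guard.mapArgs σ).args⟩ := by
  simp only [triggers, List.mem_flatMap, List.mem_map, mem_sel]
  constructor
  · rintro ⟨F, hF, τ, ⟨hτ, hap⟩, rfl⟩
    exact ⟨τ, hτ, _, hap.1.symm ▸ hF, hap.2, by rw [hap.1]⟩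
  · rintro ⟨τ, hτ, σ, h1, h2, rfl⟩
    exact ⟨_, h1, τ, ⟨hτ, (GDep.applies_iff (types_sideGuarded hτ)).2 ⟨σ, rfl, h2⟩⟩, rfl⟩

theorem mem_annotate {X : List (Atom Name V)} {G : Atom (Name ⊕ Name) V} :
    G ∈ annotate C side X ↔ (∃ F, Cl (rules C side) {F | F ∈ X} F ∧ G = F.mapRel .inl) ∨
      ∃ τ ∈ types C side, ∃ σ : Name → V, Cl (rules C side) {F | F ∈ X} (τ.guard.mapArgs σ) ∧
        (∀ H ∈ τ.side, Cl (rules C side) {F | F ∈ X} (H.mapArgs σ)) ∧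
        G = ⟨.inr (typeName side false τ), (τ.guard.mapArgs σ).args⟩ := by
  simp only [annotate, List.mem_append, mem_triggers, List.mem_map, mem_cl rules_guarded]
  exact or_congr (exists_congr fun F => and_congr_right fun _ => eq_comm) Iff.rfl

theorem annotate_over (hC : Admissible S side w h C) {X : List (Atom Name V)}
    (hX : ∀ F ∈ X, F.Over S) {G : Atom (Name ⊕ Name) V} (hG : G ∈ annotate C side X) :
    G.Over (extended S C side hS) := by
  rcases mem_annotate.1 hG with ⟨F, hF, rfl⟩ | ⟨τ, hτ, σ, -, -, rfl⟩
  · exact over_inl (Cl.over (rules_over hC) hX hF)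
  · exact over_inr hτ (by simp [Atom.mapArgs, GDep.atom])

theorem mem_linearized {δ : TGD (Name ⊕ Name)} : δ ∈ linearized C side ↔
    ∃ τ ∈ types C side, δ = ⟨[⟨.inr (typeName side false τ), τ.guard.args⟩],
        [⟨.inr (typeName side true τ), τ.head.args⟩]⟩ ∨
      ∃ G ∈ annotate C side (τ.head :: τ.side),
        δ = ⟨[⟨.inr (typeName side true τ), τ.head.args⟩], [G]⟩ := by
  simp only [linearized, List.mem_flatMap, List.mem_cons, List.mem_map]
  exact exists_congr fun τ => and_congr_right fun _ => or_congr Iff.rfl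
    (exists_congr fun G => and_congr_right fun _ => eq_comm)

theorem linearized_over (hC : Admissible S side w h C) :
    ∀ δ ∈ linearized C side, δ.Over (extended S C side hS) ∧ δ.IsLinear := by
  intro δ hδ
  obtain ⟨τ, hτ, rfl | ⟨G, hG, rfl⟩⟩ := mem_linearized.1 hδ
  · refine ⟨⟨?_, ?_⟩, ⟨_, _, rfl, rfl⟩⟩ <;> intro A hA <;> rw [List.mem_singleton] at hA <;>
      subst hA <;> exact over_inr hτ rfl
  · refine ⟨⟨?_, ?_⟩, ⟨_, _, rfl, rfl⟩⟩ <;> intro A hA <;> rw [List.mem_singleton] at hA <;>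
      subst hA
    · exact over_inr hτ rfl
    · refine annotate_over hC (fun F hF => ?_) hG
      obtain ⟨-, h2, h3⟩ := types_over hC hτ
      rcases List.mem_cons.1 hF with rfl | hF
      · exact h2
      · exact h3 F hF

theorem linearized_semiWidth (hC : Admissible S side w h C) :
    SemiWidthLE {δ | δ ∈ linearized C side} w := by
  -- the dependencies without a generated fact in the body have small width; the other ones lead
  -- from the relations of generated facts to other relations
  let gen : Name ⊕ Name → Prop := fun r => ∃ τ, r = .inr (typeName side true τ)
  refine ⟨{δ | δ ∈ linearized C side ∧ ¬ ∃ A ∈ δ.body, gen A.rel},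
    {δ | δ ∈ linearized C side ∧ ∃ A ∈ δ.body, gen A.rel}, ?_, ?_, ?_⟩
  · ext δ
    rw [Set.mem_union]
    exact ⟨fun h => (Classical.em _).elim (fun h' => .inr ⟨h, h'⟩) fun h' => .inl ⟨h, h'⟩,
      fun h => h.elim And.left And.left⟩
  · rintro δ ⟨hδ, hn⟩
    obtain ⟨τ, hτ, rfl | ⟨G, hG, rfl⟩⟩ := mem_linearized.1 hδ
    · refine le_trans (Finset.card_le_card fun z hz => ?_) (types_width hC hτ)
      simp only [TGD.exported, Finset.mem_inter, mem_vars, List.mem_singleton, exists_eq_left] at hz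
      exact List.mem_toFinset.2 (GDep.mem_iface.2 hz)
    · exact absurd ⟨_, List.mem_singleton_self _, τ, rfl⟩ hn
  · have hedge : ∀ p q, PositionEdge
        {δ | δ ∈ linearized C side ∧ ∃ A ∈ δ.body, gen A.rel} p q → gen p.1 ∧ ¬ gen q.1 := by
      rintro p q ⟨δ, ⟨hδ, hg⟩, x, -, ⟨A, hA, hAp, -⟩, B, hB, hBq, -⟩
      obtain ⟨τ, hτ, rfl | ⟨G, hG, rfl⟩⟩ := mem_linearized.1 hδ
      · obtain ⟨A', hA', τ', h⟩ := hg
        rw [List.mem_singleton] at hA'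
        subst hA'
        simp [typeName_inj] at h
      · rw [List.mem_singleton] at hA hB
        subst hA hB
        refine ⟨⟨τ, hAp.symm⟩, ?_⟩
        rintro ⟨τ', h⟩
        rw [← hBq] at h
        rcases mem_annotate.1 hG with ⟨F, -, rfl⟩ | ⟨τ₂, -, σ, -, -, rfl⟩
        · cases h
        · simp [typeName_inj] at h
    intro p hp
    have h1 : ∀ q, Relation.TransGen (PositionEdge
        {δ | δ ∈ linearized C side ∧ ∃ A ∈ δ.body, gen A.rel}) p q → gen p.1 ∧ ¬ gen q.1 := by
      intro q hq
      induction hq with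
      | single h => exact hedge _ _ h
      | tail _ h ih => exact absurd (hedge _ _ h).1 ih.2
    exact (h1 p hp).2 (h1 p hp).1

end Extended

/-! ### Soundness -/

section Soundness

variable {C : List (TGD Name)} {side : Finset Name} {S : Signature Name} {w h : ℕ} {D V : Type}
  {hS : ∀ τ ∈ types C side, ∀ b, (τ.atom b).Over S}

/-- The expansion of an instance, where the new relations of a type have their intended meaning. -/
def expansion (C : List (TGD Name)) (side : Finset Name) (I : Instance Name D) :
    Instance (Name ⊕ Name) D :=
  {G | (∃ F ∈ I, G = F.mapRel .inl) ∨ ∃ τ ∈ types C side, ∃ b, ∃ σ : Name → D,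
    (τ.atom b).mapArgs σ ∈ I ∧ (∀ H ∈ τ.side, H.mapArgs σ ∈ I) ∧
    G = ⟨.inr (typeName side b τ), ((τ.atom b).mapArgs σ).args⟩}

theorem mapRel_mem_expansion {I : Instance Name D} {F : Atom Name D} :
    F.mapRel .inl ∈ expansion C side I ↔ F ∈ I := by
  constructor
  · rintro (⟨F', hF', h⟩ | ⟨τ, -, b, σ, -, -, h⟩)
    · cases F; cases F'
      simp only [Atom.mapRel, Atom.mk.injEq, Sum.inl.injEq] at h
      obtain ⟨rfl, rfl⟩ := h
      exact hF'
    · simp [Atom.mapRel] at h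
  · exact fun h => .inl ⟨F, h, rfl⟩

theorem mem_expansion {I : Instance Name D} {τ : GDep} (hτ : τ ∈ types C side) {b : Bool}
    {ν : Name → D} : (⟨.inr (typeName side b τ), (τ.atom b).args.map ν⟩ : Atom _ D) ∈
      expansion C side I ↔ (τ.atom b).mapArgs ν ∈ I ∧ ∀ H ∈ τ.side, H.mapArgs ν ∈ I := by
  constructor
  · rintro (⟨F', hF', h⟩ | ⟨τ', -, b', σ, h1, h2, h⟩)
    · simp [Atom.mapRel] at h
    · simp only [Atom.mapArgs, Atom.mk.injEq, Sum.inr.injEq, typeName_inj] at h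
      obtain ⟨⟨rfl, rfl⟩, h⟩ := h
      have h3 := List.map_inj_left.1 h
      rw [Atom.mapArgs_congr h3]
      refine ⟨h1, fun H hH => ?_⟩
      rw [Atom.mapArgs_congr (g := σ) fun z hz => h3 z ?_]
      · exact h2 H hH
      · cases b
        · exact types_sideGuarded hτ H hH z hz
        · exact types_args_head hτ H (List.mem_cons_of_mem _ hH) z hz
  · rintro ⟨h1, h2⟩
    exact .inr ⟨τ, hτ, b, ν, h1, h2, rfl⟩

theorem annotate_mem_expansion [Inhabited V] (hC : Admissible S side w h C) {I : Instance Name D}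
    (hI : ∀ δ ∈ C, δ.Sat I) {X : List (Atom Name V)} {ν : V → D} (hX : ∀ F ∈ X, F.mapArgs ν ∈ I)
    {G : Atom (Name ⊕ Name) V} (hG : G ∈ annotate C side X) :
    G.mapArgs ν ∈ expansion C side I := by
  have hcl : ∀ F, Cl (rules C side) {F | F ∈ X} F → F.mapArgs ν ∈ I := fun F hF =>
    Cl.map_mem (rules_sat hC hI) hX hF
  rcases mem_annotate.1 hG with ⟨F, hF, rfl⟩ | ⟨τ, hτ, σ, h1, h2, rfl⟩
  · exact .inl ⟨_, hcl F hF, rfl⟩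
  · refine .inr ⟨τ, hτ, false, fun z => ν (σ z), ?_, fun H hH => ?_, ?_⟩
    · have := hcl _ h1
      rwa [Atom.mapArgs_mapArgs] at this
    · simpa [Atom.mapArgs_mapArgs] using hcl _ (h2 H hH)
    · simp [Atom.mapArgs, GDep.atom]

/-- With the intended meaning of the new relations, the linear constraints follow from the given
ones. -/
theorem expansion_sat (hC : Admissible S side w h C) {I : Instance Name D}
    (hI : ∀ δ ∈ C, δ.Sat I) : ∀ δ ∈ linearized C side, δ.Sat (expansion C side I) := by
  intro δ hδ ν hν
  obtain ⟨τ, hτ, rfl | ⟨G, hG, rfl⟩⟩ := mem_linearized.1 hδ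
  · obtain ⟨h1, h2⟩ := (mem_expansion (b := false) hτ).1 (hν _ (List.mem_singleton_self _))
    obtain ⟨μ, hμ, hμh⟩ := types_sat hC hI hτ h1
    refine ⟨μ, fun z hz => ?_, fun B hB => ?_⟩
    · obtain ⟨A, hA, hz⟩ := mem_vars.1 hz
      rw [List.mem_singleton] at hA
      subst hA
      exact hμ z hz
    · rw [List.mem_singleton] at hB
      subst hB
      refine (mem_expansion (b := true) hτ).2 ⟨hμh, fun H hH => ?_⟩
      rw [Atom.mapArgs_congr fun z hz => hμ z (types_sideGuarded hτ H hH z hz)]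
      exact h2 H hH
  · obtain ⟨h1, h2⟩ := (mem_expansion (b := true) hτ).1 (hν _ (List.mem_singleton_self _))
    refine ⟨ν, fun _ _ => rfl, fun B hB => ?_⟩
    rw [List.mem_singleton] at hB
    subst hB
    refine annotate_mem_expansion hC hI (fun F hF => ?_) hG
    rcases List.mem_cons.1 hF with rfl | hF
    · exact h1
    · exact h2 F hF

theorem expansion_over {I : Instance Name D} (hI : ∀ F ∈ I, F.Over S) :
    ∀ G ∈ expansion C side I, G.Over (extended S C side hS) := by
  rintro G (⟨F, hF, rfl⟩ | ⟨τ, hτ, b, σ, -, -, rfl⟩)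
  · exact over_inl (hI F hF)
  · exact over_inr hτ (by simp [Atom.mapArgs])

end Soundness

/-! ### The tree model -/

/-- Elements and bags of the tree model, in one type. The elements are the terms of the query and
the nulls `null n z`, where the null is created in the bag `n` for the variable `z`. The bags are
the root and, for every bag `n`, type `τ` and assignment `σ` of the variables of the guard of `τ` by
elements, a bag for the fact that `τ` generates from the facts of `n`. -/
inductive Obj where
  | term (t : Term)
  | null (n : Obj) (z : Name)
  | root
  | child (n : Obj) (τ : GDep) (σ : Name → Obj)

namespace Obj

/-- The elements of a bag, named by the variables of its type: exported values are those of the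
parent, other variables of the head stand for nulls. (For objects other than generated bags, the
value is irrelevant.) -/
noncomputable def val : Obj → Name → Obj
  | child n τ σ, z => if z ∈ τ.guard.args then σ z else null (child n τ σ) z
  | _, _ => root

/-- The facts of a bag: the closure of the query, or of the generated fact with its side atoms. -/
def facts (L : List GDep) (Q : CQ Name) : Obj → Set (Atom Name Obj)
  | root => {F | Cl L {F | ∃ A ∈ Q, F = A.mapArgs term} F}
  | child n τ σ => {F | Cl L (Atom.mapArgs (val (child n τ σ)) '' {A | A ∈ τ.head :: τ.side}) F}
  | _ => ∅

/-- The elements of a bag. -/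
def elems : Obj → Set Obj
  | root => {e | ∃ t, e = term t}
  | child n τ σ => {e | ∃ z ∈ τ.head.args, e = val (child n τ σ) z}
  | _ => ∅

/-- The depth of a bag; for an element, the depth of the bag where it is created. -/
def depth : Obj → ℕ
  | child n _ _ => depth n + 1
  | null n _ => depth n
  | _ => 0

/-- The bags that occur in the model: the type of a bag records exactly the side atoms that hold in
the parent, and the exported variables have different values. -/
inductive Valid (C : List (TGD Name)) (side : Finset Name) (Q : CQ Name) : Obj → Prop
  | root : Valid C side Q root
  | child {n : Obj} {τ : GDep} {σ : Name → Obj} (hn : Valid C side Q n) (hτ : τ ∈ types C side)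
      (hg : τ.guard.mapArgs σ ∈ facts (rules C side) Q n)
      (hs : τ.side = sel (fun G => G.mapArgs σ ∈ facts (rules C side) Q n)
        (sideAtoms C side τ.iface))
      (hinj : Set.InjOn σ {z | z ∈ τ.iface}) : Valid C side Q (child n τ σ)

/-- The tree model. -/
def model (C : List (TGD Name)) (side : Finset Name) (Q : CQ Name) : Instance Name Obj :=
  {F | ∃ n, Valid C side Q n ∧ F ∈ facts (rules C side) Q n}

variable {C : List (TGD Name)} {side : Finset Name} {Q : CQ Name} {S : Signature Name} {w h : ℕ}

theorem args_mem_elems {n : Obj} (hn : Valid C side Q n) {F : Atom Name Obj}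
    (hF : F ∈ facts (rules C side) Q n) : ∀ e ∈ F.args, e ∈ elems n := by
  cases hn with
  | root =>
    refine Cl.args_mem rules_guarded ?_ hF
    rintro _ ⟨A, -, rfl⟩ e he
    obtain ⟨t, -, rfl⟩ := Atom.mem_mapArgs.1 he
    exact ⟨t, rfl⟩
  | child hn hτ hg hs hinj =>
    refine Cl.args_mem rules_guarded ?_ hF
    rintro _ ⟨A, hA, rfl⟩ e he
    obtain ⟨z, hz, rfl⟩ := Atom.mem_mapArgs.1 he
    exact ⟨z, types_args_head hτ A hA z hz, rfl⟩

/-- An element of a generated bag is created there or is the value of an exported variable. -/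
theorem mem_elems_child {n : Obj} {τ : GDep} {σ : Name → Obj} {e : Obj}
    (he : e ∈ elems (child n τ σ)) :
    (∃ z, e = null (child n τ σ) z) ∨ ∃ z ∈ τ.iface, e = σ z := by
  obtain ⟨z, hz, rfl⟩ := he
  by_cases hg : z ∈ τ.guard.args
  · exact .inr ⟨z, GDep.mem_iface.2 ⟨hg, hz⟩, if_pos hg⟩
  · exact .inl ⟨z, if_neg hg⟩

theorem val_of_mem_guard {n : Obj} {τ : GDep} {σ : Name → Obj} {z : Name}
    (hz : z ∈ τ.guard.args) : val (child n τ σ) z = σ z := if_pos hz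

theorem depth_le_of_mem_elems {n e : Obj} (hn : Valid C side Q n) (he : e ∈ elems n) :
    depth e ≤ depth n := by
  induction hn with
  | root => obtain ⟨t, rfl⟩ := he; exact le_rfl
  | child hn hτ hg hs hinj ih =>
    rcases mem_elems_child he with ⟨z, rfl⟩ | ⟨z, hz, rfl⟩
    · exact le_rfl
    · exact (ih (args_mem_elems hn hg _ (Atom.mem_mapArgs.2
        ⟨z, (GDep.mem_iface.1 hz).1, rfl⟩))).trans (Nat.le_succ _)

/-- A null whose bag is at least as deep as the bag `n` occurs in `n` only if it is created in
`n`. -/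
theorem eq_of_null_mem_elems {n m : Obj} (hn : Valid C side Q n) {z : Name}
    (he : null m z ∈ elems n) (hd : depth n ≤ depth m) : m = n := by
  cases hn with
  | root => obtain ⟨t, ht⟩ := he; cases ht
  | child hn hτ hg hs hinj =>
    rcases mem_elems_child he with ⟨y, hy⟩ | ⟨y, hy, hyz⟩
    · cases hy; rfl
    · have h1 := depth_le_of_mem_elems hn (args_mem_elems hn hg _ (Atom.mem_mapArgs.2
        ⟨y, (GDep.mem_iface.1 hy).1, rfl⟩))
      rw [← hyz] at h1
      simp only [depth] at h1 hd
      omega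

/-- Different variables of the generated fact have different values in its bag, as the exported
ones do and the nulls of the bag are not in the parent. -/
theorem val_injOn {n : Obj} {τ : GDep} {σ : Name → Obj} (hn : Valid C side Q (child n τ σ)) :
    Set.InjOn (val (child n τ σ)) {z | z ∈ τ.head.args} := by
  cases hn with
  | child hn hτ hg hs hinj =>
    have hne : ∀ y ∈ τ.guard.args, ∀ z, σ y ≠ null (child n τ σ) z := by
      intro y hy z h
      have h1 := depth_le_of_mem_elems hn (args_mem_elems hn hg _ (Atom.mem_mapArgs.2
        ⟨y, hy, rfl⟩))
      rw [h] at h1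
      simp only [depth] at h1
      omega
    intro y hy z hz hyz
    by_cases hy' : y ∈ τ.guard.args <;> by_cases hz' : z ∈ τ.guard.args <;>
      simp only [val, hy', hz', if_true, if_false] at hyz
    · exact hinj (GDep.mem_iface.2 ⟨hy', hy⟩) (GDep.mem_iface.2 ⟨hz', hz⟩) hyz
    · exact absurd hyz (hne y hy' z)
    · exact absurd hyz.symm (hne z hz' y)
    · cases hyz; rfl

/-- The facts of a generated bag are the images of the closure of its type. -/
theorem facts_child {n : Obj} {τ : GDep} {σ : Name → Obj} (hn : Valid C side Q (child n τ σ))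
    {F : Atom Name Obj} (hF : F ∈ facts (rules C side) Q (child n τ σ)) :
    Cl (rules C side) {G | G ∈ τ.head :: τ.side}
        (F.mapArgs (Function.invFunOn (val (child n τ σ)) {z | z ∈ τ.head.args})) ∧
      (F.mapArgs (Function.invFunOn (val (child n τ σ)) {z | z ∈ τ.head.args})).mapArgs
        (val (child n τ σ)) = F := by
  have hinj := val_injOn hn
  cases hn with
  | child hn hτ hg hs _ =>
    exact Cl.exists_of_image rules_guarded (fun F hF => types_args_head hτ F hF) hinj hF

/-- Side facts on exported elements hold in a generated bag iff they hold in its parent: the type of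
the bag lists those of the parent, and for those which the bag derives there is a derived full
dependency, under which the parent is closed. -/
theorem side_fact_iff {n : Obj} {τ : GDep} {σ : Name → Obj} (hn : Valid C side Q (child n τ σ))
    {F : Atom Name Obj}
    (hF : ∃ G ∈ atomsOf C, G.rel ∈ side ∧ F.rel = G.rel ∧ F.args.length = G.args.length)
    (hi : ∀ e ∈ F.args, ∃ z ∈ τ.iface, e = σ z) :
    F ∈ facts (rules C side) Q (child n τ σ) ↔ F ∈ facts (rules C side) Q n := by
  have hval := val_injOn hn
  have hch := fun h => facts_child hn (F := F) h
  cases hn with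
  | child hn hτ hg hs hinj =>
    have hσval : ∀ z ∈ τ.iface, val (child n τ σ) z = σ z := fun z hz =>
      val_of_mem_guard (GDep.mem_iface.1 hz).1
    let κ := Function.invFunOn (val (child n τ σ)) {z | z ∈ τ.head.args}
    have hκ : ∀ z ∈ τ.iface, κ (σ z) = z := fun z hz => by
      rw [← hσval z hz]
      exact hval.leftInvOn_invFunOn (GDep.mem_iface.1 hz).2
    have hargs : ∀ z ∈ (F.mapArgs κ).args, z ∈ τ.iface := by
      intro y hy
      obtain ⟨e, he, rfl⟩ := Atom.mem_mapArgs.1 hy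
      obtain ⟨z, hz, rfl⟩ := hi e he
      rwa [hκ z hz]
    have hFσ : (F.mapArgs κ).mapArgs σ = F := by
      rw [Atom.mapArgs_mapArgs]
      refine Atom.mapArgs_eq_self fun e he => ?_
      obtain ⟨z, hz, rfl⟩ := hi e he
      rw [hκ z hz]
    have hmem : F.mapArgs κ ∈ sideAtoms C side τ.iface := by
      obtain ⟨G, h1, h2, h3, h4⟩ := hF
      exact mem_sideAtoms.2 ⟨⟨G, h1, h2, h3, by simpa [Atom.mapArgs] using h4⟩, hargs⟩
    have hside : ∀ G ∈ τ.side, G.mapArgs σ ∈ facts (rules C side) Q n := fun G hG => by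
      rw [hs] at hG
      exact (mem_sel.1 hG).2
    constructor
    · intro h
      have hd := rules_derived hτ hmem (hch h).1
      have hsat : ∀ d ∈ rules C side, d.Sat (facts (rules C side) Q n) := by
        cases hn with
        | root => exact Cl.sat _ _
        | child => exact Cl.sat _ _
      have := hsat _ hd σ hg hside
      rwa [hFσ] at this
    · intro h
      have h1 : F.mapArgs κ ∈ τ.side := by
        rw [hs]
        exact mem_sel.2 ⟨hmem, by rwa [hFσ]⟩
      refine Cl.base ⟨F.mapArgs κ, List.mem_cons_of_mem _ h1, ?_⟩
      rw [Atom.mapArgs_congr fun z hz => hσval z (hargs z hz), hFσ]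

/-- Side facts of any bag hold in every bag that contains their elements. -/
theorem side_fact_local {m n : Obj} (hm : Valid C side Q m) (hn : Valid C side Q n)
    {F : Atom Name Obj}
    (hF : ∃ G ∈ atomsOf C, G.rel ∈ side ∧ F.rel = G.rel ∧ F.args.length = G.args.length)
    (hmF : F ∈ facts (rules C side) Q m) (hnF : ∀ e ∈ F.args, e ∈ elems n) :
    F ∈ facts (rules C side) Q n := by
  -- the deeper one of the two bags does not create any of the elements, so that it can be replaced
  -- by its parent
  induction hk : depth m + depth n using Nat.strong_induction_on generalizing m n with
  | _ k ih =>
    subst hk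
    by_cases hmn : m = n
    · exact hmn ▸ hmF
    have hmE := args_mem_elems hm hmF
    rcases le_total (depth n) (depth m) with hd | hd
    · cases hm with
      | root =>
        cases hn with
        | root => exact absurd rfl hmn
        | child => simp [depth] at hd
      | @child m' τ σ hm' hτ hg hs hinj =>
        have hm : Valid C side Q (child m' τ σ) := .child hm' hτ hg hs hinj
        have hi : ∀ e ∈ F.args, ∃ z ∈ τ.iface, e = σ z := fun e he => by
          rcases mem_elems_child (hmE e he) with ⟨z, rfl⟩ | h
          · exact absurd (eq_of_null_mem_elems hn (hnF _ he) hd) hmn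
          · exact h
        exact ih _ (by simp only [depth]; omega) hm' hn ((side_fact_iff hm hF hi).1 hmF) hnF rfl
    · cases hn with
      | root =>
        cases hm with
        | root => exact absurd rfl hmn
        | child => simp [depth] at hd
      | @child n' τ σ hn' hτ hg hs hinj =>
        have hn : Valid C side Q (child n' τ σ) := .child hn' hτ hg hs hinj
        have hi : ∀ e ∈ F.args, ∃ z ∈ τ.iface, e = σ z := fun e he => by
          rcases mem_elems_child (hnF e he) with ⟨z, rfl⟩ | h
          · exact absurd (eq_of_null_mem_elems hm (hmE _ he) hd) fun h => hmn h.symm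
          · exact h
        refine (side_fact_iff hn hF hi).2 (ih _ (by simp only [depth]; omega) hm hn' hmF ?_ rfl)
        intro e he
        obtain ⟨z, hz, rfl⟩ := hi e he
        exact args_mem_elems hn' hg _ (Atom.mem_mapArgs.2 ⟨z, (GDep.mem_iface.1 hz).1, rfl⟩)

/-- The tree model satisfies the constraints. A full constraint may be matched in several bags, but
the other side atoms of its body hold already in the bag of its guard; for an inclusion dependency
there is a type that fits to the bag. -/
theorem model_sat (hC : Admissible S side w h C) : ∀ δ ∈ C, δ.Sat (model C side Q) := by
  intro δ hδ ν hν
  by_cases hf : δ.IsFull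
  · obtain ⟨-, ⟨-, hf', -⟩ | ⟨-, -, ⟨A, hA, hside⟩, -⟩⟩ := hC δ hδ
    · exact absurd hf hf'
    obtain ⟨n, hn, hnA⟩ := hν A hA.1
    refine ⟨ν, fun _ _ => rfl, fun B hB => ⟨n, hn, ?_⟩⟩
    have hsat : ∀ d ∈ rules C side, d.Sat (facts (rules C side) Q n) := by
      cases hn with
      | root => exact Cl.sat _ _
      | child => exact Cl.sat _ _
    have hd : (⟨A, δ.body, B⟩ : GDep) ∈ rules C side :=
      (rules_spec C side).1 _ (mem_fullRules.2 ⟨δ, hδ, hf, hA, rfl, hB⟩)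
    refine hsat _ hd ν hnA fun G hG => ?_
    by_cases hGA : G = A
    · exact hGA ▸ hnA
    · obtain ⟨m, hm, hmG⟩ := hν G hG
      refine side_fact_local hm hn ⟨G, ?_, hside G hG hGA, rfl, by simp [Atom.mapArgs]⟩ hmG ?_
      · exact List.mem_flatMap.2 ⟨δ, hδ, List.mem_append_left _ hG⟩
      · intro e he
        obtain ⟨z, hz, rfl⟩ := Atom.mem_mapArgs.1 he
        have hzA : z ∈ A.args := by simpa using hA.2 (mem_vars.2 ⟨G, hG, hz⟩)
        exact args_mem_elems hn hnA _ (Atom.mem_mapArgs.2 ⟨z, hzA, rfl⟩)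
  · obtain ⟨-, ⟨⟨A, B, hb, hh, -⟩, -⟩ | ⟨hf', -⟩⟩ := hC δ hδ
    swap
    · exact absurd hf' hf
    have hAB : (A, B) ∈ inclusions C := by
      simp only [inclusions, List.mem_flatMap, List.mem_map]
      exact ⟨δ, mem_sel.2 ⟨hδ, hf⟩, A, by simp [hb], B, by simp [hh], rfl⟩
    obtain ⟨n, hn, hnA⟩ := hν A (by simp [hb])
    obtain ⟨τ, hτ, hg, hinj, hs, hex⟩ := exists_type (side := side) hAB ν
      fun G => G.mapArgs ν ∈ facts (rules C side) Q n
    have hch : Valid C side Q (child n τ ν) := .child hn hτ (hg ▸ hnA) hs hinj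
    obtain ⟨μ, hμ, hμB⟩ := hex (val (child n τ ν)) fun z hz => val_of_mem_guard hz
    refine ⟨μ, fun z hz => ?_, fun B' hB' => ⟨_, hch, ?_⟩⟩
    · obtain ⟨A', hA', hz⟩ := mem_vars.1 hz
      rw [hb, List.mem_singleton] at hA'
      subst hA'
      exact hμ z hz
    · rw [hh, List.mem_singleton] at hB'
      subst hB'
      rw [← hμB]
      exact Cl.base ⟨_, List.mem_cons_self, rfl⟩

theorem model_over (hC : Admissible S side w h C) (hQ : Q.Over S) :
    ∀ F ∈ model C side Q, F.Over S := by
  rintro F ⟨n, hn, hF⟩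
  cases hn with
  | root =>
    refine Cl.over (rules_over hC) ?_ hF
    rintro _ ⟨A, hA, rfl⟩
    exact (hQ A hA).mapArgs _
  | child hn hτ hg hs hinj =>
    refine Cl.over (rules_over hC) ?_ hF
    rintro _ ⟨A, hA, rfl⟩
    obtain ⟨-, h2, h3⟩ := types_over hC hτ
    rcases List.mem_cons.1 hA with rfl | hA
    · exact h2.mapArgs _
    · exact (h3 A hA).mapArgs _

/-- The constants as elements of the tree model. -/
def constEmb : Name ↪ Obj := ⟨fun c => term (.const c), fun c d h => by simpa using h⟩

theorem model_holds : Q.Holds constEmb (model C side Q) := by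
  refine ⟨fun z => term (.var z), fun A hA => ⟨root, .root, Cl.base ⟨A, hA, ?_⟩⟩⟩
  refine Atom.mapArgs_congr fun t _ => ?_
  cases t <;> rfl

/-! ### The homomorphism from the tree model -/

section Hom

variable {D : Type}

/-- A map from the tree model to an instance `J` of the linear constraints, given on the terms by
`f`; the nulls of a bag are mapped to the values that exist by the constraint that generates the
fact of the bag. For elements, the second argument is irrelevant; for bags, it is a variable of
the type. -/
noncomputable def homAux [Nonempty D] (side : Finset Name) (J : Instance (Name ⊕ Name) D)
    (f : Term → D) : Obj → Name → D
  | term t, _ => f t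
  | null n z, _ => homAux side J f n z
  | root, _ => Classical.arbitrary D
  | child _ τ σ, z =>
    Classical.epsilon (fun μ : Name → D => (∀ z ∈ τ.guard.args, μ z = homAux side J f (σ z) []) ∧
      (⟨.inr (typeName side true τ), τ.head.args.map μ⟩ : Atom _ D) ∈ J) z

/-- The map on elements. -/
noncomputable def hom [Nonempty D] (side : Finset Name) (J : Instance (Name ⊕ Name) D)
    (f : Term → D) (e : Obj) : D := homAux side J f e []

/-- The image of the annotated facts of a bag is contained in `J`. -/
def HomAt (C : List (TGD Name)) (side : Finset Name) (Q : CQ Name) (J : Instance (Name ⊕ Name) D)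
    (g : Obj → D) (n : Obj) : Prop :=
  (∀ F ∈ facts (rules C side) Q n, (F.mapArgs g).mapRel .inl ∈ J) ∧
    ∀ τ ∈ types C side, ∀ σ : Name → Obj, τ.guard.mapArgs σ ∈ facts (rules C side) Q n →
      (∀ G ∈ τ.side, G.mapArgs σ ∈ facts (rules C side) Q n) →
      (⟨.inr (typeName side false τ), ((τ.guard.mapArgs σ).mapArgs g).args⟩ : Atom _ D) ∈ J

theorem homAt_root [Nonempty D] {J : Instance (Name ⊕ Name) D} {f : Term → D} [Inhabited Term]
    (hJ : ∀ G ∈ annotate C side Q, G.mapArgs f ∈ J) :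
    HomAt C side Q J (hom side J f) root := by
  have hback : ∀ F, F ∈ facts (rules C side) Q root →
      Cl (rules C side) {F | F ∈ Q} (F.mapArgs (Function.invFun term)) ∧
        (F.mapArgs (Function.invFun term)).mapArgs term = F := by
    intro F hF
    have hinv : Function.LeftInverse (Function.invFun term) term :=
      Function.leftInverse_invFun fun _ _ h => by simpa using h
    constructor
    · refine Cl.map_mem (I := {F | Cl (rules C side) {F | F ∈ Q} F}) (Cl.sat _ _) ?_ hF
      rintro _ ⟨A, hA, rfl⟩
      rw [Atom.mapArgs_mapArgs, Atom.mapArgs_eq_self fun t _ => hinv t]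
      exact Cl.base hA
    · rw [Atom.mapArgs_mapArgs]
      refine Atom.mapArgs_eq_self fun e he => ?_
      obtain ⟨t, rfl⟩ := args_mem_elems .root hF e he
      rw [hinv t]
  have hf : ∀ F, (F.mapArgs term).mapArgs (hom side J f) = (F : Atom Name Term).mapArgs f :=
    fun F => Atom.mapArgs_mapArgs _ _ _
  constructor
  · intro F hF
    obtain ⟨h1, h2⟩ := hback F hF
    rw [← h2, hf]
    exact hJ _ (mem_annotate.2 (.inl ⟨_, h1, rfl⟩))
  · intro τ hτ σ hg hs
    obtain ⟨h1, h2⟩ := hback _ hg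
    rw [← h2, hf]
    refine hJ ⟨.inr (typeName side false τ), _⟩
      (mem_annotate.2 (.inr ⟨τ, hτ, fun z => Function.invFun term (σ z), ?_, ?_, ?_⟩))
    · rwa [Atom.mapArgs_mapArgs] at h1
    · intro H hH
      have := (hback _ (hs H hH)).1
      rwa [Atom.mapArgs_mapArgs] at this
    · rw [Atom.mapArgs_mapArgs]

theorem homAt_child [Nonempty D] {J : Instance (Name ⊕ Name) D} {f : Term → D}
    (hJ : ∀ δ ∈ linearized C side, δ.Sat J) {n : Obj} {τ : GDep} {σ : Name → Obj}
    (hn : Valid C side Q (child n τ σ)) (ih : HomAt C side Q J (hom side J f) n) :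
    HomAt C side Q J (hom side J f) (child n τ σ) := by
  have hback := fun F => facts_child hn (F := F)
  set κ := Function.invFunOn (val (child n τ σ)) {z | z ∈ τ.head.args}
  cases hn with
  | child hn hτ hg hs hinj =>
    have htrig := ih.2 τ hτ σ hg fun G hG => by
      rw [hs] at hG
      exact (mem_sel.1 hG).2
    -- the constraint that generates the fact of this bag
    have hgen : ∃ μ : Name → D, (∀ z ∈ τ.guard.args, μ z = homAux side J f (σ z) []) ∧
        (⟨.inr (typeName side true τ), τ.head.args.map μ⟩ : Atom _ D) ∈ J := by
      obtain ⟨μ, hμ, hμh⟩ := hJ _ (mem_linearized.2 ⟨τ, hτ, .inl rfl⟩)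
        (fun z => hom side J f (σ z)) (by
          intro A hA
          rw [List.mem_singleton] at hA
          subst hA
          simpa [Atom.mapArgs, Function.comp_def] using htrig)
      refine ⟨μ, fun z hz => hμ z (mem_vars.2 ⟨_, List.mem_singleton_self _, hz⟩), ?_⟩
      simpa [Atom.mapArgs] using hμh _ (List.mem_singleton_self _)
    obtain ⟨hμ, hμJ⟩ := Classical.epsilon_spec hgen
    have hval : ∀ z, hom side J f (val (child n τ σ) z) = homAux side J f (child n τ σ) z := by
      intro z
      by_cases hz : z ∈ τ.guard.args
      · rw [val_of_mem_guard hz, homAux, hμ z hz, hom]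
      · simp only [val, hz, if_false, hom, homAux]
    have hann : ∀ G ∈ annotate C side (τ.head :: τ.side),
        G.mapArgs (fun z => hom side J f (val (child n τ σ) z)) ∈ J := by
      intro G hG
      obtain ⟨μ', hμ', hG'⟩ := hJ _ (mem_linearized.2 ⟨τ, hτ, .inr ⟨G, hG, rfl⟩⟩)
        (fun z => hom side J f (val (child n τ σ) z)) (by
          intro A hA
          rw [List.mem_singleton] at hA
          subst hA
          rw [show (fun z => hom side J f (val (child n τ σ) z)) = _ from
            funext fun z => (hval z).trans (by rw [homAux])]
          exact hμJ)
      have hG'' := hG' G (List.mem_singleton_self _)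
      rwa [Atom.mapArgs_congr] at hG''
      intro z hz
      refine hμ' z (mem_vars.2 ⟨_, List.mem_singleton_self _, ?_⟩)
      have hsub := fun F hF => types_args_head hτ F hF
      rcases mem_annotate.1 hG with ⟨F, hF, rfl⟩ | ⟨τ₂, -, σ₂, h1, -, rfl⟩
      · exact Cl.args_mem (E := {z | z ∈ τ.head.args}) rules_guarded hsub hF z hz
      · exact Cl.args_mem (E := {z | z ∈ τ.head.args}) rules_guarded hsub h1 z hz
    constructor
    · intro F hF
      obtain ⟨h1, h2⟩ := hback F hF
      rw [← h2, Atom.mapArgs_mapArgs]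
      exact hann _ (mem_annotate.2 (.inl ⟨_, h1, rfl⟩))
    · intro τ₂ hτ₂ σ₂ hg₂ hs₂
      obtain ⟨h1, h2⟩ := hback _ hg₂
      rw [← h2, Atom.mapArgs_mapArgs]
      refine hann ⟨.inr (typeName side false τ₂), _⟩
        (mem_annotate.2 (.inr ⟨τ₂, hτ₂, fun z => κ (σ₂ z), ?_, ?_, ?_⟩))
      · rwa [Atom.mapArgs_mapArgs] at h1
      · intro H hH
        have := (hback _ (hs₂ H hH)).1
        rwa [Atom.mapArgs_mapArgs] at this
      · rw [Atom.mapArgs_mapArgs]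

/-- The map from the tree model to an instance of the linear constraints is a homomorphism. -/
theorem homAt [Nonempty D] [Inhabited Term] {J : Instance (Name ⊕ Name) D} {f : Term → D}
    (hJ : ∀ δ ∈ linearized C side, δ.Sat J) (hQ : ∀ G ∈ annotate C side Q, G.mapArgs f ∈ J)
    {n : Obj} (hn : Valid C side Q n) : HomAt C side Q J (hom side J f) n := by
  induction hn with
  | root => exact homAt_root hQ
  | child hn hτ hg hs hinj ih => exact homAt_child hJ (.child hn hτ hg hs hinj) ih

end Hom

end Obj

/-! ### Equivalence -/

instance : Inhabited Term := ⟨.var []⟩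

/-- The linear constraints and the annotated query are equivalent to the given constraints and
query, as far as consequences over the original signature are concerned. -/
theorem contained_iff {C : List (TGD Name)} {side : Finset Name} {S : Signature Name} {w h : ℕ}
    (hC : Admissible S side w h C) (hS : ∀ τ ∈ types C side, ∀ b, (τ.atom b).Over S)
    {Q Q' : CQ Name} (hQ : Q.Over S) :
    Contained S C Q Q' ↔ Contained (extended S C side hS) (linearized C side)
      (annotate C side Q) (Q'.mapRel Sum.inl) := by
  constructor
  · intro H D ι J hJS hJ hQJ
    obtain ⟨ν, hν⟩ := hQJ
    have : Nonempty D := ⟨ι []⟩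
    let f : Term → D := Term.eval ι ν
    obtain ⟨ξ, hξ⟩ := H Obj Obj.constEmb (Obj.model C side Q) (Obj.model_over hC hQ)
      (Obj.model_sat hC) Obj.model_holds
    refine ⟨fun z => Obj.hom side J f (ξ z), fun A hA => ?_⟩
    obtain ⟨B, hB, rfl⟩ := List.mem_map.1 hA
    obtain ⟨n, hn, hF⟩ := hξ B hB
    have := (Obj.homAt hJ hν hn).1 _ hF
    rw [Atom.mapArgs_mapArgs] at this
    convert this using 1
    simp only [Atom.mapRel, Atom.mapArgs, Atom.mk.injEq, true_and]
    refine List.map_congr_left fun t _ => ?_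
    cases t <;> rfl
  · intro H D ι I hIS hI hQI
    obtain ⟨ν, hν⟩ := hQI
    obtain ⟨ξ, hξ⟩ := H D ι (expansion C side I) (expansion_over hIS) (expansion_sat hC hI)
      ⟨ν, fun G hG => annotate_mem_expansion hC hI hν hG⟩
    refine ⟨ξ, fun A hA => (mapRel_mem_expansion (C := C) (side := side)).1 ?_⟩
    exact hξ (A.mapRel .inl) (List.mem_map.2 ⟨A, hA, rfl⟩)

/-! ### Running times of the elementary operations on atoms and dependencies -/

/-- Pairs of atoms as data. -/
abbrev encAtoms (e : Name → Data) : Atom Name Name × Atom Name Name → Data :=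
  encPair (encAtom e encName) (encAtom e encName)

namespace PTime

variable {ι α β T U V : Type} {M : ι → ℕ} {x : ι → Data} {eR : ι → Name → Data} {eV : V → Data}
  {eT : T → Data} {eU : U → Data}

theorem mapArgs {A : ι → Atom Name T} (g : ι → T → U)
    (hA : PTime M x fun i => encAtom (eR i) eT (A i))
    (hg : ∀ z : {p : ι × T // p.2 ∈ (A p.1).args} → Data,
      PTime (fun p => M p.1.1) z (fun p => x p.1.1) →
      PTime (fun p => M p.1.1) z (fun p => eT p.1.2) →
      PTime (fun p => M p.1.1) z (fun p => eU (g p.1.1 p.1.2))) :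
    PTime M x fun i => encAtom (eR i) eU ((A i).mapArgs (g i)) :=
  hA.left.pair (PTime.map (e := fun _ => eT) (e' := fun _ => eU) g
    (l := fun i => (A i).args) hA.right hg)

theorem args {A : ι → Atom Name T} (hA : PTime M x fun i => encAtom (eR i) eT (A i)) :
    PTime M x fun i => encList eT (A i).args := hA.right

theorem guard {d : ι → GDep} (hd : PTime M x fun i => encGDep (eR i) (d i)) :
    PTime M x fun i => encAtom (eR i) encName (d i).guard := hd.left

theorem side {d : ι → GDep} (hd : PTime M x fun i => encGDep (eR i) (d i)) :
    PTime M x fun i => encList (encAtom (eR i) encName) (d i).side := hd.right.left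

theorem head {d : ι → GDep} (hd : PTime M x fun i => encGDep (eR i) (d i)) :
    PTime M x fun i => encAtom (eR i) encName (d i).head := hd.right.right

theorem gdep {A B : ι → Atom Name Name} {s : ι → List (Atom Name Name)}
    (hA : PTime M x fun i => encAtom (eR i) encName (A i))
    (hs : PTime M x fun i => encList (encAtom (eR i) encName) (s i))
    (hB : PTime M x fun i => encAtom (eR i) encName (B i)) :
    PTime M x fun i => encGDep (eR i) ⟨A i, s i, B i⟩ := hA.pair (hs.pair hB)

theorem memName {z : ι → Name} {l : ι → List Name} (hz : PTime M x fun i => encName (z i))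
    (hl : PTime M x fun i => encList encName (l i)) : PTime M x fun i => encProp (z i ∈ l i) :=
  hz.mem (e := fun _ => encName) (fun _ => encName_injective) hl

theorem look [Inhabited V] {σ : ι → List (Name × V)} {z : ι → Name}
    (hσ : PTime M x fun i => encList (encPair encName eV) (σ i))
    (hz : PTime M x fun i => encName (z i)) : PTime M x fun i => eV (look (σ i) (z i)) := by
  have h1 := PTime.sel (e := fun _ => encPair encName eV) (fun i q => q.1 = z i) hσ
    fun w hw hq => hq.left.eq (e := fun _ => encName) (fun _ => encName_injective) (hw.on hz)
  have h2 := PTime.map (e := fun _ => encPair encName eV) (e' := fun _ => eV) (fun _ q => q.2) h1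
    fun w _ hq => hq.right
  exact h2.headD (e := fun _ => eV) (d := default) (t := eV default) fun _ => rfl

theorem mapMatching [Inhabited V] {A G : ι → Atom Name Name} {F : ι → Atom Name V}
    (hA : PTime M x fun i => encAtom (eR i) encName (A i))
    (hF : PTime M x fun i => encAtom (eR i) eV (F i))
    (hG : PTime M x fun i => encAtom (eR i) encName (G i)) :
    PTime M x fun i => encAtom (eR i) eV ((G i).mapArgs (matching (A i) (F i))) := by
  have hz := hA.args.zip (e := fun _ => encName) (e' := fun _ => eV) hF.args
  exact hG.mapArgs _ fun w hw hv => (hw.on hz).look hv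

theorem applies [Inhabited V] (hR : ∀ i, Function.Injective (eR i)) (hV : Function.Injective eV)
    {d : ι → GDep} {X : ι → List (Atom Name V)} {F : ι → Atom Name V}
    (hd : PTime M x fun i => encGDep (eR i) (d i))
    (hX : PTime M x fun i => encList (encAtom (eR i) eV) (X i))
    (hF : PTime M x fun i => encAtom (eR i) eV (F i)) :
    PTime M x fun i => encProp ((d i).Applies (X i) (F i)) := by
  refine PTime.propAnd ?_ ?_
  · exact (hd.guard.mapMatching hF hd.guard).eq (e := fun i => encAtom (eR i) eV)
      (fun i => encAtom_injective (hR i) hV) hF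
  · refine PTime.forall_mem (e := fun i => encAtom (eR i) encName) _ hd.side fun w hw hG => ?_
    exact ((hw.on hd.guard).mapMatching (hw.on hF) hG).mem
      (e := fun p => encAtom (eR p.1.1) eV) (fun p => encAtom_injective (hR p.1.1) hV) (hw.on hX)

theorem consequences [Inhabited V] (hR : ∀ i, Function.Injective (eR i))
    (hV : Function.Injective eV) {L : ι → List GDep} {X : ι → List (Atom Name V)}
    (hL : PTime M x fun i => encList (encGDep (eR i)) (L i))
    (hX : PTime M x fun i => encList (encAtom (eR i) eV) (X i)) :
    PTime M x fun i => encList (encAtom (eR i) eV) (consequences (L i) (X i)) := by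
  refine PTime.flatMap (e := fun i => encAtom (eR i) eV) _ hX fun z hz hF => ?_
  have h1 := PTime.sel (e := fun p => encGDep (eR p.1.1)) (fun p d => d.Applies (X p.1.1) p.1.2)
    (hz.on hL) fun w hw hd =>
      PTime.applies (fun p => hR p.1.1.1.1) hV hd ((hw.on hz).on hX) (hw.on hF)
  exact PTime.map (e := fun p : {p : ι × Atom Name V // _} => encGDep (eR p.1.1))
    (e' := fun p => encAtom (eR p.1.1) eV)
    (fun p d => d.head.mapArgs (matching d.guard p.1.2)) h1
    fun w hw hd => hd.guard.mapMatching (hw.on hF) hd.head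

theorem cl [Inhabited V] (hR : ∀ i, Function.Injective (eR i))
    (hV : Function.Injective eV) {L : ι → List GDep} {X : ι → List (Atom Name V)}
    (hL : PTime M x fun i => encList (encGDep (eR i)) (L i))
    (hX : PTime M x fun i => encList (encAtom (eR i) eV) (X i)) (U : ι → Finset (Atom Name V))
    (hU : ∀ i, ClosedUnder (Linearization.consequences (L i)) (U i : Set (Atom Name V)))
    (hXU : ∀ i, ∀ F ∈ X i, F ∈ U i) (hcard : PolyLE M fun i => (U i).card)
    (hsize : PolyLE (fun p : {p : ι × Atom Name V // p.2 ∈ U p.1} => M p.1.1)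
      fun p => (encAtom (eR p.1.1) eV p.1.2).size) :
    PTime M x fun i => encList (encAtom (eR i) eV) (cl (L i) (X i)) :=
  PTime.saturate (e := fun i => encAtom (eR i) eV) (fun i => encAtom_injective (hR i) hV) hX U hU
    hXU hcard hsize fun _ hz hY => PTime.consequences
      (fun _ => hR _) hV (hz.on hL) hY

/-- Saturation inside a list that can be computed in polynomial time. -/
theorem saturate_of_list {e : ι → α → Data} {st : ι → List α → List α} {X L : ι → List α}
    (he : ∀ i, Function.Injective (e i))
    (hX : PTime M x fun i => encList (e i) (X i)) (hL : PTime M x fun i => encList (e i) (L i))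
    (hU : ∀ i, ∀ Y : List α, ∀ a ∈ st i Y, a ∈ L i) (hXU : ∀ i, ∀ a ∈ X i, a ∈ L i)
    (hst : ∀ z : {p : ι × List α // SatState (L p.1).toFinset (X p.1) p.2} → Data,
      PTime (fun p => M p.1.1) z (fun p => x p.1.1) →
      PTime (fun p => M p.1.1) z (fun p => encList (e p.1.1) p.1.2) →
      PTime (fun p => M p.1.1) z (fun p => encList (e p.1.1) (st p.1.1 p.1.2))) :
    PTime M x fun i => encList (e i) (Linearization.saturate (st i) (X i)) := by
  refine PTime.saturate he hX (fun i => (L i).toFinset)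
    (fun i Y _ a ha => by simpa using hU i Y a ha) (fun i a ha => by simpa using hXU i a ha)
    (hL.size_le.mono fun i => (List.toFinset_card_le _).trans (length_le_size_encList _ _))
    ((hL.size_le.on fun p : {p : ι × α // p.2 ∈ (L p.1).toFinset} => p.1.1).mono fun p =>
      size_le_size_encList _ (List.mem_toFinset.1 p.2)) hst

/-! ### Running times of the constructions without saturation -/

variable {C : ι → List (TGD Name)}

theorem atomsOf (hC : PTime M x fun i => encTGDs (eR i) (C i)) :
    PTime M x fun i => encList (encAtom (eR i) encName) (atomsOf (C i)) := by
  refine PTime.flatMap (e := fun i => encTGD (eR i)) (e' := fun i => encAtom (eR i) encName) _ hC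
    fun z hz hδ => ?_
  exact PTime.append (e := fun p : {p : ι × TGD Name // _} => encAtom (eR p.1.1) encName)
    (l := fun p => p.1.2.body) (l' := fun p => p.1.2.head) hδ.left hδ.right

/-- Membership of a variable in some atom of a list. -/
theorem mem_args {l : ι → List (Atom Name Name)} {z : ι → Name}
    (hl : PTime M x fun i => encList (encAtom (eR i) encName) (l i))
    (hz : PTime M x fun i => encName (z i)) :
    PTime M x fun i => encProp (∃ A ∈ l i, z i ∈ A.args) :=
  PTime.exists_mem (e := fun i => encAtom (eR i) encName) _ hl
    fun _ hw hA => (hw.on hz).memName hA.args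

theorem isFull {δ : ι → TGD Name} (hδ : PTime M x fun i => encTGD (eR i) (δ i)) :
    PTime M x fun i => encProp (δ i).IsFull := by
  have h := PTime.forall_mem (e := fun i => encAtom (eR i) encName)
    (fun i B => ∀ z ∈ B.args, ∃ A ∈ (δ i).body, z ∈ A.args)
    (l := fun i => (δ i).head) hδ.right fun w hw hB =>
      PTime.forall_mem (e := fun _ => encName) _ hB.args fun v hv hz =>
        PTime.mem_args ((hv.on hw).on (y := fun i =>
          encList (encAtom (eR i) encName) (δ i).body) hδ.left) hz
  refine h.propCongr fun i => ⟨fun h z hz => ?_, fun h B hB z hz => ?_⟩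
  · obtain ⟨B, hB, hz⟩ := mem_vars.1 hz
    exact mem_vars.2 (h B hB z hz)
  · exact mem_vars.1 (h (mem_vars.2 ⟨B, hB, hz⟩))

theorem fullRules (hC : PTime M x fun i => encTGDs (eR i) (C i)) :
    PTime M x fun i => encList (encGDep (eR i)) (fullRules (C i)) := by
  have h1 := PTime.sel (e := fun i => encTGD (eR i)) (fun _ δ => δ.IsFull) hC
    fun w hw hδ => hδ.isFull
  refine PTime.flatMap (e := fun i => encTGD (eR i)) (e' := fun i => encGDep (eR i)) _ h1
    fun z hz hδ => ?_
  have hb := hδ.left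
  have hh := hδ.right
  have h2 := PTime.sel (e := fun p : {p : ι × TGD Name // _} => encAtom (eR p.1.1) encName)
    (l := fun p => p.1.2.body) (fun p A => vars p.1.2.body ⊆ A.args.toFinset) hb fun w hw hA => by
      refine (PTime.forall_mem
        (e := fun q : {q : {p : ι × TGD Name // _} × Atom Name Name // _} =>
          encAtom (eR q.1.1.1.1) encName) (l := fun q => q.1.1.1.2.body)
        (fun q B => ∀ z ∈ B.args, z ∈ q.1.2.args) (hw.on hb) fun v hv hB =>
          PTime.forall_mem (e := fun _ => encName) _ hB.args fun u hu hy =>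
            hy.memName ((hu.on hv).on hA.args)).propCongr fun q =>
              ⟨fun h y hy => ?_, fun h B hB y hy => ?_⟩
      · obtain ⟨B, hB, hy⟩ := mem_vars.1 hy
        exact List.mem_toFinset.2 (h B hB y hy)
      · exact List.mem_toFinset.1 (h (mem_vars.2 ⟨B, hB, hy⟩))
  refine PTime.flatMap (e := fun p : {p : ι × TGD Name // _} => encAtom (eR p.1.1) encName)
    (e' := fun p => encGDep (eR p.1.1))
    (fun p A => p.1.2.head.map fun B => (⟨A, p.1.2.body, B⟩ : GDep)) h2 fun w hw hA => ?_
  exact PTime.map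
    (e := fun q : {q : {p : ι × TGD Name // _} × Atom Name Name // _} =>
      encAtom (eR q.1.1.1.1) encName)
    (e' := fun q => encGDep (eR q.1.1.1.1)) (l := fun q => q.1.1.1.2.head)
    (fun q B => (⟨q.1.2, q.1.1.1.2.body, B⟩ : GDep)) (hw.on hh) fun v hv hB =>
      (hv.on hA).gdep ((hv.on hw).on hb) hB

theorem inclusions (hC : PTime M x fun i => encTGDs (eR i) (C i)) :
    PTime M x fun i => encList (encAtoms (eR i)) (inclusions (C i)) := by
  have h1 := PTime.sel (e := fun i => encTGD (eR i)) (fun _ δ => ¬ δ.IsFull) hC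
    fun w hw hδ => hδ.isFull.propNot
  refine PTime.flatMap (e := fun i => encTGD (eR i)) (e' := fun i => encAtoms (eR i)) _ h1
    fun z hz hδ => ?_
  have hh := hδ.right
  refine PTime.flatMap (e := fun p : {p : ι × TGD Name // _} => encAtom (eR p.1.1) encName)
    (e' := fun p => encAtoms (eR p.1.1)) (l := fun p => p.1.2.body)
    (fun p A => p.1.2.head.map fun B => (A, B)) hδ.left fun w hw hA => ?_
  exact PTime.map
    (e := fun q : {q : {p : ι × TGD Name // _} × Atom Name Name // _} =>
      encAtom (eR q.1.1.1.1) encName)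
    (e' := fun q => encAtoms (eR q.1.1.1.1)) (l := fun q => q.1.1.1.2.head)
    (fun q B => (q.1.2, B)) (hw.on hh) fun v hv hB => (hv.on hA).pair hB

theorem common {A B : ι → Atom Name Name}
    (hA : PTime M x fun i => encAtom (eR i) encName (A i))
    (hB : PTime M x fun i => encAtom (eR i) encName (B i)) :
    PTime M x fun i => encList encName (common (A i) (B i)) :=
  PTime.sel (e := fun _ => encName) _ hA.args fun _ hw hz => hz.memName (hw.on hB.args)

theorem iface {d : ι → GDep} (hd : PTime M x fun i => encGDep (eR i) (d i)) :
    PTime M x fun i => encList encName (d i).iface := hd.guard.common hd.head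

theorem renameVars {A B G : ι → Atom Name Name} {t : ι → List Name}
    (hA : PTime M x fun i => encAtom (eR i) encName (A i))
    (hB : PTime M x fun i => encAtom (eR i) encName (B i))
    (hG : PTime M x fun i => encAtom (eR i) encName (G i))
    (ht : PTime M x fun i => encList encName (t i)) :
    PTime M x fun i => encAtom (eR i) encName
      ((G i).mapArgs (renameVars (A i) (B i) (t i))) := by
  have hc := hA.common hB
  have hl := PTime.sel (e := fun _ => encName)
    (fun i z => z ∉ Linearization.common (A i) (B i))
    (hA.args.append (e := fun _ => encName) hB.args)
    fun _ hw hz => (hz.memName (hw.on hc)).propNot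
  have hσ := (hc.zip (e := fun _ => encName) (e' := fun _ => encName) ht).append
    (e := fun _ => encPair encName encName)
    (hl.zip (e := fun _ => encName) (e' := fun _ => encName) hl)
  exact hG.mapArgs _ fun w hw hz => (hw.on hσ).look hz

/-- The sublists are selected by the tuples of bits of the same length. -/
theorem subs {l : ι → List α} {e : ι → α → Data} (hl : PTime M x fun i => encList (e i) (l i))
    (h2 : PolyLE M fun i => 2 ^ (l i).length) :
    PTime M x fun i => encList (encList (e i)) (subs (l i)) := by
  have h1 := PTime.tuples (E := fun _ => [true, false]) (e' := fun _ => encBool) hl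
    (const hl.size_input_le (encList encBool [true, false])) h2
  refine PTime.map (e := fun _ => encList encBool) (e' := fun i => encList (e i)) _ h1
    fun z hz hb => ?_
  have h3 := (hz.on hl).zip (e := fun p : {p : ι × List Bool // _} => e p.1.1)
    (e' := fun _ => encBool) hb
  have h4 := PTime.sel (e := fun p : {p : ι × List Bool // _} => encPair (e p.1.1) encBool)
    (fun _ q => q.2 = true) h3 fun w hw hq => hq.right.eq (e := fun _ => encBool)
      (fun _ => encBool_injective)
      (constTrue hw.size_input_le)
  exact PTime.map (e := fun p : {p : ι × List Bool // _} => encPair (e p.1.1) encBool)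
    (e' := fun p => e p.1.1) (fun _ q => q.1) h4 fun w hw hq => hq.left

end PTime

/-! ### Bounds for side atoms, types and closures -/

section Bounds

variable {C : List (TGD Name)} {side : Finset Name} {S : Signature Name} {w h a' : ℕ} {V : Type}

theorem pow_self_le {m n : ℕ} (hmn : m ≤ n) : m ^ m ≤ n ^ n := by
  rcases Nat.eq_zero_or_pos n with rfl | hn
  · rw [Nat.le_zero.1 hmn]
  · exact (Nat.pow_le_pow_left hmn m).trans (Nat.pow_le_pow_right hn hmn)

theorem length_flatMap_le {α β : Type} (l : List α) (f : α → List β) {n : ℕ}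
    (hf : ∀ a ∈ l, (f a).length ≤ n) : (l.flatMap f).length ≤ l.length * n := by
  rw [List.length_flatMap]
  refine (List.sum_le_card_nsmul _ n ?_).trans (by simp)
  rintro _ hm
  obtain ⟨a, ha, rfl⟩ := List.mem_map.1 hm
  exact hf a ha

theorem arity_le_of_mem (hC : Admissible S side w h C) (ha : ∀ r ∈ side, S.arity r ≤ a')
    {G : Atom Name Name} (hG : G ∈ atomsOf C) (hr : G.rel ∈ side) : G.args.length ≤ a' := by
  rw [(atomsOf_over hC hG).2]
  exact ha _ hr

theorem pow_arity_le (hC : Admissible S side w h C) (ha : ∀ r ∈ side, S.arity r ≤ a')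
    {G : Atom Name Name} (hG : G ∈ atomsOf C) (hr : G.rel ∈ side) (n : ℕ) :
    n ^ G.args.length ≤ (n + 1) ^ a' :=
  (Nat.pow_le_pow_left n.le_succ _).trans
    (Nat.pow_le_pow_right n.succ_pos (arity_le_of_mem hC ha hG hr))

/-- There are few side atoms over few variables. -/
theorem length_sideAtoms_le (hC : Admissible S side w h C) (ha : ∀ r ∈ side, S.arity r ≤ a')
    {E : List Name} {m : ℕ} (hE : E.toFinset.card ≤ m) :
    (sideAtoms C side E).length ≤ side.card * (m + 1) ^ a' := by
  have hU : ClosedUnder (fun _ => sideFacts C side E)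
      ((sideFacts C side E).toFinset : Set (Atom Name Name)) := fun Y _ a ha => by simpa using ha
  obtain ⟨⟨W, hW, hnd⟩, -⟩ := satState_saturate hU (X := []) (by simp)
  rw [List.append_nil] at hW
  rw [← hW] at hnd
  rw [show (sideAtoms C side E).length = (sideAtoms C side E).toFinset.card from
    (List.toFinset_card_of_nodup hnd).symm]
  refine (Finset.card_le_card (t := side.biUnion fun r =>
    ((sel (fun _ => S.arity r ≤ a') (tuples E.toFinset.toList (S.arity r))).map
      fun t => (⟨r, t⟩ : Atom Name Name)).toFinset) fun F hF => ?_).trans ?_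
  · obtain ⟨⟨G, hG, hs, hr, hl⟩, hv⟩ := mem_sideAtoms.1 (List.mem_toFinset.1 hF)
    refine Finset.mem_biUnion.2 ⟨G.rel, hs, List.mem_toFinset.2 (List.mem_map.2
      ⟨F.args, mem_sel.2 ⟨mem_tuples.2 ⟨?_, fun v h => ?_⟩, ha _ hs⟩, ?_⟩)⟩
    · rw [hl, (atomsOf_over hC hG).2]
    · simpa using hv v h
    · rw [← hr]
  · refine Finset.card_biUnion_le_card_mul _ _ _ fun r hr => ?_
    refine (List.toFinset_card_le _).trans ?_
    rw [List.length_map]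
    refine (sel_sublist _ _).length_le.trans ?_
    rw [length_tuples, Finset.length_toList]
    exact (Nat.pow_le_pow_left (hE.trans m.le_succ) _).trans
      (Nat.pow_le_pow_right m.succ_pos (ha r hr))

theorem length_common_le (hC : Admissible S side w h C) {A B : Atom Name Name}
    (hAB : (A, B) ∈ inclusions C) : (common A B).length ≤ w := by
  obtain ⟨δ, -, h1, h2, h3, hw, -⟩ := inclusions_spec hC hAB
  rw [← List.toFinset_card_of_nodup (h3.sublist (sel_sublist _ _) : (common A B).Nodup),
    common_toFinset h1 h2]
  exact hw

theorem length_sideAtoms_common_le (hC : Admissible S side w h C)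
    (ha : ∀ r ∈ side, S.arity r ≤ a') {A B : Atom Name Name} (hAB : (A, B) ∈ inclusions C)
    {t : List Name} (ht : t ∈ tuples (common A B) (common A B).length) :
    (sideAtoms C side (common (A.mapArgs (renameVars A B t))
      (B.mapArgs (renameVars A B t)))).length ≤ side.card * (w + 1) ^ a' := by
  refine length_sideAtoms_le hC ha ?_
  refine le_trans ?_ (length_common_le hC hAB)
  refine le_trans (Finset.card_le_card fun z hz => ?_) (List.toFinset_card_le (common A B))
  have hρ := isRenaming_renameVars ht
  obtain ⟨y, hy, rfl⟩ := hρ.common_subset (List.mem_toFinset.1 hz)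
  exact List.mem_toFinset.2 (hρ.1 y hy)

variable [Inhabited V]

/-- The atoms whose relation is that of the head of a full constraint and whose arguments are
members of `K`, with the same repetitions as in that head. -/
noncomputable def headFacts (C : List (TGD Name)) (K : List V) : List (Atom Name V) :=
  (fullRules C).flatMap fun d => (tuples K.dedup d.head.args.dedup.length).map fun t =>
    d.head.mapArgs (look (d.head.args.dedup.zip t))

theorem mem_headFacts {K : List V} {d : GDep} (hd : d ∈ fullRules C) {σ : Name → V}
    (hσ : ∀ z ∈ d.head.args, σ z ∈ K) : d.head.mapArgs σ ∈ headFacts C K := by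
  refine List.mem_flatMap.2 ⟨d, hd, List.mem_map.2 ⟨d.head.args.dedup.map σ, mem_tuples.2
    ⟨by simp, fun v hv => ?_⟩, ?_⟩⟩
  · obtain ⟨z, hz, rfl⟩ := List.mem_map.1 hv
    exact List.mem_dedup.2 (hσ z (List.mem_dedup.1 hz))
  · exact Atom.mapArgs_congr fun z hz => look_zip_map (List.mem_dedup.2 hz)

theorem of_mem_headFacts {K : List V} {F : Atom Name V} (hF : F ∈ headFacts C K) :
    (∃ G ∈ atomsOf C, F.rel = G.rel ∧ F.args.length = G.args.length) ∧ ∀ v ∈ F.args, v ∈ K := by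
  simp only [headFacts, List.mem_flatMap, List.mem_map, mem_tuples] at hF
  obtain ⟨d, hd, t, ⟨ht, hK⟩, rfl⟩ := hF
  refine ⟨⟨d.head, mem_atomsOf_of_mem_fullRules hd, rfl, by simp [Atom.mapArgs]⟩, fun v hv => ?_⟩
  obtain ⟨z, hz, rfl⟩ := Atom.mem_mapArgs.1 hv
  have h1 : z ∈ (d.head.args.dedup.zip t).map Prod.fst := by
    rw [List.map_fst_zip ht.ge]
    exact List.mem_dedup.2 hz
  obtain ⟨q, hq, hqz⟩ := List.mem_map.1 h1
  exact List.mem_dedup.1 (hK _ (List.of_mem_zip (look_mem ⟨q, hq, hqz⟩)).2)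

theorem card_head_le (hC : Admissible S side w h C) {d : GDep} (hd : d ∈ fullRules C) :
    d.head.args.toFinset.card ≤ h := by
  obtain ⟨δ, hδ, hf, -, -, hh⟩ := mem_fullRules.1 hd
  obtain ⟨-, ⟨-, hn, -⟩ | ⟨-, -, -, hle⟩⟩ := hC δ hδ
  · exact absurd hf hn
  · refine le_trans (Finset.card_le_card fun z hz => ?_) hle
    exact mem_vars.2 ⟨_, hh, List.mem_toFinset.1 hz⟩

theorem length_headFacts_le (hC : Admissible S side w h C) {K : List V} {m : ℕ}
    (hK : K.toFinset.card ≤ m) :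
    (headFacts C K).length ≤ (fullRules C).length * (m + 1) ^ h := by
  refine length_flatMap_le _ _ fun d hd => ?_
  rw [List.length_map, length_tuples, ← List.card_toFinset, ← List.card_toFinset]
  exact (Nat.pow_le_pow_left (hK.trans m.le_succ) _).trans
    (Nat.pow_le_pow_right m.succ_pos (card_head_le hC hd))

/-- The values of the head variables of the full constraints whose guard is matched to a fact of
`X`, and the arguments of the side facts: the facts derived by full constraints from facts of `X`,
from side facts or from facts derived so before have all their arguments in one of these lists. -/
noncomputable def supports (C : List (TGD Name)) (side : Finset Name) (X : List (Atom Name V)) :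
    List (List V) :=
  (X.flatMap fun F => (fullRules C).map fun d => (d.head.mapArgs (matching d.guard F)).args) ++
    (sideFacts C side (X.flatMap Atom.args)).map Atom.args

/-- A small set of facts which contains `X` and is closed under the full constraints and the derived
full dependencies. -/
noncomputable def closureBound (C : List (TGD Name)) (side : Finset Name) (X : List (Atom Name V)) :
    List (Atom Name V) :=
  X ++ (sideFacts C side (X.flatMap Atom.args) ++
    (supports C side X).flatMap fun K => sel (fun F => ∀ v ∈ F.args, v ∈ X.flatMap Atom.args)
      (headFacts C K))

theorem mem_closureBound {X : List (Atom Name V)} {F : Atom Name V} :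
    F ∈ closureBound C side X ↔ F ∈ X ∨ F ∈ sideFacts C side (X.flatMap Atom.args) ∨
      ∃ K ∈ supports C side X, F ∈ headFacts C K ∧ ∀ v ∈ F.args, v ∈ X.flatMap Atom.args := by
  simp only [closureBound, List.mem_append, List.mem_flatMap, mem_sel]

theorem args_of_mem_closureBound {X : List (Atom Name V)} {F : Atom Name V}
    (hF : F ∈ closureBound C side X) : ∀ v ∈ F.args, v ∈ X.flatMap Atom.args := by
  rcases mem_closureBound.1 hF with hF | hF | ⟨K, -, -, hF⟩
  · exact fun v hv => List.mem_flatMap.2 ⟨F, hF, hv⟩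
  · exact (mem_sideFacts.1 hF).2
  · exact hF

theorem shape_of_mem_closureBound {X : List (Atom Name V)} {F : Atom Name V}
    (hF : F ∈ closureBound C side X) :
    F ∈ X ∨ ∃ G ∈ atomsOf C, F.rel = G.rel ∧ F.args.length = G.args.length := by
  rcases mem_closureBound.1 hF with hF | hF | ⟨K, -, hF, -⟩
  · exact .inl hF
  · obtain ⟨⟨G, h1, -, h2⟩, -⟩ := mem_sideFacts.1 hF
    exact .inr ⟨G, h1, h2⟩
  · exact .inr (of_mem_headFacts hF).1

/-- A full constraint leads from facts with all their arguments in some list to such facts, and a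
derived full dependency leads to side facts. -/
theorem closureBound_closed {L : List GDep} (hL : ∀ d ∈ L, d ∈ candidates C side)
    (X : List (Atom Name V)) :
    ClosedUnder (consequences L) ((closureBound C side X).toFinset : Set (Atom Name V)) := by
  intro Y hY F hF
  obtain ⟨G, hG, d, hd, hap, rfl⟩ := mem_consequences.1 hF
  have hGU : G ∈ closureBound C side X := List.mem_toFinset.1 (hY G hG)
  have hsub : ∀ z ∈ d.head.args, matching d.guard G z ∈ G.args := fun z hz => by
    have h1 : matching d.guard G z ∈ (d.guard.mapArgs (matching d.guard G)).args :=
      Atom.mem_mapArgs.2 ⟨z, (guarded_of_mem_candidates (hL d hd)).2 z hz, rfl⟩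
    rwa [hap.1] at h1
  have hE : ∀ v ∈ (d.head.mapArgs (matching d.guard G)).args, v ∈ X.flatMap Atom.args := by
    intro v hv
    obtain ⟨z, hz, rfl⟩ := Atom.mem_mapArgs.1 hv
    exact args_of_mem_closureBound hGU _ (hsub z hz)
  refine List.mem_toFinset.2 (mem_closureBound.2 (.inr ?_))
  rcases List.mem_append.1 (hL d hd) with hd' | hd'
  · right
    rcases mem_closureBound.1 hGU with hG | hG | ⟨K, hK, hG, -⟩
    · refine ⟨_, List.mem_append_left _ (List.mem_flatMap.2 ⟨G, hG, List.mem_map.2 ⟨d, hd', rfl⟩⟩),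
        mem_headFacts hd' fun z hz => ?_, hE⟩
      exact Atom.mem_mapArgs.2 ⟨z, hz, rfl⟩
    · exact ⟨_, List.mem_append_right _ (List.mem_map.2 ⟨G, hG, rfl⟩), mem_headFacts hd' hsub, hE⟩
    · exact ⟨K, hK, mem_headFacts hd' fun z hz => (of_mem_headFacts hG).2 _ (hsub z hz), hE⟩
  · left
    simp only [List.mem_flatMap, List.mem_map] at hd'
    obtain ⟨τ, -, B, hB, rfl⟩ := hd'
    obtain ⟨⟨G', h1, h2, h3, h4⟩, -⟩ := mem_sideAtoms.1 hB
    exact mem_sideFacts.2 ⟨⟨G', h1, h2, h3, by simpa [Atom.mapArgs] using h4⟩, hE⟩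

/-- The bound is polynomial except for the factor `(h + a' + 1) ^ h`. -/
theorem length_closureBound_le (hC : Admissible S side w h C) (ha : ∀ r ∈ side, S.arity r ≤ a')
    (X : List (Atom Name V)) : (closureBound C side X).length ≤
      X.length + ((sideFacts C side (X.flatMap Atom.args)).length +
        (X.length * (fullRules C).length + (sideFacts C side (X.flatMap Atom.args)).length) *
          ((fullRules C).length * (h + a' + 1) ^ h)) := by
  have h1 : (supports C side X).length ≤
      X.length * (fullRules C).length + (sideFacts C side (X.flatMap Atom.args)).length := by
    rw [supports, List.length_append, List.length_map]
    exact Nat.add_le_add_right (length_flatMap_le _ _ fun F _ => (List.length_map _).le) _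
  have h2 : ∀ K ∈ supports C side X, K.toFinset.card ≤ h + a' := by
    intro K hK
    rcases List.mem_append.1 hK with hK | hK
    · simp only [List.mem_flatMap, List.mem_map] at hK
      obtain ⟨F, -, d, hd, rfl⟩ := hK
      have : (d.head.mapArgs (matching d.guard F)).args.toFinset =
          d.head.args.toFinset.image (matching d.guard F) := by
        ext v; simp [Atom.mapArgs]
      rw [this]
      exact Finset.card_image_le.trans ((card_head_le hC hd).trans (Nat.le_add_right _ _))
    · obtain ⟨F, hF, rfl⟩ := List.mem_map.1 hK
      obtain ⟨⟨G, hG, hs, -, hl⟩, -⟩ := mem_sideFacts.1 hF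
      refine (List.toFinset_card_le _).trans ?_
      rw [hl]
      exact (arity_le_of_mem hC ha hG hs).trans (Nat.le_add_left _ _)
  rw [closureBound, List.length_append, List.length_append]
  refine Nat.add_le_add_left (Nat.add_le_add_left ?_ _) _
  refine (length_flatMap_le _ _ fun K hK => ?_).trans (Nat.mul_le_mul_right _ h1)
  exact (sel_sublist _ _).length_le.trans (length_headFacts_le hC (h2 K hK))

end Bounds

/-! ### Running time of the linearization -/

/-- Families of admissible inputs for which the quantities that are exponential in the width, in the
head arity and in the number of side relations are polynomially bounded in the measure `M`. -/
structure Tractable {ι : Type} (a' : ℕ) (M : ι → ℕ) (S : ι → Signature Name)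
    (side : ι → Finset Name) (C : ι → List (TGD Name)) (w h : ι → ℕ) : Prop where
  admissible : ∀ i, Admissible (S i) (side i) (w i) (h i) (C i)
  arity_le : ∀ i, ∀ r ∈ side i, (S i).arity r ≤ a'
  width_pow : PolyLE M fun i => w i ^ w i
  two_pow : PolyLE M fun i => 2 ^ ((side i).card * (w i + 1) ^ a')
  head_pow : PolyLE M fun i => (h i + a' + 1) ^ h i

theorem Tractable.on {ι κ : Type} {a' : ℕ} {M : ι → ℕ} {S : ι → Signature Name}
    {side : ι → Finset Name} {C : ι → List (TGD Name)} {w h : ι → ℕ}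
    (H : Tractable a' M S side C w h) (r : κ → ι) :
    Tractable a' (fun k => M (r k)) (fun k => S (r k)) (fun k => side (r k)) (fun k => C (r k))
      (fun k => w (r k)) fun k => h (r k) :=
  ⟨fun _ => H.admissible _, fun _ => H.arity_le _, H.width_pow.on r, H.two_pow.on r,
    H.head_pow.on r⟩

/-- The representation of atoms, with a mark at the side relations. -/
abbrev encMarkedAtom {V : Type} (side : Finset Name) (eV : V → Data) : Atom Name V → Data :=
  encAtom (encMarked side) eV

namespace PTime

variable {ι V : Type} {M : ι → ℕ} {x : ι → Data} {eV : V → Data} {a' : ℕ} {S : ι → Signature Name}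
  {side : ι → Finset Name} {C : ι → List (TGD Name)} {w h : ι → ℕ}

theorem markedAtoms (hC : PTime M x fun i => encTGDs (encMarked (side i)) (C i)) :
    PTime M x fun i => encList (encMarkedAtom (side i) encName) (Linearization.atomsOf (C i)) :=
  hC.atomsOf (eR := fun i => encMarked (side i))

theorem markedRules (hC : PTime M x fun i => encTGDs (encMarked (side i)) (C i)) :
    PTime M x fun i => encList (encGDep (encMarked (side i))) (Linearization.fullRules (C i)) :=
  hC.fullRules (eR := fun i => encMarked (side i))

theorem sideFacts (H : Tractable a' M S side C w h)
    (hC : PTime M x fun i => encTGDs (encMarked (side i)) (C i)) {E : ι → List V}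
    (hE : PTime M x fun i => encList eV (E i)) :
    PTime M x fun i => encList (encMarkedAtom (side i) eV)
      (Linearization.sideFacts (C i) (side i) (E i)) := by
  have h1 := PTime.sel (e := fun i => encMarkedAtom (side i) encName) (fun i G => G.rel ∈ side i)
    hC.markedAtoms fun z hz hG => hG.left.left.congr
      (z := fun p => encProp (p.1.2.rel ∈ side p.1.1)) fun p => by
        simp only [encMarkedAtom, encAtom, encMarked, Data.left, encProp]
        congr
  refine PTime.flatMap (e := fun i => encMarkedAtom (side i) encName)
    (e' := fun i => encMarkedAtom (side i) eV)
    (fun i G => (Linearization.tuples (E i) G.args.length).map fun t => (⟨G.rel, t⟩ : Atom Name V))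
    h1 fun z hz hG => ?_
  have hEz : PTime _ z fun p => encList eV (E p.1.1) := hz.on hE
  have h2 := PTime.tuples (e := fun _ => encName) (e' := fun _ => eV) hG.args hEz
    ((((hE.size_le.add (.const 1)).pow a').on (fun p : {p : ι × Atom Name Name // _} => p.1.1)).mono
      fun p => by
        obtain ⟨h3, h4⟩ := mem_sel.1 p.2
        exact (pow_arity_le (H.admissible _) (H.arity_le _) h3 h4 _).trans (Nat.pow_le_pow_left
          (Nat.add_le_add_right (length_le_size_encList eV _) 1) _))
  exact PTime.map (e := fun _ => encList eV)
    (e' := fun p : {p : ι × Atom Name Name // _} => encMarkedAtom (side p.1.1) eV)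
    (fun p t => (⟨p.1.2.rel, t⟩ : Atom Name V)) h2 fun u hu ht => (hu.on hG).left.pair ht

theorem sideAtoms (H : Tractable a' M S side C w h)
    (hC : PTime M x fun i => encTGDs (encMarked (side i)) (C i)) {E : ι → List Name}
    (hE : PTime M x fun i => encList encName (E i)) :
    PTime M x fun i => encList (encMarkedAtom (side i) encName)
      (Linearization.sideAtoms (C i) (side i) (E i)) :=
  PTime.saturate_of_list (e := fun i => encMarkedAtom (side i) encName) (X := fun _ => [])
    (fun _ => encAtom_injective (encMarked_injective _) encName_injective)
    (PTime.listNil hC.size_input_le) (PTime.sideFacts H hC hE) (fun _ _ _ ha => ha)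
    (fun _ _ ha => absurd ha List.not_mem_nil) fun _ hz _ => hz.on (PTime.sideFacts H hC hE)

theorem types (H : Tractable a' M S side C w h)
    (hC : PTime M x fun i => encTGDs (encMarked (side i)) (C i)) :
    PTime M x fun i => encList (encGDep (encMarked (side i)))
      (Linearization.types (C i) (side i)) := by
  refine PTime.flatMap (e := fun i => encAtoms (encMarked (side i)))
    (e' := fun i => encGDep (encMarked (side i))) (l := fun i => Linearization.inclusions (C i)) _
    (hC.inclusions (eR := fun i => encMarked (side i))) fun z hz hq => ?_
  have hA : PTime _ z fun p => encMarkedAtom (side p.1.1) encName p.1.2.1 := hq.left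
  have hB : PTime _ z fun p => encMarkedAtom (side p.1.1) encName p.1.2.2 := hq.right
  have hc := hA.common (eR := fun p : {p : ι × Atom Name Name × Atom Name Name // _} =>
    encMarked (side p.1.1)) hB
  have ht := PTime.tuples (e := fun _ => encName) (e' := fun _ => encName) hc hc
    ((H.width_pow.on (fun p : {p : ι × Atom Name Name × Atom Name Name // _} => p.1.1)).mono
      fun p => pow_self_le (length_common_le (H.admissible _) p.2))
  refine PTime.flatMap (e := fun _ => encList encName)
    (e' := fun p : {p : ι × Atom Name Name × Atom Name Name // _} =>
      encGDep (encMarked (side p.1.1)))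
    _ ht fun u hu ht => ?_
  have hA' := (hu.on hA).renameVars
    (eR := fun p : {p : {p : ι × Atom Name Name × Atom Name Name // _} × List Name // _} =>
      encMarked (side p.1.1.1.1)) (hu.on hB) (hu.on hA) ht
  have hB' := (hu.on hA).renameVars
    (eR := fun p : {p : {p : ι × Atom Name Name × Atom Name Name // _} × List Name // _} =>
      encMarked (side p.1.1.1.1)) (hu.on hB) (hu.on hB) ht
  have hC' : PTime _ u fun p => encTGDs (encMarked (side p.1.1.1.1)) (C p.1.1.1.1) :=
    (hu.on hz).on hC
  have hs := PTime.sideAtoms ((H.on fun p : {p : ι × Atom Name Name × Atom Name Name // _} =>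
    p.1.1).on fun p : {p : {p : ι × Atom Name Name × Atom Name Name // _}
    × List Name // _} => p.1.1) hC' (hA'.common hB')
  have h2 := hs.subs (e := fun p : {p : {p : ι × Atom Name Name × Atom Name Name // _}
      × List Name // _} => encMarkedAtom (side p.1.1.1.1) encName)
    (((H.two_pow.on (fun p : {p : ι × Atom Name Name × Atom Name Name // _} => p.1.1)).on
      fun p : {p : {p : ι × Atom Name Name × Atom Name Name // _} × List Name // _} => p.1.1).mono
      fun p => Nat.pow_le_pow_right Nat.two_pos
        (length_sideAtoms_common_le (H.admissible _) (H.arity_le _) p.1.1.2 p.2))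
  exact PTime.map (e := fun p : {p : {p : ι × Atom Name Name × Atom Name Name // _}
      × List Name // _} => encList (encMarkedAtom (side p.1.1.1.1) encName))
    (e' := fun p => encGDep (encMarked (side p.1.1.1.1)))
    (fun p s => (⟨p.1.1.1.2.1.mapArgs (Linearization.renameVars p.1.1.1.2.1 p.1.1.1.2.2 p.1.2), s,
      p.1.1.1.2.2.mapArgs (Linearization.renameVars p.1.1.1.2.1 p.1.1.1.2.2 p.1.2)⟩ : GDep)) h2
    fun v hv hs => (hv.on hA').gdep hs (hv.on hB')

/-- The closure of facts under full constraints and derived full dependencies is computed in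
polynomial time. -/
theorem cl_of_candidates [Inhabited V] (H : Tractable a' M S side C w h)
    (hC : PTime M x fun i => encTGDs (encMarked (side i)) (C i)) (hV : Function.Injective eV)
    {L : ι → List GDep} (hL : PTime M x fun i => encList (encGDep (encMarked (side i))) (L i))
    (hLC : ∀ i, ∀ d ∈ L i, d ∈ candidates (C i) (side i)) {X : ι → List (Atom Name V)}
    (hX : PTime M x fun i => encList (encMarkedAtom (side i) eV) (X i)) :
    PTime M x fun i => encList (encMarkedAtom (side i) eV) (Linearization.cl (L i) (X i)) := by
  have hE : PTime M x fun i => encList eV ((X i).flatMap Atom.args) :=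
    PTime.flatMap (e := fun i => encMarkedAtom (side i) eV) (e' := fun _ => eV) _ hX
      fun z hz hF => hF.right
  have hsf := (PTime.sideFacts H hC hE).size_le.mono fun i => length_le_size_encList _ _
  have hXl := hX.size_le.mono fun i => length_le_size_encList _ _
  have hfr := hC.markedRules.size_le.mono fun i => length_le_size_encList _ _
  refine PTime.cl (eR := fun i => encMarked (side i)) (fun i => encMarked_injective _) hV hL hX
    (fun i => (closureBound (C i) (side i) (X i)).toFinset)
    (fun i => closureBound_closed (hLC i) (X i))
    (fun i F hF => List.mem_toFinset.2 (mem_closureBound.2 (.inl hF))) ?_ ?_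
  · exact (hXl.add (hsf.add (((hXl.mul hfr).add hsf).mul (hfr.mul H.head_pow)))).mono fun i =>
      (List.toFinset_card_le _).trans (length_closureBound_le (H.admissible i) (H.arity_le i) _)
  · have hN := (hC.markedAtoms.size_le.add hX.size_le).add hE.size_le
    refine ((((hN.add ((PolyLE.const 1).add (hN.mul (hN.add (.const 1))))).add (.const 1))).on
      (fun p : {p : ι × Atom Name V // p.2 ∈ (closureBound (C p.1) (side p.1) (X p.1)).toFinset} =>
        p.1.1)).mono fun p => ?_
    obtain ⟨⟨i, F⟩, hF⟩ := p
    have hF : F ∈ closureBound (C i) (side i) (X i) := List.mem_toFinset.1 hF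
    dsimp only
    set N := (encList (encMarkedAtom (side i) encName) (Linearization.atomsOf (C i))).size +
      (encList (encMarkedAtom (side i) eV) (X i)).size +
      (encList eV ((X i).flatMap Atom.args)).size with hNdef
    have h1 : (encMarked (side i) F.rel).size ≤ N ∧ F.args.length ≤ N := by
      have key : ∀ {T : Type} (e : T → Data) (G : Atom Name T),
          (encMarked (side i) G.rel).size ≤ (encMarkedAtom (side i) e G).size ∧
            G.args.length ≤ (encMarkedAtom (side i) e G).size := by
        intro T e G
        have := length_le_size_encList e G.args
        simp only [encMarkedAtom, encAtom, Data.size]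
        omega
      rcases shape_of_mem_closureBound hF with hF | ⟨G, hG, h1, h2⟩
      · have h3 := size_le_size_encList (encMarkedAtom (side i) eV) hF
        have := key eV F
        omega
      · have h3 := size_le_size_encList (encMarkedAtom (side i) encName) hG
        have := key encName G
        rw [h1, h2]
        omega
    have h2 : ∀ v ∈ F.args, (eV v).size ≤ N := fun v hv =>
      (size_le_size_encList eV (args_of_mem_closureBound hF v hv)).trans (Nat.le_add_left _ _)
    have h3 := size_encList_le eV F.args h2
    have h4 := Nat.mul_le_mul_right (N + 1) h1.2
    simp only [encAtom, Data.size]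
    omega

end PTime

namespace PTime

variable {ι V : Type} {M : ι → ℕ} {x : ι → Data} {eV : V → Data} {a' : ℕ} {S : ι → Signature Name}
  {side : ι → Finset Name} {C : ι → List (TGD Name)} {w h : ι → ℕ}

theorem derived (H : Tractable a' M S side C w h)
    (hC : PTime M x fun i => encTGDs (encMarked (side i)) (C i)) {L : ι → List GDep}
    (hL : PTime M x fun i => encList (encGDep (encMarked (side i))) (L i))
    (hLC : ∀ i, ∀ d ∈ L i, d ∈ candidates (C i) (side i)) :
    PTime M x fun i => encList (encGDep (encMarked (side i)))
      (Linearization.derived (C i) (side i) (L i)) := by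
  refine PTime.flatMap (e := fun i => encGDep (encMarked (side i)))
    (e' := fun i => encGDep (encMarked (side i))) _ (PTime.types H hC) fun z hz hτ => ?_
  have H' := H.on fun p : {p : ι × GDep // p.2 ∈ Linearization.types (C p.1) (side p.1)} => p.1.1
  have hC' : PTime _ z fun p => encTGDs (encMarked (side p.1.1)) (C p.1.1) := hz.on hC
  have hs := PTime.sideAtoms H' hC' (hτ.iface (eR := fun p :
    {p : ι × GDep // p.2 ∈ Linearization.types (C p.1) (side p.1)} => encMarked (side p.1.1)))
  have hX : PTime _ z fun p => encList (encMarkedAtom (side p.1.1) encName)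
      (p.1.2.head :: p.1.2.side) := hτ.head.pair hτ.side
  have hcl := PTime.cl_of_candidates H' hC' encName_injective (hz.on hL) (fun p => hLC p.1.1) hX
  have h1 := PTime.sel
    (e := fun p : {p : ι × GDep // p.2 ∈ Linearization.types (C p.1) (side p.1)} =>
      encMarkedAtom (side p.1.1) encName)
    (fun p F => F ∈ Linearization.cl (L p.1.1) (p.1.2.head :: p.1.2.side)) hs fun u hu hF =>
      hF.mem (e := fun p : {p : {p : ι × GDep // p.2 ∈ Linearization.types (C p.1) (side p.1)} ×
        Atom Name Name // _} => encMarkedAtom (side p.1.1.1.1) encName)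
        (fun _ => encAtom_injective (encMarked_injective _) encName_injective) (hu.on hcl)
  exact PTime.map (e := fun p : {p : ι × GDep // p.2 ∈ Linearization.types (C p.1) (side p.1)} =>
    encMarkedAtom (side p.1.1) encName) (e' := fun p => encGDep (encMarked (side p.1.1)))
    (fun p F => (⟨p.1.2.guard, p.1.2.side, F⟩ : GDep)) h1 fun u hu hF =>
      (hu.on hτ.guard).gdep (hu.on hτ.side) hF

theorem candidates (H : Tractable a' M S side C w h)
    (hC : PTime M x fun i => encTGDs (encMarked (side i)) (C i)) :
    PTime M x fun i => encList (encGDep (encMarked (side i)))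
      (candidates (C i) (side i)) := by
  refine PTime.append (e := fun i => encGDep (encMarked (side i))) hC.markedRules
    (PTime.flatMap (e := fun i => encGDep (encMarked (side i)))
      (e' := fun i => encGDep (encMarked (side i))) _ (PTime.types H hC) fun z hz hτ => ?_)
  have H' := H.on fun p : {p : ι × GDep // p.2 ∈ Linearization.types (C p.1) (side p.1)} => p.1.1
  have hC' : PTime _ z fun p => encTGDs (encMarked (side p.1.1)) (C p.1.1) := hz.on hC
  have hs := PTime.sideAtoms H' hC' (hτ.iface (eR := fun p :
    {p : ι × GDep // p.2 ∈ Linearization.types (C p.1) (side p.1)} => encMarked (side p.1.1)))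
  exact PTime.map (e := fun p : {p : ι × GDep // p.2 ∈ Linearization.types (C p.1) (side p.1)} =>
    encMarkedAtom (side p.1.1) encName) (e' := fun p => encGDep (encMarked (side p.1.1)))
    (fun p F => (⟨p.1.2.guard, p.1.2.side, F⟩ : GDep)) hs fun u hu hF =>
      (hu.on hτ.guard).gdep (hu.on hτ.side) hF

theorem rules (H : Tractable a' M S side C w h)
    (hC : PTime M x fun i => encTGDs (encMarked (side i)) (C i)) :
    PTime M x fun i => encList (encGDep (encMarked (side i)))
      (Linearization.rules (C i) (side i)) :=
  PTime.saturate_of_list (e := fun i => encGDep (encMarked (side i)))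
    (fun _ => encGDep_injective (encMarked_injective _)) hC.markedRules (PTime.candidates H hC)
    (fun _ Y => derived_subset_candidates Y) (fun _ _ ha => List.mem_append_left _ ha)
    fun _ hz hY => PTime.derived (H.on _) (hz.on hC) hY
      fun p d hd => List.mem_toFinset.1 (p.2.2 d hd)

theorem typeName {τ : ι → GDep} (b : Bool)
    (hτ : PTime M x fun i => encGDep (encMarked (side i)) (τ i)) :
    PTime M x fun i => encExt (.inr (typeName (side i) b (τ i))) :=
  (PTime.constTrue hτ.size_input_le).pair ((PTime.const hτ.size_input_le (encBool b)).pair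
    (PTime.serialize hτ))

theorem annotate [Inhabited V] (H : Tractable a' M S side C w h)
    (hC : PTime M x fun i => encTGDs (encMarked (side i)) (C i)) (hV : Function.Injective eV)
    {X : ι → List (Atom Name V)}
    (hX : PTime M x fun i => encList (encMarkedAtom (side i) eV) (X i)) :
    PTime M x fun i => encList (encAtom encExt eV)
      (Linearization.annotate (C i) (side i) (X i)) := by
  have hcl := PTime.cl_of_candidates H hC hV (PTime.rules H hC)
    (fun _ => rules_subset_candidates) hX
  refine PTime.append (e := fun _ => encAtom encExt eV) ?_ ?_
  · exact PTime.map (e := fun i => encMarkedAtom (side i) eV) (e' := fun _ => encAtom encExt eV)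
      (fun _ F => F.mapRel .inl) hcl fun z hz hF =>
        ((PTime.constFalse hF.size_input_le).pair hF.left.right).pair hF.right
  · refine PTime.flatMap (e := fun i => encMarkedAtom (side i) eV)
      (e' := fun _ => encAtom encExt eV) _ hcl fun z hz hF => ?_
    have h1 := PTime.sel
      (e := fun p : {p : ι × Atom Name V // _} => encGDep (encMarked (side p.1.1)))
      (fun p τ => τ.Applies
        (Linearization.cl (Linearization.rules (C p.1.1) (side p.1.1)) (X p.1.1)) p.1.2)
      (hz.on (PTime.types H hC)) fun u hu hτ =>
          PTime.applies (eR := fun p => encMarked (side p.1.1.1.1)) (fun _ => encMarked_injective _)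
            hV hτ ((hu.on hz).on hcl) (hu.on hF)
    exact PTime.map (e := fun p : {p : ι × Atom Name V // _} => encGDep (encMarked (side p.1.1)))
      (e' := fun _ => encAtom encExt eV)
      (fun p τ => (⟨.inr (Linearization.typeName (side p.1.1) false τ), p.1.2.args⟩ : Atom _ V)) h1
      fun u hu hτ => (PTime.typeName (side := fun p => side p.1.1.1.1) false hτ).pair
        (hu.on hF.right)

theorem linearized (H : Tractable a' M S side C w h)
    (hC : PTime M x fun i => encTGDs (encMarked (side i)) (C i)) :
    PTime M x fun i => encTGDs encExt (linearized (C i) (side i)) := by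
  refine PTime.flatMap (e := fun i => encGDep (encMarked (side i)))
    (e' := fun _ => encTGD encExt) _ (PTime.types H hC) fun z hz hτ => ?_
  have H' := H.on fun p : {p : ι × GDep // p.2 ∈ Linearization.types (C p.1) (side p.1)} => p.1.1
  have hC' : PTime _ z fun p => encTGDs (encMarked (side p.1.1)) (C p.1.1) := hz.on hC
  have hX : PTime _ z fun p => encList (encMarkedAtom (side p.1.1) encName)
      (p.1.2.head :: p.1.2.side) := hτ.head.pair hτ.side
  have hann := PTime.annotate H' hC' encName_injective hX
  have ht : PTime _ z fun p => encAtom encExt encName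
      ⟨.inr (Linearization.typeName (side p.1.1) false p.1.2), p.1.2.guard.args⟩ :=
    (PTime.typeName (side := fun p :
      {p : ι × GDep // p.2 ∈ Linearization.types (C p.1) (side p.1)} => side p.1.1) false hτ).pair
      hτ.guard.right
  have hg : PTime _ z fun p => encAtom encExt encName
      ⟨.inr (Linearization.typeName (side p.1.1) true p.1.2), p.1.2.head.args⟩ :=
    (PTime.typeName (side := fun p :
      {p : ι × GDep // p.2 ∈ Linearization.types (C p.1) (side p.1)} => side p.1.1) true hτ).pair
      hτ.head.right
  have hnil : ∀ {κ : Type} {M' : κ → ℕ} {x' : κ → Data} {y : κ → Data}, PTime M' x' y →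
      PTime M' x' fun i => .node (y i) .nil := fun hy => hy.pair (PTime.const hy.size_input_le .nil)
  refine ((hnil ht).pair (hnil hg)).pair ?_
  exact PTime.map (e := fun _ => encAtom encExt encName) (e' := fun _ => encTGD encExt)
    (fun (p : {p : ι × GDep // p.2 ∈ Linearization.types (C p.1) (side p.1)}) G =>
      (⟨[⟨.inr (Linearization.typeName (side p.1.1) true p.1.2), p.1.2.head.args⟩],
      [G]⟩ : TGD (Name ⊕ Name))) hann fun u hu hG => (hnil (hu.on hg)).pair (hnil hG)

end PTime

/-! ### The two algorithms -/

theorem size_encList_le_mul {α : Type} {e e' : α → Data} {c : ℕ} (hc : 1 ≤ c) {l : List α}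
    (h : ∀ a ∈ l, (e a).size ≤ c * (e' a).size) :
    (encList e l).size ≤ c * (encList e' l).size := by
  induction l with
  | nil => simpa [encList, Data.size] using hc
  | cons a l ih =>
    have h1 := h a List.mem_cons_self
    have h2 := ih fun b hb => h b (List.mem_cons_of_mem a hb)
    simp only [encList, Data.size, mul_add]
    omega

/-- Marking the side relations increases the size at most by a constant factor. -/
theorem size_encTGDs_encMarked_le (side : Finset Name) (C : List (TGD Name)) :
    (encTGDs (encMarked side) C).size ≤ 5 * constraintsSize C := by
  have h1 : ∀ A : Atom Name Name, (encAtom (encMarked side) encName A).size ≤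
      5 * (encAtom encName encName A).size := by
    intro A
    have := (encName A.rel).size_pos
    have h2 : ∀ b, (encBool b).size ≤ 3 := fun b => by cases b <;> simp [encBool, Data.size]
    have := h2 (decide (A.rel ∈ side))
    simp only [encAtom, encMarked, Data.size]
    omega
  refine size_encList_le_mul (by omega) fun δ _ => ?_
  have h2 := size_encList_le_mul (e := encAtom (encMarked side) encName)
    (e' := encAtom encName encName) (c := 5) (by omega) fun A (_ : A ∈ δ.body) => h1 A
  have h3 := size_encList_le_mul (e := encAtom (encMarked side) encName)
    (e' := encAtom encName encName) (c := 5) (by omega) fun A (_ : A ∈ δ.head) => h1 A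
  simp only [encTGD, Data.size]
  omega

theorem encTerm_injective : Function.Injective encTerm := by
  rintro (y | y) (z | z) hyz <;> simp only [encTerm, Data.node.injEq] at hyz
  · rw [encName_injective hyz.2]
  · exact absurd (encBool_injective hyz.1) (by simp)
  · exact absurd (encBool_injective hyz.1) (by simp)
  · rw [encName_injective hyz.2]

/-- The side relations that occur in the constraints. Only those are marked in the input. -/
noncomputable def occurring (C : List (TGD Name)) (side : Finset Name) : Finset Name :=
  {r ∈ side | ∃ A ∈ atomsOf C, A.rel = r}

theorem mem_occurring {C : List (TGD Name)} {side : Finset Name} {r : Name} :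
    r ∈ occurring C side ↔ r ∈ side ∧ ∃ A ∈ atomsOf C, A.rel = r := by simp [occurring]

theorem admissible_occurring {S : Signature Name} {side : Finset Name} {w h : ℕ}
    {C : List (TGD Name)} (hC : Admissible S side w h C) :
    Admissible S (occurring C side) w h C := fun δ hδ =>
  (hC δ hδ).imp_right <| Or.imp_right fun ⟨h1, h2, ⟨A, hA, hside⟩, h4⟩ =>
    ⟨h1, h2, ⟨A, hA, fun B hB hBA => mem_occurring.2 ⟨hside B hB hBA, B,
      List.mem_flatMap.2 ⟨δ, hδ, List.mem_append_left _ hB⟩, rfl⟩⟩, h4⟩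

theorem encTGDs_occurring (C : List (TGD Name)) (side : Finset Name) :
    encTGDs (encMarked (occurring C side)) C = encTGDs (encMarked side) C := by
  have hlist : ∀ {α : Type} {e e' : α → Data} {l : List α}, (∀ a ∈ l, e a = e' a) →
      encList e l = encList e' l := by
    intro α e e' l
    induction l with
    | nil => exact fun _ => rfl
    | cons a l ih =>
      intro h
      rw [encList, encList, h a List.mem_cons_self, ih fun b hb => h b (List.mem_cons_of_mem a hb)]
  have hatom : ∀ A ∈ atomsOf C, encAtom (encMarked (occurring C side)) encName A =
      encAtom (encMarked side) encName A := by
    intro A hA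
    have : A.rel ∈ occurring C side ↔ A.rel ∈ side := by
      rw [mem_occurring]
      exact and_iff_left ⟨A, hA, rfl⟩
    simp only [encAtom, encMarked, this]
  refine hlist fun δ hδ => ?_
  rw [encTGD, encTGD, hlist fun A hA => hatom A ?_, hlist fun A hA => hatom A ?_]
  · exact List.mem_flatMap.2 ⟨δ, hδ, List.mem_append_right _ hA⟩
  · exact List.mem_flatMap.2 ⟨δ, hδ, List.mem_append_left _ hA⟩

theorem annotate_nil {V : Type} [Inhabited V] (C : List (TGD Name)) (side : Finset Name) :
    annotate C side ([] : List (Atom Name V)) = [] := by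
  have h : cl (rules C side) ([] : List (Atom Name V)) = [] := by
    refine saturate_eq (n := 0) ?_
    simp [growing, consequences, runWhile]
  simp [annotate, triggers, h]

/-- The constraints that are inputs of the two algorithms, with the arity bound `a'` for the side
relations, which all occur in the constraints, and with a bound `n` for their number. -/
structure Input (a' : ℕ) where
  S : Signature Name
  side : Finset Name
  C : List (TGD Name)
  w : ℕ
  h : ℕ
  n : ℕ
  admissible : Admissible S side w h C
  arity_le : ∀ r ∈ side, S.arity r ≤ a'
  occurs : ∀ r ∈ side, ∃ A ∈ atomsOf C, A.rel = r
  card_le : side.card ≤ n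

/-- The exponent that bounds all exponential quantities. -/
def exponent (a' w h n : ℕ) : ℕ := w * w + n * (w + 1) ^ a' + (h + a' + 1) * h + 1

theorem pow_le_two_pow (m k : ℕ) : m ^ k ≤ 2 ^ (m * k) := by
  rw [pow_mul]
  exact Nat.pow_le_pow_left Nat.lt_two_pow_self.le k

theorem Input.tractable {a' : ℕ} {κ : Type} (I : κ → Input a') {M : κ → ℕ}
    (hM : ∀ k, 2 ^ exponent a' (I k).w (I k).h (I k).n ≤ M k) :
    Tractable a' M (fun k => (I k).S) (fun k => (I k).side) (fun k => (I k).C)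
      (fun k => (I k).w) fun k => (I k).h := by
  have key : ∀ k m, m ≤ exponent a' (I k).w (I k).h (I k).n → 2 ^ m ≤ M k :=
    fun k m hm => (Nat.pow_le_pow_right Nat.two_pos hm).trans (hM k)
  refine ⟨fun k => (I k).admissible, fun k => (I k).arity_le, PolyLE.self.mono fun k => ?_,
    PolyLE.self.mono fun k => ?_, PolyLE.self.mono fun k => ?_⟩
  · refine (pow_le_two_pow _ _).trans (key k _ ?_)
    simp only [exponent]
    omega
  · refine key k _ ?_
    have := Nat.mul_le_mul_right (((I k).w + 1) ^ a') (I k).card_le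
    simp only [exponent]
    omega
  · refine (pow_le_two_pow _ _).trans (key k _ ?_)
    simp only [exponent]
    omega

/-- The linear constraints are computed in polynomial time. -/
theorem ptime_linearized (a' : ℕ) :
    PTime (fun I : Input a' => constraintsSize I.C + 2 ^ exponent a' I.w I.h I.n)
      (fun I => encTGDs (encMarked I.side) I.C)
      fun I => encTGDs encExt (linearized I.C I.side) := by
  refine PTime.linearized (Input.tractable (fun I => I) fun I => Nat.le_add_left _ _) (PTime.id ?_)
  exact ((PolyLE.const 5).mul .self).mono fun I =>
    (size_encTGDs_encMarked_le _ _).trans (Nat.mul_le_mul_left 5 (Nat.le_add_right _ _))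

theorem two_le_querySize {Q : CQ Name} (hQ : Q ≠ []) : 2 ≤ querySize Q := by
  obtain ⟨A, Q, rfl⟩ := List.exists_cons_of_ne_nil hQ
  have := (encAtom encName encTerm A).size_pos
  simp only [querySize, encCQ, encList, Data.size]
  omega

/-- The marks of the relations of a query are found by comparison with the marked relations of the
constraints. -/
theorem PTime.markedQuery {κ : Type} {M : κ → ℕ} {x : κ → Data} {a' : ℕ} {I : κ → Input a'}
    {Q : κ → CQ Name} (hC : PTime M x fun k => encTGDs (encMarked (I k).side) (I k).C)
    (hQ : PTime M x fun k => encCQ encName (Q k)) :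
    PTime M x fun k => encList (encMarkedAtom (I k).side encTerm) (Q k) := by
  refine (PTime.map (e := fun _ => encAtom encName encTerm)
    (e' := fun k => encMarkedAtom (I k).side encTerm) (fun _ A => A) hQ fun z hz hA => ?_).congr
    fun k => by rw [List.map_id']
  have hr : PTime (fun p : {p : κ × Atom Name Term // p.2 ∈ Q p.1} => M p.1.1) z
      fun p => encName p.1.2.rel := hA.left
  have hm : PTime (fun p : {p : κ × Atom Name Term // p.2 ∈ Q p.1} => M p.1.1) z
      fun p => encProp (p.1.2.rel ∈ (I p.1.1).side) := by
    refine (PTime.exists_mem (e := fun p : {p : κ × Atom Name Term // p.2 ∈ Q p.1} =>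
      encMarkedAtom (I p.1.1).side encName) (fun p G => G.rel = p.1.2.rel ∧ G.rel ∈ (I p.1.1).side)
      (hz.on hC.markedAtoms) fun u hu hG => PTime.propAnd ?_ ?_).propCongr fun p => ?_
    · exact PTime.eq (e := fun _ => encName) (fun _ => encName_injective) hG.left.right (hu.on hr)
    · exact hG.left.left.congr fun p => by
        simp only [encMarkedAtom, encAtom, encMarked, Data.left, encProp]
        congr
    · constructor
      · rintro ⟨G, -, h1, h2⟩
        exact h1 ▸ h2
      · intro h
        obtain ⟨G, hG, h1⟩ := (I p.1.1).occurs _ h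
        exact ⟨G, hG, h1, h1.symm ▸ h⟩
  refine ((hm.pair hr).pair hA.right).congr fun p => ?_
  simp only [encMarkedAtom, encAtom, encMarked, Data.right, encProp]
  congr

/-- The linearized query is computed in polynomial time. -/
theorem ptime_annotate (a' : ℕ) :
    PTime (fun q : Input a' × CQ Name =>
        constraintsSize q.1.C + querySize q.2 ^ exponent a' q.1.w q.1.h q.1.n)
      (fun q => .node (encTGDs (encMarked q.1.side) q.1.C) (encCQ encName q.2))
      fun q => encCQ encExt (annotate q.1.C q.1.side q.2) := by
  have hsize : ∀ q : Input a' × CQ Name,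
      querySize q.2 ≤ querySize q.2 ^ exponent a' q.1.w q.1.h q.1.n :=
    fun q => Nat.le_self_pow (by simp [exponent]) _
  have hid := PTime.id (M := fun q : Input a' × CQ Name =>
      constraintsSize q.1.C + querySize q.2 ^ exponent a' q.1.w q.1.h q.1.n)
    (x := fun q => .node (encTGDs (encMarked q.1.side) q.1.C) (encCQ encName q.2))
    ((((PolyLE.const 5).mul .self).add (.const 1)).mono fun q => by
      have h1 := size_encTGDs_encMarked_le q.1.side q.1.C
      have h2 := hsize q
      simp only [querySize] at h2 ⊢
      simp only [Data.size]
      omega)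
  have hC : PTime _ _ fun q : Input a' × CQ Name => encTGDs (encMarked q.1.side) q.1.C := hid.left
  have hQ : PTime _ _ fun q : Input a' × CQ Name => encCQ encName q.2 := hid.right
  refine PTime.cond_cases (PTime.isEmpty hQ) ?_ ?_
  · -- the empty query, whose size is too small to bound anything
    refine ((PTime.const hid.size_input_le (encCQ encExt [])).reindex _).congr fun q => ?_
    rw [List.isEmpty_iff.1 q.2, annotate_nil]
  · have hQ' : ∀ q : {q : Input a' × CQ Name // q.2.isEmpty = false}, q.1.2 ≠ [] :=
      fun q hq => by simpa [hq] using q.2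
    refine PTime.annotate (Input.tractable (fun q : {q : Input a' × CQ Name //
      q.2.isEmpty = false} => q.1.1) fun q => ?_) (hC.reindex _) encTerm_injective
      ((PTime.markedQuery hC hQ).reindex _)
    exact (Nat.pow_le_pow_left (two_le_querySize (hQ' q)) _).trans (Nat.le_add_left _ _)

theorem ComputesWithin.mono {p : Prog} {x y : Data} {s t : ℕ} (h : ComputesWithin p x y s)
    (hst : s ≤ t) : ComputesWithin p x y t :=
  h.imp fun _ h => ⟨h.1.trans hst, h.2⟩

end Linearization

open Linearization in
theorem mainTheorem12 (a' : ℕ) :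
    ∃ (P₁ : MvPolynomial (Fin 2) ℕ) (P₂ : MvPolynomial (Fin 3) ℕ) (linProg queryProg : Prog),
      ∀ (S : Signature Name) (a : ℕ) (side : Finset Name) (C : List (TGD Name)) (w h : ℕ),
        (∀ r ∈ S.rels, S.arity r ≤ a) →
        (∀ r ∈ side, r ∈ S.rels ∧ S.arity r ≤ a') →
        Admissible S side w h C →
        ∃ (T : Signature (Name ⊕ Name)) (C' : List (TGD (Name ⊕ Name))),
          Extends T S ∧
          (∀ r ∈ T.rels, T.arity r ≤ a) ∧
          (∀ δ ∈ C', δ.Over T ∧ δ.IsLinear) ∧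
          SemiWidthLE {δ | δ ∈ C'} w ∧
          ComputesWithin linProg (encTGDs (encMarked side) C) (encTGDs encExt C')
            (MvPolynomial.eval
              ![constraintsSize C, 2 ^ MvPolynomial.eval ![w, h, side.card] P₂] P₁) ∧
          ∀ Q : CQ Name, Q.Over S →
            ∃ QLin : CQ (Name ⊕ Name),
              QLin.Over T ∧
              ComputesWithin queryProg
                (.node (encTGDs (encMarked side) C) (encCQ encName Q)) (encCQ encExt QLin)
                (MvPolynomial.eval
                  ![constraintsSize C, querySize Q ^ MvPolynomial.eval ![w, h, side.card] P₂]
                  P₁) ∧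
              ∀ Q' : CQ Name, Q'.Over S →
                (Contained S C Q Q' ↔ Contained T C' QLin (Q'.mapRel Sum.inl)) := by
  obtain ⟨linProg, k₁, hlin⟩ := ptime_linearized a'
  obtain ⟨queryProg, k₂, hquery⟩ := ptime_annotate a'
  obtain ⟨P₁, hP₁⟩ : ∃ P₁ : MvPolynomial (Fin 2) ℕ, ∀ u v : ℕ,
      MvPolynomial.eval ![u, v] P₁ = (u + v + 2) ^ (k₁ + k₂) :=
    ⟨(MvPolynomial.X 0 + MvPolynomial.X 1 + MvPolynomial.C 2) ^ (k₁ + k₂), fun u v => by simp⟩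
  obtain ⟨P₂, hP₂⟩ : ∃ P₂ : MvPolynomial (Fin 3) ℕ, ∀ w h n : ℕ,
      MvPolynomial.eval ![w, h, n] P₂ = exponent a' w h n :=
    ⟨MvPolynomial.X 0 * MvPolynomial.X 0 +
      MvPolynomial.X 2 * (MvPolynomial.X 0 + MvPolynomial.C 1) ^ a' +
      (MvPolynomial.X 1 + MvPolynomial.C a' + MvPolynomial.C 1) * MvPolynomial.X 1 +
      MvPolynomial.C 1, fun w h n => by simp [exponent]⟩
  refine ⟨P₁, P₂, linProg, queryProg, fun S a side C w h hS hside hC => ?_⟩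
  -- the marks of relations that do not occur in the constraints are not part of the input
  let I : Input a' :=
    { S := S, side := occurring C side, C := C, w := w, h := h, n := side.card
      admissible := admissible_occurring hC
      arity_le := fun r hr => (hside r (mem_occurring.1 hr).1).2
      occurs := fun r hr => (mem_occurring.1 hr).2
      card_le := Finset.card_filter_le _ _ }
  have hatom := atom_over I.admissible
  refine ⟨extended S C (occurring C side) hatom, linearized C (occurring C side),
    extended_extends, extended_arity_le hS, linearized_over I.admissible,
    linearized_semiWidth I.admissible, ?_, fun Q hQ =>
      ⟨annotate C (occurring C side) Q, fun A => annotate_over I.admissible hQ, ?_,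
        fun Q' _ => contained_iff I.admissible hatom hQ⟩⟩
  · rw [hP₂, hP₁, ← encTGDs_occurring]
    exact (hlin I).mono (Nat.pow_le_pow_right (by omega) (by omega))
  · rw [hP₂, hP₁, ← encTGDs_occurring]
    exact (hquery (I, Q)).mono (Nat.pow_le_pow_right (by omega) (by omega))
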